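/- For a graph $H$ with possible loops, let $\mathrm{mrc}(H)$ be the maximum number of pairwise adjacent vertices of $H$ each of which has a loop. An instance of $\mathrm{LHom}(H)$ is a (loopless, finite) graph $G$ with lists $L(v)\subseteq V(H)$, $v\in V(G)$; the question is whether there is a homomorphism $h:G\to H$ with $h(v)\in L(v)$ for every $v\in V(G)$. For a set $v$ in the plane let $r_{\mathrm{in},v}$ and $r_{\mathrm{out},v}$ be the radii of a largest disk inside $v$ and of a smallest disk containing $v$. For constants $\alpha,\beta>0$, a collection $V$ of non-degenerate closed triangles in the plane is $\alpha$-fat if $r_{\mathrm{in},v}/r_{\mathrm{out},v}\ge\alpha$ for all $v\in V$, and $\beta$-similarly-sized if $\mathrm{diam}(v)/\mathrm{diam}(w)\le\beta$ for all $v,w\in V$. The intersection graph of $V$ has vertex set $V$, two distinct triangles being adjacent if and only if they intersect. The Exponential-Time Hypothesis (ETH) says that there is $\delta>0$ such that 3-SAT on formulas $\varphi$ with $N$ variables cannot be decided in time $2^{\delta N}\cdot|\varphi|^{O(1)}$, where $|\varphi|$ is the input length. Theorem. Assume the ETH. Then there are a finite reflexive graph $H$ (every vertex has a loop) with $\mathrm{mrc}(H)=3$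 and constants $\alpha,\beta>0$ such that for no function $f:\mathbb N\to\mathbb R$ with $f(n)=o(n)$ is there an algorithm that solves $\mathrm{LHom}(H)$ on all $n$-vertex intersection graphs of $\alpha$-fat, $\beta$-similarly-sized triangles in time $2^{f(n)}\cdot|x|^{O(1)}$, even if the input $x$ contains, besides the graph and the lists, the triangles (given by corners with rational coordinates, written in binary); here $|x|$ is the length of the input. In particular, $\mathrm{LHom}(H)$ cannot be solved in time $2^{o(n)}$ on these graphs. -/

import Mathlib

open Asymptotics Filter

/-! ## Machine model: WHILE programs over binary trees, with a step count

Programs of the WHILE language (N. D. Jones) compute on binary trees.  Trees are immutable and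
shared, an operation looks at or allocates a single cell, and costs one step; there is no equality
test of trees.  The model simulates Turing machines, and is simulated by them, with polynomial
overhead. -/

/-- Binary trees, the data of WHILE programs. -/
inductive Data : Type
  | nil : Data
  | cons : Data → Data → Data

namespace Data

/-- Left component (`nil` for `nil`). -/
def hd : Data → Data
  | nil => nil
  | cons a _ => a

/-- Right component (`nil` for `nil`). -/
def tl : Data → Data
  | nil => nil
  | cons _ b => b

/-- The number of nodes of a tree: the length of the input that it encodes. -/
def size : Data → ℕ
  | nil => 1
  | cons a b => a.size + b.size + 1

end Data

/-- The contents of the variables `0, 1, 2, …` of a program. -/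
abbrev Store : Type := ℕ → Data

/-- Expressions. -/
inductive Expr : Type
  | var : ℕ → Expr
  | nil : Expr
  | cons : Expr → Expr → Expr
  | hd : Expr → Expr
  | tl : Expr → Expr

namespace Expr

/-- The value of an expression. -/
def eval (s : Store) : Expr → Data
  | var i => s i
  | nil => Data.nil
  | cons a b => Data.cons (a.eval s) (b.eval s)
  | hd a => (a.eval s).hd
  | tl a => (a.eval s).tl

/-- The number of steps for evaluating an expression: one for every operation. -/
def cost : Expr → ℕ
  | var _ => 1
  | nil => 1
  | cons a b => a.cost + b.cost + 1
  | hd a => a.cost + 1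
  | tl a => a.cost + 1

end Expr

/-- Programs: assignment, composition, conditional, and `while e ≠ nil do c`. -/
inductive Program : Type
  | assign : ℕ → Expr → Program
  | seq : Program → Program → Program
  | cond : Expr → Program → Program → Program
  | loop : Expr → Program → Program

/-- `Runs c s t s'`: started in the store `s`, the program `c` halts after exactly `t` steps in the
store `s'`. -/
inductive Runs : Program → Store → ℕ → Store → Prop
  | assign (i : ℕ) (e : Expr) (s : Store) :
      Runs (Program.assign i e) s (e.cost + 1) (Function.update s i (e.eval s))
  | seq {c d : Program} {s s' s'' : Store} {t t' : ℕ} :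
      Runs c s t s' → Runs d s' t' s'' → Runs (Program.seq c d) s (t + t') s''
  | condTrue {e : Expr} {c d : Program} {s s' : Store} {t : ℕ} :
      e.eval s ≠ Data.nil → Runs c s t s' → Runs (Program.cond e c d) s (e.cost + 1 + t) s'
  | condFalse {e : Expr} {c d : Program} {s s' : Store} {t : ℕ} :
      e.eval s = Data.nil → Runs d s t s' → Runs (Program.cond e c d) s (e.cost + 1 + t) s'
  | loopStop {e : Expr} {c : Program} {s : Store} :
      e.eval s = Data.nil → Runs (Program.loop e c) s (e.cost + 1) s
  | loopStep {e : Expr} {c : Program} {s s' s'' : Store} {t t' : ℕ} :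
      e.eval s ≠ Data.nil → Runs c s t s' → Runs (Program.loop e c) s' t' s'' →
        Runs (Program.loop e c) s (e.cost + 1 + t + t') s''

/-- The initial store on input `x`: the input is in variable `0`, all others hold `nil`. -/
def initStore (x : Data) : Store := fun i => if i = 0 then x else Data.nil

/-- The program `P` decides the problem with instances `i : ι` for which `valid i` holds, encoded
by `enc`, with yes-instances given by `yes`, and on every valid instance `i` it halts after at most
`time i` steps.  The answer is read from variable `0` (`nil` means no).  Nothing is required on
invalid instances. -/
def DecidesInTime {ι : Type} (P : Program) (enc : ι → Data) (valid yes : ι → Prop)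
    (time : ι → ℝ) : Prop :=
  ∀ i, valid i → ∃ (t : ℕ) (s : Store),
    Runs P (initStore (enc i)) t s ∧ (t : ℝ) ≤ time i ∧ (s 0 ≠ Data.nil ↔ yes i)

/-! ## Encodings -/

/-- Lists of trees. -/
def encList : List Data → Data
  | [] => Data.nil
  | a :: l => Data.cons a (encList l)

/-- Booleans. -/
def encBool : Bool → Data
  | false => Data.nil
  | true => Data.cons Data.nil Data.nil

/-- Natural numbers in binary, least significant bit first. -/
def encNat (n : ℕ) : Data := encList (n.bits.map encBool)

/-- Integers: the sign and the absolute value. -/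
def encInt (z : ℤ) : Data := Data.cons (encBool (decide (z < 0))) (encNat z.natAbs)

/-- Rationals: numerator and denominator. -/
def encRat (q : ℚ) : Data := Data.cons (encInt q.num) (encNat q.den)

/-! ## 3-SAT and the Exponential Time Hypothesis -/

/-- A 3-CNF formula with `numVars` variables: every clause is a triple of literals (repetitions
allowed), and a literal is a variable with a sign (`true` for the positive literal). -/
structure Formula3 : Type where
  numVars : ℕ
  clauses : List (Fin 3 → Fin numVars × Bool)

namespace Formula3

/-- Some truth assignment satisfies a literal of every clause. -/
def Satisfiable (φ : Formula3) : Prop :=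
  ∃ a : Fin φ.numVars → Bool, ∀ c ∈ φ.clauses, ∃ j : Fin 3, a (c j).1 = (c j).2

/-- The formula as an input. -/
def enc (φ : Formula3) : Data :=
  Data.cons (encNat φ.numVars) (encList (φ.clauses.map fun c =>
    encList (List.ofFn fun j : Fin 3 => Data.cons (encNat (c j).1) (encBool (c j).2))))

end Formula3

/-- The Exponential Time Hypothesis: for some `δ > 0`, no algorithm decides 3-SAT on formulas with
`N` variables in time `2 ^ (δ N)` times a polynomial of the input length. -/
def ExponentialTimeHypothesis : Prop :=
  ∃ δ : ℝ, 0 < δ ∧ ¬ ∃ (P : Program) (p : Polynomial ℕ),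
    DecidesInTime P Formula3.enc (fun _ => True) Formula3.Satisfiable
      (fun φ => (2 : ℝ) ^ (δ * (φ.numVars : ℝ)) * ((p.eval φ.enc.size : ℕ) : ℝ))

/-! ## Graphs with possible loops and list homomorphisms -/

/-- Graphs with possible loops. -/
structure LoopGraph (V : Type) : Type where
  Adj : V → V → Prop
  symm : ∀ u v, Adj u v → Adj v u

namespace LoopGraph

variable {V : Type}

/-- All vertices have loops. -/
def IsReflexive (H : LoopGraph V) : Prop := ∀ v, H.Adj v v

/-- A set of pairwise adjacent vertices, each of which has a loop. -/
def IsReflexiveClique (H : LoopGraph V) (S : Finset V) : Prop :=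
  (∀ v ∈ S, H.Adj v v) ∧ ∀ u ∈ S, ∀ v ∈ S, u ≠ v → H.Adj u v

/-- The size of a maximum reflexive clique of a (finite) graph. -/
noncomputable def mrc (H : LoopGraph V) : ℕ :=
  sSup {m : ℕ | ∃ S : Finset V, H.IsReflexiveClique S ∧ S.card = m}

end LoopGraph

/-! ## Fat, similarly-sized families of triangles -/

/-- The Euclidean plane. -/
abbrev Plane : Type := EuclideanSpace ℝ (Fin 2)

/-- The radius of a largest inscribed disk. -/
noncomputable def inRadius (v : Set Plane) : ℝ :=
  sSup {r : ℝ | 0 ≤ r ∧ ∃ c : Plane, Metric.closedBall c r ⊆ v}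

/-- The radius of a smallest circumscribed (that is, enclosing) disk. -/
noncomputable def outRadius (v : Set Plane) : ℝ :=
  sInf {r : ℝ | 0 ≤ r ∧ ∃ c : Plane, v ⊆ Metric.closedBall c r}

/-- Every object of the collection is fat, with constant `α`. -/
def IsFat (α : ℝ) (V : Set (Set Plane)) : Prop :=
  ∀ v ∈ V, α ≤ inRadius v / outRadius v

/-- The diameters of the objects of the collection differ by a factor of at most `β`. -/
def IsSimilarlySized (β : ℝ) (V : Set (Set Plane)) : Prop :=
  ∀ v ∈ V, ∀ w ∈ V, Metric.diam v / Metric.diam w ≤ β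

/-- An instance of the list homomorphism problem with target vertex set `Fin k`: a graph on `n`
vertices with lists, given along with three points of rational coordinates for every vertex. -/
structure TriangleInstance (k : ℕ) : Type where
  n : ℕ
  G : SimpleGraph (Fin n)
  L : Fin n → Finset (Fin k)
  corner : Fin n → Fin 3 → ℚ × ℚ

namespace TriangleInstance

variable {k : ℕ}

/-- The three corners of the triangle of `v`, as points of the plane. -/
noncomputable def point (I : TriangleInstance k) (v : Fin I.n) (j : Fin 3) : Plane :=
  !₂[((I.corner v j).1 : ℝ), ((I.corner v j).2 : ℝ)]

/-- The (closed) triangle that represents the vertex `v`. -/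
noncomputable def triangle (I : TriangleInstance k) (v : Fin I.n) : Set Plane :=
  convexHull ℝ (Set.range (I.point v))

/-- The graph of the instance is the intersection graph of its triangles, which are non-degenerate,
pairwise distinct, fat and similarly-sized with constants `α` and `β`. -/
structure IsValid (α β : ℝ) (I : TriangleInstance k) : Prop where
  nondegenerate : ∀ v, AffineIndependent ℝ (I.point v)
  distinct : Function.Injective I.triangle
  represents : ∀ u v, I.G.Adj u v ↔ u ≠ v ∧ (I.triangle u ∩ I.triangle v).Nonempty
  fat : IsFat α (Set.range I.triangle)
  similarlySized : IsSimilarlySized β (Set.range I.triangle)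

/-- There is a homomorphism from the graph of the instance to `H` that respects the lists. -/
def HasListHom (H : LoopGraph (Fin k)) (I : TriangleInstance k) : Prop :=
  ∃ h : Fin I.n → Fin k, (∀ u v, I.G.Adj u v → H.Adj (h u) (h v)) ∧ ∀ v, h v ∈ I.L v

open Classical in
/-- The instance as an input: for every vertex its triangle, its list, and its row of the adjacency
matrix. -/
noncomputable def enc (I : TriangleInstance k) : Data :=
  encList (List.ofFn fun v : Fin I.n =>
    Data.cons
      (encList (List.ofFn fun j : Fin 3 =>
        Data.cons (encRat (I.corner v j).1) (encRat (I.corner v j).2)))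
      (Data.cons
        (encList (List.ofFn fun a : Fin k => encBool (decide (a ∈ I.L v))))
        (encList (List.ofFn fun u : Fin I.n => encBool (decide (I.G.Adj v u))))))

end TriangleInstance

/-- The program `P` solves the list homomorphism problem with target `H` on intersection graphs of
`α`-fat, `β`-similarly-sized triangles, given with a representation; on `n` vertices it takes time
at most `2 ^ f n` times a polynomial of the input length. -/
def SolvesLHom {k : ℕ} (H : LoopGraph (Fin k)) (α β : ℝ) (f : ℕ → ℝ) (P : Program) : Prop :=
  ∃ p : Polynomial ℕ,
    DecidesInTime P TriangleInstance.enc (TriangleInstance.IsValid α β)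
      (TriangleInstance.HasListHom H)
      (fun I => (2 : ℝ) ^ f I.n * ((p.eval I.enc.size : ℕ) : ℝ))

/-! ## Polynomial-time computable functions -/

/-! The target is the reflexive octahedron: two triangles {0, 1, 2} and {3, 4, 5}, in which the only
non-adjacent pairs are x and x + 3. Lists split the vertices of an instance into two classes, each
coloured from one of the triangles. Within a class every pair of colours is adjacent, so
intersections there impose nothing; between the classes an edge says that the colours differ modulo
3 (`hasListHom_shapes_iff`). Only a bipartite pattern of intersections matters.

Fat triangles realize a rich bipartite pattern cheaply. One class consists of rows and columns, the
other of links, and the link for (a, b) meets exactly row a and column b. The tips of the rows lie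
on a parabola and those of the columns on its mirror image; a link spans two tips and a far corner
shared by all links. The tangent at the tip of a row separates it from all links that end at other
tips (`Shape.not_inter_row_link`). Since the part of the parabola that carries the tips is small
compared with the triangles, all of them are uniformly fat and similarly sized. Hence any incidence
between a row and a column costs a single vertex.

Through its list, a link imposes a binary constraint on its row and its column. A variable becomes
three columns tied together by two rows (`var_values`), and a clause becomes one row whose value
points to a true literal (`clause_ok`). With three links per row, K variables and m clauses give 11
K + 4 m triangles.

This is linear in the number of variables only if there are few clauses. Therefore the formula is
first sparsified, following Impagliazzo, Paturi and Zane: a set of literals contained in many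
clauses of the same length (the heart of a flower) either is hit, and is added as a clause, or is
missed, and all the remainders of these clauses (the petals) are added. A potential drops so much in
both branches that there are at most 2 ^ (ε N) leaves, each with O(N) clauses
(`Sparsify.Good.children_spec`, `Sparsify.exists_thresholds`, `exists_explores`). A depth-first
search which runs the assumed algorithm at the leaves (`exists_search`) then decides 3-SAT in time 2
^ (δ N) times a polynomial for every δ > 0, against the ETH.

The reduction itself has to be carried out by programs. It is composed from combinators for
`PolyTime`; coordinates are built from powers of two, so that their binary digits can be written
down from indices in unary, without arithmetic. -/

theorem eval_le_eval_of_le (p : Polynomial ℕ) {m n : ℕ} (h : m ≤ n) : p.eval m ≤ p.eval n := by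
  induction p using Polynomial.induction_on' with
  | add p q hp hq => simpa using Nat.add_le_add hp hq
  | monomial k a => simpa using Nat.mul_le_mul_left a (Nat.pow_le_pow_left h k)

/-- Types whose elements are encoded as trees. -/
class DataEnc (α : Type) where
  code : α → Data

open DataEnc

instance : DataEnc Bool := ⟨encBool⟩
instance {α : Type} [DataEnc α] : DataEnc (List α) := ⟨fun l => encList (l.map code)⟩
instance {α β : Type} [DataEnc α] [DataEnc β] : DataEnc (α × β) :=
  ⟨fun p => Data.cons (code p.1) (code p.2)⟩

instance {α : Type} [DataEnc α] {p : α → Prop} : DataEnc {a // p a} := ⟨fun a => code a.1⟩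

/-- The length of the encoding. -/
def codeSize {α : Type} [DataEnc α] (a : α) : ℕ := (code a).size

section
variable {α β γ σ : Type} [DataEnc α] [DataEnc β] [DataEnc γ] [DataEnc σ]

@[simp] theorem code_false : code false = Data.nil := rfl
@[simp] theorem code_true : code true = Data.cons Data.nil Data.nil := rfl
@[simp] theorem code_nil : code ([] : List α) = Data.nil := rfl
@[simp] theorem code_cons (a : α) (l : List α) : code (a :: l) = Data.cons (code a) (code l) := rfl
@[simp] theorem code_pair (p : α × β) : code p = Data.cons (code p.1) (code p.2) := rfl

theorem code_subtype {p : α → Prop} (a : {a // p a}) : code a = code a.1 := rfl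
theorem codeSize_subtype {p : α → Prop} (a : {a // p a}) : codeSize a = codeSize a.1 := rfl

@[simp] theorem codeSize_false : codeSize false = 1 := rfl
@[simp] theorem codeSize_true : codeSize true = 3 := rfl
@[simp] theorem codeSize_nil : codeSize ([] : List α) = 1 := rfl
@[simp] theorem codeSize_cons (a : α) (l : List α) :
    codeSize (a :: l) = codeSize a + codeSize l + 1 := rfl
@[simp] theorem codeSize_pair (p : α × β) : codeSize p = codeSize p.1 + codeSize p.2 + 1 := rfl

theorem codeSize_pos (a : α) : 1 ≤ codeSize a := by
  unfold codeSize; cases code a <;> simp [Data.size]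

theorem codeSize_bool_le (b : Bool) : codeSize b ≤ 3 := by cases b <;> simp

theorem length_lt_codeSize (l : List α) : l.length < codeSize l := by
  induction l with
  | nil => simp
  | cons a l ih => simp; have := codeSize_pos a; omega

theorem codeSize_append (l₁ l₂ : List α) :
    codeSize (l₁ ++ l₂) + 1 = codeSize l₁ + codeSize l₂ := by
  induction l₁ with
  | nil => simp; omega
  | cons a l ih => simp; omega

theorem codeSize_sublist {l₁ l₂ : List α} (h : l₁.Sublist l₂) : codeSize l₁ ≤ codeSize l₂ := by
  induction h with
  | slnil => simp
  | cons a _ ih => simp; omega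
  | cons_cons a _ ih => simp; omega

theorem codeSize_perm {l₁ l₂ : List α} (h : l₁.Perm l₂) : codeSize l₁ = codeSize l₂ := by
  induction h with
  | nil => simp
  | cons a _ ih => simp; omega
  | swap a b l => simp; omega
  | trans _ _ h₁ h₂ => omega

theorem codeSize_mem {a : α} {l : List α} (h : a ∈ l) : codeSize a + 2 ≤ codeSize l := by
  induction l with
  | nil => simp at h
  | cons b l ih =>
    rcases List.mem_cons.1 h with rfl | h
    · have := codeSize_pos l; simp; omega
    · have := ih h; simp; omega

theorem codeSize_map_le {α β : Type} [DataEnc β] (f : α → β) (l : List α) (B : ℕ)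
    (h : ∀ a ∈ l, codeSize (f a) ≤ B) :
    codeSize (l.map f) ≤ l.length * (B + 1) + 1 := by
  induction l with
  | nil => simp
  | cons a l ih =>
    have h1 := h a (by simp)
    have h2 := ih (fun b hb => h b (by simp [hb]))
    simp only [List.map_cons, codeSize_cons, List.length_cons]
    nlinarith

/-- `f` is computed in polynomial time: for every `i` there is a program that replaces the code of
`a` in the variable `i` by the code of `f a`, and does not touch the variables below `i`. -/
def PolyTime (f : α → β) : Prop :=
  ∃ (c : ℕ → Program) (p : Polynomial ℕ), ∀ (a : α) (i : ℕ) (s : Store), s i = code a →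
    ∃ (t : ℕ) (s' : Store), Runs (c i) s t s' ∧ s' i = code (f a) ∧ (∀ j < i, s' j = s j) ∧
      t ≤ p.eval (codeSize a) ∧ codeSize (f a) ≤ p.eval (codeSize a)

/-! ### Basic combinators. -/

namespace PolyTime

theorem id : PolyTime (fun a : α => a) := by
  refine ⟨fun i => Program.assign i (Expr.var i), Polynomial.X + 2, fun a i s h => ?_⟩
  refine ⟨_, _, Runs.assign _ _ _, by simp [Expr.eval, h], fun j hj => ?_, ?_, ?_⟩
  · simp [hj.ne]
  · simp [Expr.cost]
  · simp

/-- The size bound on `f a` that is part of `PolyTime` is what makes the running time of the second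
program polynomial in the size of `a`. -/
theorem comp {g : β → γ} {f : α → β} (hg : PolyTime g) (hf : PolyTime f) :
    PolyTime (fun a => g (f a)) := by
  obtain ⟨cg, pg, hg⟩ := hg
  obtain ⟨cf, pf, hf⟩ := hf
  refine ⟨fun i => Program.seq (cf i) (cg i), pf + pg.comp pf, fun a i s h => ?_⟩
  obtain ⟨t, s', r, e, fr, ht, hs⟩ := hf a i s h
  obtain ⟨t', s'', r', e', fr', ht', hs'⟩ := hg (f a) i s' e
  have := eval_le_eval_of_le pg hs
  refine ⟨_, _, Runs.seq r r', e', fun j hj => (fr' j hj).trans (fr j hj), ?_, ?_⟩ <;>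
    simp only [Polynomial.eval_add, Polynomial.eval_comp] <;> omega

theorem congr {f g : α → β} (hf : PolyTime f) (h : ∀ a, f a = g a) : PolyTime g := by
  rwa [funext h] at hf

/-- Changing the type of the result without changing its encoding. -/
theorem recode {f : α → β} {g : α → γ} (hf : PolyTime f) (h : ∀ a, code (g a) = code (f a)) :
    PolyTime g := by
  obtain ⟨c, p, hf⟩ := hf
  refine ⟨c, p, fun a i s hs => ?_⟩
  obtain ⟨t, s', r, e, fr, ht, hz⟩ := hf a i s hs
  exact ⟨t, s', r, e.trans (h a).symm, fr, ht, by rw [codeSize, h]; exact hz⟩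

/-- An assignment of an expression in the input computes in polynomial time. -/
theorem of_expr {f : α → β} (e : ℕ → Expr) (k m : ℕ) (hc : ∀ i, (e i).cost ≤ k)
    (he : ∀ a i (s : Store), s i = code a → (e i).eval s = code (f a))
    (hz : ∀ a, codeSize (f a) ≤ codeSize a + m) : PolyTime f := by
  refine ⟨fun i => Program.assign i (e i), Polynomial.X + ((k + m + 1 : ℕ) : Polynomial ℕ),
    fun a i s h => ?_⟩
  refine ⟨_, _, Runs.assign _ _ _, by simp [he a i s h], fun j hj => by simp [hj.ne], ?_, ?_⟩
  · have := hc i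
    simp only [Polynomial.eval_add, Polynomial.eval_natCast, Polynomial.eval_X, Nat.cast_id]; omega
  · have := hz a
    simp only [Polynomial.eval_add, Polynomial.eval_natCast, Polynomial.eval_X, Nat.cast_id]; omega

theorem fst : PolyTime (fun p : α × β => p.1) :=
  of_expr (fun i => Expr.hd (Expr.var i)) 2 0 (fun _ => by simp [Expr.cost])
    (fun a i s h => by simp [Expr.eval, h, Data.hd]) (fun p => by simp; omega)

theorem snd : PolyTime (fun p : α × β => p.2) :=
  of_expr (fun i => Expr.tl (Expr.var i)) 2 0 (fun _ => by simp [Expr.cost])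
    (fun a i s h => by simp [Expr.eval, h, Data.tl]) (fun p => by simp; omega)

theorem tail {f : α → List β} (hf : PolyTime f) : PolyTime (fun a => (f a).tail) :=
  comp (g := List.tail) (of_expr (fun i => Expr.tl (Expr.var i)) 2 0 (fun _ => by simp [Expr.cost])
    (fun a i s h => by cases a <;> simp [Expr.eval, h, Data.tl])
    (fun l => by cases l <;> simp; omega)) hf

end PolyTime

/-- An expression for a constant. -/
def Data.toExpr : Data → Expr
  | Data.nil => Expr.nil
  | Data.cons a b => Expr.cons a.toExpr b.toExpr

theorem Data.eval_toExpr (d : Data) (s : Store) : d.toExpr.eval s = d := by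
  induction d with
  | nil => rfl
  | cons a b ha hb => simp [Data.toExpr, Expr.eval, ha, hb]

namespace PolyTime

theorem const (b : β) : PolyTime (fun _ : α => b) :=
  of_expr (fun _ => (code b).toExpr) (code b).toExpr.cost (codeSize b) (fun _ => le_rfl)
    (fun _ _ s _ => (code b).eval_toExpr s) (fun _ => by omega)

/-- The argument stays in variable `i`, while copies of it are transformed in `i + 1` and `i + 2`.
Since programs respect the variables below their own, neither the argument nor the first result is
lost. -/
theorem pair {f : α → β} {g : α → γ} (hf : PolyTime f) (hg : PolyTime g) :
    PolyTime (fun a => (f a, g a)) := by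
  obtain ⟨cf, pf, hf⟩ := hf
  obtain ⟨cg, pg, hg⟩ := hg
  refine ⟨fun i => Program.seq (Program.assign (i + 1) (Expr.var i)) <|
    Program.seq (cf (i + 1)) <| Program.seq (Program.assign (i + 2) (Expr.var i)) <|
    Program.seq (cg (i + 2)) (Program.assign i (Expr.cons (Expr.var (i + 1)) (Expr.var (i + 2)))),
    pf + pg + 10, fun a i s h => ?_⟩
  obtain ⟨t, s', r, e, fr, ht, hs⟩ := hf a (i + 1) (Function.update s (i + 1) (s i)) (by simp [h])
  have e0 : s' i = code a := by rw [fr i (by omega)]; simp [h]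
  obtain ⟨t', s'', r', e', fr', ht', hs'⟩ :=
    hg a (i + 2) (Function.update s' (i + 2) (s' i)) (by simp [e0])
  refine ⟨_, _, Runs.seq (Runs.assign _ _ _) (Runs.seq r (Runs.seq (Runs.assign _ _ _)
    (Runs.seq r' (Runs.assign _ _ _)))), ?_, fun j hj => ?_, ?_, ?_⟩
  · simp [Expr.eval, e', fr' (i + 1) (by omega), e]
  · rw [Function.update_of_ne hj.ne, fr' j (by omega), Function.update_of_ne (by omega),
      fr j (by omega), Function.update_of_ne (by omega)]
  · simp [Expr.cost]; omega
  · simp; omega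

theorem fst' {f : α → β × γ} (hf : PolyTime f) : PolyTime (fun a => (f a).1) := comp fst hf

theorem snd' {f : α → β × γ} (hf : PolyTime f) : PolyTime (fun a => (f a).2) := comp snd hf

theorem cons {f : α → β} {g : α → List β} (hf : PolyTime f) (hg : PolyTime g) :
    PolyTime (fun a => f a :: g a) :=
  (pair hf hg).recode fun _ => rfl

/-- Each branch needs a program only for the inputs that reach it. This is used for `headD`, where
looking at the first cell is correct on nonempty lists only. -/
theorem cond_subtype {F : α → β} {e : α → γ} (he : PolyTime e) (b : α → Bool)
    (hb : ∀ a, code (e a) ≠ Data.nil ↔ b a = true)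
    (hf : PolyTime (fun a : {a // b a = true} => F a.1))
    (hg : PolyTime (fun a : {a // b a = false} => F a.1)) : PolyTime F := by
  obtain ⟨ce, pe, he⟩ := he
  obtain ⟨cf, pf, hf⟩ := hf
  obtain ⟨cg, pg, hg⟩ := hg
  refine ⟨fun i => Program.seq (Program.assign (i + 1) (Expr.var i)) <|
    Program.seq (ce (i + 1)) <| Program.cond (Expr.var (i + 1)) (cf i) (cg i),
    pe + pf + pg + 10, fun a i s h => ?_⟩
  obtain ⟨t, s', r, e', fr, ht, hs⟩ := he a (i + 1) (Function.update s (i + 1) (s i)) (by simp [h])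
  have e0 : s' i = code a := by rw [fr i (by omega)]; simp [h]
  have fr' : ∀ j < i, s' j = s j := fun j hj => by
    rw [fr j (by omega), Function.update_of_ne (by omega)]
  have := hb a
  cases hh : b a
  · obtain ⟨t2, s2, r2, e2, fr2, ht2, hs2⟩ := hg ⟨a, hh⟩ i s' e0
    change t2 ≤ pg.eval (codeSize a) at ht2
    change codeSize (F a) ≤ pg.eval (codeSize a) at hs2
    refine ⟨_, _, Runs.seq (Runs.assign _ _ _) (Runs.seq r (Runs.condFalse ?_ r2)), e2,
      fun j hj => (fr2 j hj).trans (fr' j hj), ?_, ?_⟩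
    · simp only [Expr.eval, e']; simpa [hh] using this
    · simp [Expr.cost]; omega
    · simp; omega
  · obtain ⟨t1, s1, r1, e1, fr1, ht1, hs1⟩ := hf ⟨a, hh⟩ i s' e0
    change t1 ≤ pf.eval (codeSize a) at ht1
    change codeSize (F a) ≤ pf.eval (codeSize a) at hs1
    refine ⟨_, _, Runs.seq (Runs.assign _ _ _) (Runs.seq r (Runs.condTrue ?_ r1)), e1,
      fun j hj => (fr1 j hj).trans (fr' j hj), ?_, ?_⟩
    · simp only [Expr.eval, e']; simpa [hh] using this
    · simp [Expr.cost]; omega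
    · simp; omega

theorem restrict {f : α → β} (hf : PolyTime f) (p : α → Prop) :
    PolyTime (fun a : {a // p a} => f a.1) := by
  obtain ⟨c, q, hf⟩ := hf
  exact ⟨c, q, fun a i s h => hf a.1 i s h⟩

theorem cond_data {f g : α → β} {e : α → γ} (he : PolyTime e) (b : α → Bool)
    (hb : ∀ a, code (e a) ≠ Data.nil ↔ b a = true) (hf : PolyTime f) (hg : PolyTime g) :
    PolyTime (fun a => bif b a then f a else g a) :=
  cond_subtype he b hb ((hf.restrict _).congr fun a => by simp [a.2])
    ((hg.restrict _).congr fun a => by simp [a.2])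

theorem cond {b : α → Bool} {f g : α → β} (hb : PolyTime b) (hf : PolyTime f) (hg : PolyTime g) :
    PolyTime (fun a => bif b a then f a else g a) :=
  cond_data hb b (fun a => by cases b a <;> simp) hf hg

theorem isEmpty {l : α → List β} (hl : PolyTime l) : PolyTime (fun a => (l a).isEmpty) :=
  (cond_data hl (fun a => !(l a).isEmpty) (fun a => by cases l a <;> simp)
    (const false) (const true)).congr fun a => by cases l a <;> simp

theorem and {b c : α → Bool} (hb : PolyTime b) (hc : PolyTime c) :
    PolyTime (fun a => b a && c a) :=
  (cond hb hc (const false)).congr fun a => by cases b a <;> simp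

theorem not {b : α → Bool} (hb : PolyTime b) : PolyTime (fun a => !b a) :=
  (cond hb (const false) (const true)).congr fun a => by cases b a <;> simp

theorem headD {f : α → List β} {d : α → β} (hf : PolyTime f) (hd : PolyTime d) :
    PolyTime (fun a => (f a).headD (d a)) := by
  have h : PolyTime (fun q : List β × β => q.1.headD q.2) := by
    refine cond_subtype fst (fun q => !q.1.isEmpty) (fun q => by cases q.1 <;> simp) ?_ ?_
    · refine of_expr (fun i => Expr.hd (Expr.hd (Expr.var i))) 3 0 (fun _ => by simp [Expr.cost])
        (fun a i s h => ?_) (fun a => ?_)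
      · obtain ⟨⟨_ | ⟨b, l⟩, d⟩, ha⟩ := a
        · simp at ha
        · simp [Expr.eval, h, Data.hd, code_subtype]
      · obtain ⟨⟨_ | ⟨b, l⟩, d⟩, ha⟩ := a
        · simp at ha
        · simp [codeSize_subtype]; omega
    · exact (snd.restrict _).congr fun a => by
        obtain ⟨⟨_ | ⟨b, l⟩, d⟩, ha⟩ := a <;> simp at ha ⊢
  exact comp (g := fun q : List β × β => q.1.headD q.2) h (pair hf hd)

/-- The only loop among the combinators, on which all later list operations rest. Iterating a
polynomial-time step can make the accumulator grow exponentially; `hB` excludes this by bounding its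
size after every prefix. Relative to `i`, variable 0 holds the argument, 1 the remaining list, 2 the
accumulator, and 3 onwards the workspace of a step. -/
theorem foldl {l : α → List β} {z : α → σ} {g : α → σ → β → σ} (hl : PolyTime l) (hz : PolyTime z)
    (hg : PolyTime (fun q : α × (σ × β) => g q.1 q.2.1 q.2.2)) (B : Polynomial ℕ)
    (hB : ∀ a l₁ l₂, l a = l₁ ++ l₂ → codeSize (l₁.foldl (g a) (z a)) ≤ B.eval (codeSize a)) :
    PolyTime (fun a => (l a).foldl (g a) (z a)) := by
  obtain ⟨cl, pl, hl⟩ := hl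
  obtain ⟨cz, pz, hz⟩ := hz
  obtain ⟨cg, pg, hg⟩ := hg
  let body : ℕ → Program := fun i =>
    Program.seq (Program.assign (i + 3) (Expr.cons (Expr.var i)
      (Expr.cons (Expr.var (i + 2)) (Expr.hd (Expr.var (i + 1)))))) <|
    Program.seq (cg (i + 3)) <|
    Program.seq (Program.assign (i + 2) (Expr.var (i + 3)))
      (Program.assign (i + 1) (Expr.tl (Expr.var (i + 1))))
  -- A bound for one round: the argument of `pg` dominates the size of the triple handed to the
  -- step, and 20 covers the assignments and the test.
  let q : Polynomial ℕ := pg.comp (Polynomial.X + B + pl + 2) + 20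
  have loop : ∀ (a : α) (i : ℕ) (l₂ l₁ : List β) (s : Store), l a = l₁ ++ l₂ → s i = code a →
      s (i + 1) = code l₂ → s (i + 2) = code (l₁.foldl (g a) (z a)) →
      codeSize (l a) ≤ pl.eval (codeSize a) →
      ∃ t s', Runs (Program.loop (Expr.var (i + 1)) (body i)) s t s' ∧
        s' (i + 2) = code ((l a).foldl (g a) (z a)) ∧ (∀ j < i, s' j = s j) ∧
        t ≤ (l₂.length + 1) * q.eval (codeSize a) := by
    intro a i l₂
    induction l₂ with
    | nil =>
      intro l₁ s h h0 h1 h2 _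
      refine ⟨_, _, Runs.loopStop (by simp [Expr.eval, h1]), ?_, fun _ _ => rfl, ?_⟩
      · rw [h2, h, List.append_nil]
      · simp [Expr.cost, q]
    | cons b l₂ ih =>
      intro l₁ s h h0 h1 h2 h3
      obtain ⟨t, s', r, e, fr, ht, hs⟩ := hg (a, l₁.foldl (g a) (z a), b) (i + 3)
        (Function.update s (i + 3) (Data.cons (s i) (Data.cons (s (i + 2)) (s (i + 1)).hd)))
        (by simp [h0, h1, h2, Data.hd])
      obtain ⟨t', s'', r', e', fr', ht'⟩ := ih (l₁ ++ [b])
        (Function.update (Function.update s' (i + 2) (s' (i + 3))) (i + 1) (s' (i + 1)).tl)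
        (by simp [h]) (by simp [fr i, h0]) (by simp [fr (i + 1), h1, Data.tl]) (by simp [e]) h3
      have hbody : Runs (body i) s _ _ := Runs.seq (Runs.assign _ _ _) (Runs.seq r
        (Runs.seq (Runs.assign _ _ _) (Runs.assign _ _ _)))
      simp only [Expr.eval, ne_eq, Nat.reduceEqDiff, not_false_eq_true,
        Function.update_of_ne, Nat.add_right_inj] at hbody
      refine ⟨_, s'', Runs.loopStep (by simp [Expr.eval, h1]) hbody r', e', fun j hj => ?_, ?_⟩
      · rw [fr' j hj, Function.update_of_ne (by omega), Function.update_of_ne (by omega),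
          fr j (by omega), Function.update_of_ne (by omega)]
      · have hb := hB a l₁ _ h
        have hm : b ∈ l a := by simp [h]
        have hm := codeSize_mem hm
        have : codeSize (a, l₁.foldl (g a) (z a), b) ≤
            (Polynomial.X + B + pl + 2).eval (codeSize a) := by
          simp; omega
        have := eval_le_eval_of_le pg this
        have hq : q.eval (codeSize a) =
          pg.eval ((Polynomial.X + B + pl + 2).eval (codeSize a)) + 20 := by simp [q]
        rw [List.length_cons, Nat.succ_mul]
        simp only [Expr.cost]
        omega
  refine ⟨fun i => Program.seq (Program.assign (i + 1) (Expr.var i)) <|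
    Program.seq (cl (i + 1)) <| Program.seq (Program.assign (i + 2) (Expr.var i)) <|
    Program.seq (cz (i + 2)) <| Program.seq (Program.loop (Expr.var (i + 1)) (body i))
      (Program.assign i (Expr.var (i + 2))),
    pl + pz + pl * q + q + B + 20, fun a i s h => ?_⟩
  obtain ⟨t, s', r, e, fr, ht, hs⟩ := hl a (i + 1) (Function.update s (i + 1) (s i)) (by simp [h])
  have e0 : s' i = code a := by rw [fr i (by omega)]; simp [h]
  obtain ⟨t', s'', r', e', fr', ht', hs'⟩ :=
    hz a (i + 2) (Function.update s' (i + 2) (s' i)) (by simp [e0])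
  obtain ⟨u, s₃, r₃, e₃, fr₃, ht₃⟩ := loop a i (l a) [] s'' rfl (by simp [fr' i, e0])
    (by simp [fr' (i + 1), e]) e' hs
  refine ⟨_, _, Runs.seq (Runs.assign _ _ _) (Runs.seq r (Runs.seq (Runs.assign _ _ _)
    (Runs.seq r' (Runs.seq r₃ (Runs.assign _ _ _))))), ?_, fun j hj => ?_, ?_, ?_⟩
  · simp [Expr.eval, e₃]
  · rw [Function.update_of_ne (by omega), fr₃ j hj, fr' j (by omega),
      Function.update_of_ne (by omega), fr j (by omega), Function.update_of_ne (by omega)]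
  · have h1 : (l a).length + 1 ≤ pl.eval (codeSize a) + 1 := by
      have := length_lt_codeSize (l a); omega
    have h2 := Nat.mul_le_mul_right (q.eval (codeSize a)) h1
    simp only [Expr.cost, Polynomial.eval_add, Polynomial.eval_mul, add_mul, one_mul] at h2 ht₃ ⊢
    simp only [Polynomial.eval_ofNat]
    omega
  · have := hB a (l a) [] (by simp)
    simp; omega

end PolyTime
end

/-! ### List operations and equality tests in polynomial time. -/

section
variable {α β γ σ : Type} [DataEnc α] [DataEnc β] [DataEnc γ] [DataEnc σ]

namespace PolyTime

theorem reverse {l : α → List β} (hl : PolyTime l) : PolyTime (fun a => (l a).reverse) := by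
  have key : ∀ (l acc : List β), l.foldl (fun acc b => b :: acc) acc = l.reverse ++ acc := by
    intro l; induction l <;> simp_all
  have h : PolyTime (fun l : List β => l.foldl (fun acc b => b :: acc) []) := by
    refine foldl (l := fun l : List β => l) (g := fun _ acc b => b :: acc) id (const [])
      (cons (snd' snd) (fst' snd)) Polynomial.X fun a l₁ l₂ h => ?_
    rw [key, List.append_nil, codeSize_perm l₁.reverse_perm, Polynomial.eval_X]
    exact codeSize_sublist (h ▸ List.sublist_append_left l₁ l₂)
  exact (comp h hl).congr fun a => by simp [key]

theorem foldr {l : α → List β} {z : α → σ} {g : α → β → σ → σ} (hl : PolyTime l) (hz : PolyTime z)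
    (hg : PolyTime (fun q : α × (σ × β) => g q.1 q.2.2 q.2.1)) (B : Polynomial ℕ)
    (hB : ∀ a l₁ l₂, l a = l₁ ++ l₂ → codeSize (l₂.foldr (g a) (z a)) ≤ B.eval (codeSize a)) :
    PolyTime (fun a => (l a).foldr (g a) (z a)) := by
  refine (foldl (g := fun a s b => g a b s) (reverse hl) hz hg B fun a l₁ l₂ h => ?_).congr
    fun a => List.foldl_reverse
  have := hB a l₂.reverse l₁.reverse (by rw [← List.reverse_append, ← h, List.reverse_reverse])
  rwa [List.foldr_reverse] at this

theorem map {l : α → List β} {f : α → β → γ} (hl : PolyTime l)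
    (hf : PolyTime (fun q : α × β => f q.1 q.2)) : PolyTime (fun a => (l a).map (f a)) := by
  have hl' := hl
  have hf' := hf
  obtain ⟨_, pl, hl⟩ := hl
  obtain ⟨_, pf, hf⟩ := hf
  refine (foldr (g := fun a b s => f a b :: s) hl' (const [])
    (cons (comp (g := fun q : α × β => f q.1 q.2) hf' (pair fst (snd' snd))) (fst' snd))
    (pl * (pf.comp (Polynomial.X + pl + 1) + 1) + 1) fun a l₁ l₂ h => ?_).congr fun a => ?_
  · obtain ⟨_, _, _, _, _, _, hs⟩ := hl a 0 (fun _ => code a) rfl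
    have h2 : ∀ b ∈ l₂, codeSize (f a b) ≤ pf.eval (codeSize a + pl.eval (codeSize a) + 1) := by
      intro b hb
      obtain ⟨_, _, _, _, _, _, hs'⟩ := hf (a, b) 0 (fun _ => code (a, b)) rfl
      refine hs'.trans (eval_le_eval_of_le _ ?_)
      have : b ∈ l a := by simp [h, hb]
      have := codeSize_mem this
      simp; omega
    have h3 := codeSize_map_le _ _ _ h2
    have h4 : l₂.length ≤ pl.eval (codeSize a) := by
      have := length_lt_codeSize (l a)
      simp [h] at this
      rw [h] at hs; omega
    rw [← List.map_eq_foldr]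
    refine h3.trans ?_
    simp only [Polynomial.eval_add, Polynomial.eval_mul, Polynomial.eval_comp, Polynomial.eval_X,
      Polynomial.eval_one]
    exact Nat.add_le_add_right (Nat.mul_le_mul_right _ h4) 1
  · exact (List.map_eq_foldr ..).symm

theorem filter {l : α → List β} {p : α → β → Bool} (hl : PolyTime l)
    (hp : PolyTime (fun q : α × β => p q.1 q.2)) : PolyTime (fun a => (l a).filter (p a)) := by
  have hl' := hl
  obtain ⟨_, pl, hl⟩ := hl
  have key : ∀ a (l : List β),
      l.foldr (fun b s => bif p a b then b :: s else s) [] = l.filter (p a) := by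
    intro a l; induction l with
    | nil => rfl
    | cons b l ih => cases h : p a b <;> simp [h, ih]
  refine (foldr (g := fun a b s => bif p a b then b :: s else s) hl' (const [])
    (cond (comp (g := fun q : α × β => p q.1 q.2) hp (pair fst (snd' snd)))
      (cons (snd' snd) (fst' snd)) (fst' snd)) pl fun a l₁ l₂ h => ?_).congr fun a => key a (l a)
  obtain ⟨_, _, _, _, _, _, hs⟩ := hl a 0 (fun _ => code a) rfl
  rw [key]
  refine (codeSize_sublist ?_).trans hs
  rw [h]
  exact List.filter_sublist.trans (List.sublist_append_right _ _)

theorem append {f g : α → List β} (hf : PolyTime f) (hg : PolyTime g) :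
    PolyTime (fun a => f a ++ g a) := by
  have h : PolyTime (fun q : List β × List β => q.1.foldr List.cons q.2) := by
    refine foldr (g := fun _ => List.cons) fst snd (cons (snd' snd) (fst' snd)) Polynomial.X
      fun q l₁ l₂ h => ?_
    rw [List.foldr_cons_eq_append, List.map_id']
    have := codeSize_append l₂ q.2
    have := codeSize_append l₁ l₂
    have := codeSize_pos l₁
    simp [h]; omega
  exact (comp h (pair hf hg)).congr fun a => by simp

theorem flatten {l : α → List (List β)} (hl : PolyTime l) : PolyTime (fun a => (l a).flatten) := by
  have key : ∀ l : List (List β), l.foldr (fun b s => b ++ s) [] = l.flatten := by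
    intro l; induction l <;> simp_all
  have h : PolyTime (fun l : List (List β) => l.foldr (fun b s => b ++ s) []) := by
    refine foldr (l := fun l : List (List β) => l) (g := fun _ b s => b ++ s) id (const [])
      (append (snd' snd) (fst' snd)) Polynomial.X fun a l₁ l₂ h => ?_
    rw [key, Polynomial.eval_X]
    refine le_trans ?_ (codeSize_sublist (h ▸ List.sublist_append_right l₁ l₂))
    clear h
    induction l₂ with
    | nil => simp
    | cons b l ih => have := codeSize_append b l.flatten; simp; omega
  exact (comp h hl).congr fun a => key _

theorem flatMap {l : α → List β} {f : α → β → List γ} (hl : PolyTime l)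
    (hf : PolyTime (fun q : α × β => f q.1 q.2)) : PolyTime (fun a => (l a).flatMap (f a)) :=
  (flatten (map hl hf)).congr fun a => by rw [List.flatMap]

theorem any {l : α → List β} {p : α → β → Bool} (hl : PolyTime l)
    (hp : PolyTime (fun q : α × β => p q.1 q.2)) : PolyTime (fun a => (l a).any (p a)) :=
  (not (isEmpty (filter hl hp))).congr fun a => by
    generalize l a = l
    induction l with
    | nil => rfl
    | cons b l ih => cases h : p a b <;> simp_all

theorem all {l : α → List β} {p : α → β → Bool} (hl : PolyTime l)
    (hp : PolyTime (fun q : α × β => p q.1 q.2)) : PolyTime (fun a => (l a).all (p a)) :=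
  (not (any hl (p := fun a b => !p a b) (not hp))).congr fun a => by simp [List.not_any_eq_all_not]

/-- Lists serve as unary numbers, and dropping is their subtraction; in this way lengths are
compared and exponents subtracted later. -/
theorem drop {f : α → List β} {l : α → List γ} (hf : PolyTime f) (hl : PolyTime l) :
    PolyTime (fun a => (l a).drop (f a).length) := by
  have key : ∀ (l : List β) (m : List γ), l.foldl (fun s _ => s.tail) m = m.drop l.length := by
    intro l
    induction l with
    | nil => simp
    | cons b l ih => intro m; rw [List.foldl_cons, ih, List.drop_tail, List.length_cons]
  have h : PolyTime (fun q : List β × List γ => q.1.foldl (fun s _ => s.tail) q.2) := by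
    refine foldl (g := fun _ (s : List γ) _ => s.tail) fst snd (tail (fst' snd)) Polynomial.X
      fun q l₁ l₂ h => ?_
    rw [key]
    have := codeSize_sublist (List.drop_sublist l₁.length q.2)
    simp; omega
  exact (comp h (pair hf hl)).congr fun a => key _ _

end PolyTime

/-- Equality can be tested in polynomial time. -/
class PolyTimeEq (β : Type) [DataEnc β] [DecidableEq β] : Prop where
  polyTime : PolyTime (fun q : β × β => decide (q.1 = q.2))

theorem PolyTime.eq [DecidableEq β] [PolyTimeEq β] {f g : α → β} (hf : PolyTime f)
    (hg : PolyTime g) : PolyTime (fun a => decide (f a = g a)) :=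
  comp PolyTimeEq.polyTime (pair hf hg)

instance : PolyTimeEq Bool := ⟨(PolyTime.cond .fst .snd (.not .snd)).congr fun q => by
  rcases q with ⟨_ | _, _ | _⟩ <;> rfl⟩

instance [DecidableEq β] [DecidableEq γ] [PolyTimeEq β] [PolyTimeEq γ] : PolyTimeEq (β × γ) :=
  ⟨(PolyTime.and (.eq (.fst' .fst) (.fst' .snd)) (.eq (.snd' .fst) (.snd' .snd))).congr fun q => by
    simp [Prod.ext_iff]⟩

/-- Trees cannot be compared in one step. A fold along the first list consumes the second, with a
flag telling whether all heads agreed so far; the lists are equal if the flag survives and nothing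
remains. The default of `headD` is harmless, as emptiness is tested separately. -/
instance [DecidableEq β] [PolyTimeEq β] : PolyTimeEq (List β) := by
  let g : Bool × List β → β → Bool × List β := fun s b =>
    (s.1 && (!s.2.isEmpty && decide (s.2.headD b = b)), s.2.tail)
  have key : ∀ (l m : List β) (b : Bool), ((l.foldl g (b, m)).1 && (l.foldl g (b, m)).2.isEmpty) =
      (b && decide (l = m)) := by
    intro l
    induction l with
    | nil => intro m b; cases m <;> simp
    | cons a l ih =>
      intro m b
      rw [List.foldl_cons, ih]
      cases m with
      | nil => simp
      | cons c m =>
        rw [Bool.eq_iff_iff]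
        simp [List.cons.injEq, eq_comm (a := a), and_assoc]
        exact fun _ _ => ⟨fun h => of_decide_eq_true h, fun h => decide_eq_true h⟩
  have hz : ∀ (l m : List β) (b : Bool), codeSize (l.foldl g (b, m)) ≤ codeSize m + 4 := by
    intro l
    induction l with
    | nil => intro m b; have := codeSize_bool_le b; simp; omega
    | cons a l ih =>
      intro m b
      exact (ih _ _).trans (Nat.add_le_add_right (codeSize_sublist (List.tail_sublist m)) 4)
  have hf : PolyTime (fun q : List β × List β => q.1.foldl g (true, q.2)) := by
    refine .foldl (g := fun _ => g) .fst (.pair (.const true) .snd) ?_ (Polynomial.X + 4)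
      fun q l₁ l₂ h => ?_
    · exact .pair (.and (.fst' (.fst' .snd)) (.and (.not (.isEmpty (.snd' (.fst' .snd))))
        (.eq (.headD (.snd' (.fst' .snd)) (.snd' .snd)) (.snd' .snd)))) (.tail (.snd' (.fst' .snd)))
    · refine (hz _ _ _).trans ?_
      simp; omega
  exact ⟨(PolyTime.and (.fst' hf) (.isEmpty (.snd' hf))).congr fun q => by
    rw [key]; simp⟩

theorem PolyTime.mem [DecidableEq β] [PolyTimeEq β] {f : α → β} {l : α → List β} (hf : PolyTime f)
    (hl : PolyTime l) : PolyTime (fun a => decide (f a ∈ l a)) :=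
  (PolyTime.any hl (p := fun a b => decide (f a = b)) (.eq (.comp hf .fst) .snd)).congr fun a => by
    rw [Bool.eq_iff_iff, List.any_eq_true]
    exact ⟨fun ⟨b, h, e⟩ => by simpa [of_decide_eq_true e] using h,
      fun h => ⟨f a, of_decide_eq_true h, by simp⟩⟩

/-- Comparing the length of a list with a constant. -/
theorem PolyTime.le_length {l : α → List β} (hl : PolyTime l) (k : ℕ) :
    PolyTime (fun a => decide (k ≤ (l a).length)) := by
  induction k generalizing l with
  | zero => exact (const true).congr fun a => by simp
  | succ k ih =>
    exact (and (not (isEmpty hl)) (ih (tail hl))).congr fun a => by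
      cases l a with
      | nil => simp
      | cons b l =>
        simp only [List.isEmpty_cons, Bool.not_false, Bool.true_and, List.tail_cons]
        exact decide_eq_decide.2 (by simp)

theorem PolyTime.length_eq {l : α → List β} (hl : PolyTime l) (k : ℕ) :
    PolyTime (fun a => decide ((l a).length = k)) :=
  (and (le_length hl k) (not (le_length hl (k + 1)))).congr fun a => by
    rw [Bool.eq_iff_iff]; simp; omega

end

/-! ## Sparsification of set systems -/

namespace Sparsify

set_option linter.unusedSectionVars false

variable {α : Type} [DecidableEq α]

/-- Inclusion of lists, as sets. -/
def sub (h C : List α) : Bool := h.all fun l => decide (l ∈ C)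

theorem sub_iff {h C : List α} : sub h C = true ↔ h ⊆ C := by
  simp [sub, List.subset_def]

/-- Adding the clauses `P`, and removing those that they subsume. -/
def addAll (P φ : List (List α)) : List (List α) :=
  P ++ φ.filter fun C => !P.any fun p => sub p C

/-- The clauses of length `i` that contain `h`. -/
def flower (i : ℕ) (h : List α) (φ : List (List α)) : List (List α) :=
  φ.filter fun C => decide (C.length = i) && sub h C

/-- The clauses of a flower, without its heart. -/
def petals (h : List α) (F : List (List α)) : List (List α) :=
  F.map fun C => C.filter fun l => !decide (l ∈ h)

/-- The one-element subclauses. -/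
def hearts₁ (φ : List (List α)) : List (List α) := φ.flatMap fun C => C.map fun l => [l]

/-- The two-element subclauses. -/
def hearts₂ (φ : List (List α)) : List (List α) :=
  φ.flatMap fun C => C.flatMap fun a => (C.filter fun b => !decide (b = a)).map fun b => [a, b]

/-- The flowers, with their hearts, that are large enough for branching. -/
def select (c e d : ℕ) (φ : List (List α)) : List (List (List α) × List α) :=
  ((hearts₁ φ).map fun h => (flower 2 h φ, h)).filter (fun q => decide (c ≤ q.1.length)) ++
  (((hearts₂ φ).map fun h => (flower 3 h φ, h)).filter (fun q => decide (e ≤ q.1.length)) ++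
  ((hearts₁ φ).map fun h => (flower 3 h φ, h)).filter (fun q => decide (d ≤ q.1.length)))

/-- The two systems obtained from a flower. -/
def branch (q : List (List α) × List α) (φ : List (List α)) : List (List (List α)) :=
  [addAll [q.2] φ, addAll (petals q.2 q.1) φ]

/-- One step of the sparsification. -/
def children (c e d : ℕ) (φ : List (List α)) : List (List (List α)) :=
  bif (select c e d φ).isEmpty then [] else branch ((select c e d φ).headD ([], [])) φ

/-- The set `S` meets all clauses. -/
def Hits (S : α → Prop) (φ : List (List α)) : Prop := ∀ C ∈ φ, ∃ l ∈ C, S l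

theorem hits_addAll {S : α → Prop} {P φ : List (List α)} (h : Hits S (addAll P φ)) : Hits S φ := by
  intro C hC
  by_cases hp : ∃ p ∈ P, p ⊆ C
  · obtain ⟨p, hp, hs⟩ := hp
    obtain ⟨l, hl, hS⟩ := h p (by simp [addAll, hp])
    exact ⟨l, hs hl, hS⟩
  · refine h C ?_
    simp only [addAll, List.mem_append, List.mem_filter]
    exact Or.inr ⟨hC, by simpa [sub_iff] using hp⟩

theorem Hits.add {S : α → Prop} {P φ : List (List α)} (hP : Hits S P) (h : Hits S φ) :
    Hits S (addAll P φ) := by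
  intro C hC
  rcases List.mem_append.1 hC with hC | hC
  · exact hP C hC
  · exact h C (List.mem_filter.1 hC).1

/-- If `S` misses the heart, then it hits each clause of the flower outside the heart, that is, in
its petal. -/
theorem hits_branch (S : α → Prop) (i : ℕ) (h : List α) (φ : List (List α)) :
    Hits S φ ↔ Hits S (addAll [h] φ) ∨ Hits S (addAll (petals h (flower i h φ)) φ) := by
  refine ⟨fun hS => ?_, fun hS => hS.elim hits_addAll hits_addAll⟩
  by_cases hh : ∃ l ∈ h, S l
  · exact Or.inl (Hits.add (by simpa [Hits] using hh) hS)
  · refine Or.inr (Hits.add ?_ hS)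
    intro p hp
    obtain ⟨C, hC, rfl⟩ := List.mem_map.1 hp
    obtain ⟨l, hl, hSl⟩ := hS C (List.mem_filter.1 hC).1
    exact ⟨l, List.mem_filter.2 ⟨hl, by simpa using fun h' => hh ⟨l, h', hSl⟩⟩, hSl⟩

/-- Systems of clauses of length at most three over `U`, none of which contains another. -/
structure Good (U : Finset α) (φ : List (List α)) : Prop where
  nodup : ∀ C ∈ φ, C.Nodup
  ne_nil : ∀ C ∈ φ, C ≠ []
  length_le : ∀ C ∈ φ, C.length ≤ 3
  mem : ∀ C ∈ φ, ∀ l ∈ C, l ∈ U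
  antichain : φ.Pairwise fun C D => ¬ C ⊆ D ∧ ¬ D ⊆ C

/-- The number of clauses of length `i` containing `h`. -/
def deg (i : ℕ) (h : List α) (φ : List (List α)) : ℕ := (flower i h φ).length

/-- The number of clauses of length `i`. -/
def cnt (i : ℕ) (φ : List (List α)) : ℕ := (φ.filter fun C => decide (C.length = i)).length

variable {U : Finset α} {φ P : List (List α)}

theorem Good.eq_of_subset (hφ : Good U φ) {C D : List α} (hC : C ∈ φ) (hD : D ∈ φ) (h : C ⊆ D) :
    C = D := by
  by_contra hne
  have : Std.Symm fun C D : List α => ¬ C ⊆ D ∧ ¬ D ⊆ C := ⟨fun _ _ h => ⟨h.2, h.1⟩⟩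
  exact (hφ.antichain.forall hC hD hne).1 h

theorem subset_of_length_le {p C : List α} (hp : p.Nodup) (h : p ⊆ C)
    (hl : C.length ≤ p.length) : C ⊆ p :=
  ((hp.subperm h).perm_of_length_le hl).symm.subset

/-- Antichains that can be added to `φ`. -/
structure Addable (φ P : List (List α)) : Prop where
  nodup : ∀ p ∈ P, p.Nodup
  ne_nil : ∀ p ∈ P, p ≠ []
  antichain : P.Pairwise fun C D => ¬ C ⊆ D ∧ ¬ D ⊆ C
  below : ∀ p ∈ P, ∃ C ∈ φ, p ⊆ C ∧ ¬ C ⊆ p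

/-- An added clause lies strictly below an old one, so an old clause inside it would contradict the
antichain property. -/
theorem Good.not_subset (hφ : Good U φ) (hP : Addable φ P) {p C : List α} (hp : p ∈ P)
    (hC : C ∈ φ) : ¬ C ⊆ p := by
  intro h
  obtain ⟨D, hD, h1, h2⟩ := hP.below p hp
  rw [hφ.eq_of_subset hC hD (List.Subset.trans h h1)] at h
  exact h2 h

theorem Good.add (hφ : Good U φ) (hP : Addable φ P) : Good U (addAll P φ) := by
  have hor : ∀ C ∈ addAll P φ, C ∈ P ∨ C ∈ φ := fun C hC =>
    (List.mem_append.1 hC).imp (fun h => h) fun h => (List.mem_filter.1 h).1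
  refine ⟨fun C hC => (hor C hC).elim (hP.nodup C) (hφ.nodup C),
    fun C hC => (hor C hC).elim (hP.ne_nil C) (hφ.ne_nil C), fun C hC => ?_, fun C hC => ?_, ?_⟩
  · refine (hor C hC).elim (fun h => ?_) (hφ.length_le C)
    obtain ⟨D, hD, h1, _⟩ := hP.below C h
    exact ((hP.nodup C h).subperm h1).length_le.trans (hφ.length_le D hD)
  · refine (hor C hC).elim (fun h => ?_) (hφ.mem C)
    obtain ⟨D, hD, h1, _⟩ := hP.below C h
    exact fun l hl => hφ.mem D hD l (h1 hl)
  · refine List.pairwise_append.2 ⟨hP.antichain, hφ.antichain.filter _, fun p hp C hC => ?_⟩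
    obtain ⟨hC, h⟩ := List.mem_filter.1 hC
    refine ⟨fun hs => ?_, hφ.not_subset hP hp hC⟩
    simp only [Bool.not_eq_true', List.any_eq_false] at h
    exact h p hp (sub_iff.2 hs)

theorem deg_addAll_le (i : ℕ) (h : List α) (P φ : List (List α)) :
    deg i h (addAll P φ) ≤ deg i h P + deg i h φ := by
  unfold deg flower addAll
  rw [List.filter_append, List.length_append]
  exact Nat.add_le_add_left (List.Sublist.length_le (List.filter_sublist.filter _)) _

theorem cnt_addAll (i : ℕ) (P φ : List (List α)) : cnt i (addAll P φ) =
    cnt i P + cnt i (φ.filter fun C => !P.any fun p => sub p C) := by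
  simp [cnt, addAll]

theorem cnt_of_length {i j : ℕ} (h : ∀ p ∈ P, p.length = j) :
    cnt i P = if i = j then P.length else 0 := by
  unfold cnt
  split_ifs with hij
  · rw [List.filter_eq_self.2 fun p hp => by simp [h p hp, hij]]
  · rw [List.filter_eq_nil_iff.2 fun p hp => by simp [h p hp, eq_comm, hij], List.length_nil]

/-- Only clauses longer than the added ones can be subsumed: a subsumed clause of length at most `j`
would be contained in the clause that subsumes it, which `Good.not_subset` excludes. -/
theorem Good.cnt_addAll_of_le (hφ : Good U φ) (hP : Addable φ P) {i j : ℕ}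
    (h : ∀ p ∈ P, p.length = j) (hij : i ≤ j) : cnt i (addAll P φ) = cnt i P + cnt i φ := by
  rw [cnt_addAll]
  congr 1
  unfold cnt
  rw [List.filter_filter]
  congr 1
  refine List.filter_congr fun C hC => ?_
  by_cases hl : C.length = i
  · simp only [hl, decide_true, Bool.true_and, Bool.not_eq_true', List.any_eq_false]
    intro p hp hs
    exact hφ.not_subset hP hp hC (subset_of_length_le (hP.nodup p hp) (sub_iff.1 hs)
      (by rw [hl, h p hp]; exact hij))
  · simp [hl]

theorem cnt_le_cnt_filter_add (i K : ℕ) (P φ : List (List α)) (hK : ∀ p ∈ P, deg i p φ ≤ K) :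
    cnt i φ ≤ cnt i (φ.filter fun C => !P.any fun p => sub p C) + P.length * K := by
  induction P with
  | nil => simp
  | cons p P ih =>
    have h1 := ih fun q hq => hK q (by simp [hq])
    have h2 := hK p (by simp)
    have h3 : cnt i (φ.filter fun C => !P.any fun p => sub p C) ≤
        cnt i (φ.filter fun C => !(p :: P).any fun p => sub p C) + deg i p φ := by
      simp only [cnt, deg, flower, ← List.countP_eq_length_filter, List.countP_filter]
      clear h1 h2 hK ih
      induction φ with
      | nil => simp
      | cons C φ ih =>
        simp only [List.countP_cons, List.any_cons] at ih ⊢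
        cases h : sub p C <;> cases h' : P.any (fun p => sub p C) <;>
          by_cases h'' : C.length = i <;> simp [h''] at ih ⊢ <;> omega
    rw [List.length_cons, Nat.succ_mul]
    omega

/-- Double counting of the incidences between elements and clauses of length `i`. -/
theorem sum_deg (U : Finset α) (i : ℕ) (φ : List (List α)) (hn : ∀ C ∈ φ, C.Nodup)
    (hU : ∀ C ∈ φ, ∀ l ∈ C, l ∈ U) : ∑ a ∈ U, deg i [a] φ = i * cnt i φ := by
  simp only [cnt, deg, flower, ← List.countP_eq_length_filter]
  induction φ with
  | nil => simp
  | cons C φ ih =>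
    simp only [List.countP_cons, Finset.sum_add_distrib]
    rw [ih (fun D hD => hn D (by simp [hD])) (fun D hD => hU D (by simp [hD])), mul_add]
    congr 1
    by_cases hC : C.length = i
    · have : U.filter (fun a => a ∈ C) = C.toFinset := by
        ext a
        simp only [Finset.mem_filter, List.mem_toFinset, and_iff_right_iff_imp]
        exact hU C (by simp) a
      simp [hC, sub, this, List.toFinset_card_of_nodup (hn C (by simp))]
    · simp [hC]

theorem Good.deg_one_le (hφ : Good U φ) (a : α) : deg 1 [a] φ ≤ 1 := by
  by_contra! h
  unfold deg at h
  have hs : ∀ C ∈ flower 1 [a] φ, C = [a] := fun C hC => by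
    have := (List.mem_filter.1 hC).2
    simp only [Bool.and_eq_true, decide_eq_true_eq, sub_iff, List.length_eq_one_iff] at this
    obtain ⟨⟨b, rfl⟩, h⟩ := this
    simpa [eq_comm] using h
  have hpw := hφ.antichain.filter fun C => decide (C.length = 1) && sub [a] C
  change (flower 1 [a] φ).Pairwise _ at hpw
  rcases hF : flower 1 [a] φ with _ | ⟨C, _ | ⟨D, F⟩⟩
  · simp [hF] at h
  · simp [hF] at h
  · rw [hF] at hpw hs
    have h1 := hs C (by simp)
    have h2 := hs D (by simp)
    subst h1 h2
    simp at hpw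

theorem Good.deg_eq_zero (hφ : Good U φ) {a : α} (ha : 1 ≤ deg 1 [a] φ) {i : ℕ} (hi : 2 ≤ i) :
    deg i [a] φ = 0 := by
  by_contra h
  obtain ⟨C, hC⟩ := List.exists_mem_of_length_pos ha
  obtain ⟨D, hD⟩ := List.exists_mem_of_length_pos (Nat.pos_of_ne_zero h)
  simp only [flower, List.mem_filter, Bool.and_eq_true, decide_eq_true_eq, sub_iff] at hC hD
  have : C = D := by
    refine hφ.eq_of_subset hC.1 hD.1 ?_
    exact List.Subset.trans (subset_of_length_le (by simp) hC.2.2 (by simp [hC.2.1])) hD.2.2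
  subst this
  omega

theorem Good.cnt_one_le (hφ : Good U φ) : cnt 1 φ ≤ U.card := by
  have h := sum_deg U 1 φ hφ.nodup hφ.mem
  have := Finset.sum_le_card_nsmul U (fun a => deg 1 [a] φ) 1 fun a _ => hφ.deg_one_le a
  simp at this; omega

/-- In an antichain, an element that forms a unit clause lies in no pair. So in the sum of the
degrees it leaves its share `K` unused. -/
theorem Good.cnt_two_add_le (hφ : Good U φ) {K : ℕ} (hK : ∀ a, deg 2 [a] φ ≤ K) :
    2 * cnt 2 φ + K * cnt 1 φ ≤ K * U.card := by
  have h1 := sum_deg U 1 φ hφ.nodup hφ.mem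
  have h2 := sum_deg U 2 φ hφ.nodup hφ.mem
  rw [one_mul] at h1
  rw [← h1, ← h2, Finset.mul_sum, ← Finset.sum_add_distrib, mul_comm, ← smul_eq_mul]
  refine Finset.sum_le_card_nsmul U _ K fun a _ => ?_
  have h3 := hφ.deg_one_le a
  rcases Nat.lt_or_ge (deg 1 [a] φ) 1 with h | h
  · have h4 : deg 1 [a] φ = 0 := by omega
    simpa [h4] using hK a
  · have h4 : deg 1 [a] φ = 1 := by omega
    simp [h4, hφ.deg_eq_zero h le_rfl]

/-- The measure of progress. -/
def potential (U : Finset α) (K : ℕ) (φ : List (List α)) : ℕ :=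
  2 * K * (U.card - cnt 1 φ) - cnt 2 φ

/-- Neither subtraction in `potential` is truncated, by the two preceding bounds on the numbers of
units and pairs. In this additive form the potentials before and after a step can be compared
linearly. -/
theorem Good.potential_add (hφ : Good U φ) {K : ℕ} (hK : ∀ a, deg 2 [a] φ ≤ K) :
    potential U K φ + cnt 2 φ + 2 * K * cnt 1 φ = 2 * K * U.card := by
  have h1 := hφ.cnt_one_le
  have h2 := hφ.cnt_two_add_le hK
  unfold potential
  obtain ⟨r, hr⟩ := Nat.exists_eq_add_of_le h1
  rw [hr, Nat.add_sub_cancel_left]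
  rw [hr] at h2
  have : cnt 2 φ ≤ 2 * K * r := by nlinarith
  rw [mul_add]
  omega

/-- Adding unit clauses. -/
theorem Good.add_units (hφ : Good U φ) (hP : Addable φ P) (h : ∀ p ∈ P, p.length = 1) {K : ℕ}
    (hK : ∀ a, deg 2 [a] φ ≤ K) : (∀ a, deg 2 [a] (addAll P φ) ≤ K) ∧
      potential U K (addAll P φ) + P.length * K ≤ potential U K φ := by
  have hd : ∀ a, deg 2 [a] P = 0 := fun a => by
    unfold deg flower
    rw [List.filter_eq_nil_iff.2 fun p hp => by simp [h p hp], List.length_nil]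
  have hK' : ∀ a, deg 2 [a] (addAll P φ) ≤ K := fun a => by
    have := deg_addAll_le 2 [a] P φ
    have := hK a
    rw [hd] at *; omega
  refine ⟨hK', ?_⟩
  have e1 := hφ.potential_add hK
  have e2 := (hφ.add hP).potential_add hK'
  have e3 := hφ.cnt_addAll_of_le hP h (i := 1) le_rfl
  rw [cnt_of_length h, if_pos rfl] at e3
  have e4 := cnt_addAll 2 P φ
  rw [cnt_of_length h, if_neg (by simp)] at e4
  -- Each new unit clause lowers the potential by `2 * K`, and subsumes at most `K` pairs, whose
  -- loss raises it by at most `K`. The net gain is `K` per unit.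
  have e5 := cnt_le_cnt_filter_add 2 K P φ fun p hp => by
    obtain ⟨a, rfl⟩ := List.length_eq_one_iff.1 (h p hp)
    exact hK a
  rw [e3] at e2
  nlinarith

/-- Adding clauses of length two. -/
theorem Good.add_pairs (hφ : Good U φ) (hP : Addable φ P) (h : ∀ p ∈ P, p.length = 2) {K : ℕ}
    (hK : ∀ a, deg 2 [a] P + deg 2 [a] φ ≤ K) : (∀ a, deg 2 [a] (addAll P φ) ≤ K) ∧
      potential U K (addAll P φ) + P.length ≤ potential U K φ := by
  have hK' : ∀ a, deg 2 [a] (addAll P φ) ≤ K := fun a =>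
    (deg_addAll_le 2 [a] P φ).trans (hK a)
  refine ⟨hK', ?_⟩
  have e1 := hφ.potential_add fun a => (Nat.le_add_left _ _).trans (hK a)
  have e2 := (hφ.add hP).potential_add hK'
  have e3 := hφ.cnt_addAll_of_le hP h (i := 1) (by omega)
  rw [cnt_of_length h, if_neg (by simp), zero_add] at e3
  have e4 := hφ.cnt_addAll_of_le hP h (i := 2) le_rfl
  rw [cnt_of_length h, if_pos rfl] at e4
  rw [e3, e4] at e2
  omega

theorem mem_hearts₁ {h : List α} : h ∈ hearts₁ φ ↔ ∃ C ∈ φ, ∃ a ∈ C, h = [a] := by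
  simp [hearts₁, eq_comm]

theorem mem_hearts₂ {h : List α} :
    h ∈ hearts₂ φ ↔ ∃ C ∈ φ, ∃ a ∈ C, ∃ b ∈ C, b ≠ a ∧ h = [a, b] := by
  simp only [hearts₂, List.mem_flatMap, List.mem_map, List.mem_filter, Bool.not_eq_true',
    decide_eq_false_iff_not, and_assoc, @eq_comm _ h]

theorem Good.addable_heart (hφ : Good U φ) {h : List α} (hn : h.Nodup) (h0 : h ≠ []) {i : ℕ}
    (hi : h.length < i) (hF : flower i h φ ≠ []) : Addable φ [h] := by
  refine ⟨by simpa using hn, by simpa using h0, by simp, ?_⟩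
  obtain ⟨C, hC⟩ := List.exists_mem_of_ne_nil _ hF
  simp only [flower, List.mem_filter, Bool.and_eq_true, decide_eq_true_eq, sub_iff] at hC
  simp only [List.mem_singleton, forall_eq]
  refine ⟨C, hC.1, hC.2.2, fun hs => ?_⟩
  have := ((hφ.nodup C hC.1).subperm hs).length_le
  omega

theorem length_petal {h C : List α} (hn : h.Nodup) (hC : C.Nodup) (hs : h ⊆ C) :
    (C.filter fun l => !decide (l ∈ h)).length + h.length = C.length := by
  have h1 : (C.filter fun l => decide (l ∈ h)).length = h.length := by
    refine List.Perm.length_eq ((List.perm_ext_iff_of_nodup (hC.filter _) hn).2 fun a => ?_)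
    simpa using @hs a
  have h2 := (List.filter_append_perm (fun l => decide (l ∈ h)) C).length_eq
  rw [List.length_append] at h2
  omega

theorem Good.addable_petals (hφ : Good U φ) {h : List α} (hn : h.Nodup) (h0 : h ≠ []) {i : ℕ}
    (hi : h.length < i) : Addable φ (petals h (flower i h φ)) ∧
      ∀ p ∈ petals h (flower i h φ), p.length = i - h.length := by
  have hl : ∀ p ∈ petals h (flower i h φ), p.length = i - h.length := by
    intro p hp
    obtain ⟨C, hC, rfl⟩ := List.mem_map.1 hp
    simp only [flower, List.mem_filter, Bool.and_eq_true, decide_eq_true_eq, sub_iff] at hC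
    have := length_petal hn (hφ.nodup C hC.1) hC.2.2
    omega
  refine ⟨⟨fun p hp => ?_, fun p hp h0 => ?_, ?_, fun p hp => ?_⟩, hl⟩
  · obtain ⟨C, hC, rfl⟩ := List.mem_map.1 hp
    exact (hφ.nodup C (List.mem_filter.1 hC).1).filter _
  · have := hl p hp
    rw [h0, List.length_nil] at this
    omega
  · refine List.pairwise_map.2 ((hφ.antichain.filter _).imp_of_mem fun {C D} hC hD hCD => ?_)
    simp only [flower, List.mem_filter, Bool.and_eq_true, decide_eq_true_eq, sub_iff] at hC hD
    refine ⟨fun hs => hCD.1 fun l hl => ?_, fun hs => hCD.2 fun l hl => ?_⟩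
    · by_cases hlh : l ∈ h
      · exact hD.2.2 hlh
      · exact (List.mem_filter.1 (hs (List.mem_filter.2 ⟨hl, by simp [hlh]⟩))).1
    · by_cases hlh : l ∈ h
      · exact hC.2.2 hlh
      · exact (List.mem_filter.1 (hs (List.mem_filter.2 ⟨hl, by simp [hlh]⟩))).1
  · obtain ⟨C, hC, rfl⟩ := List.mem_map.1 hp
    simp only [flower, List.mem_filter, Bool.and_eq_true, decide_eq_true_eq, sub_iff] at hC
    refine ⟨C, hC.1, List.filter_sublist.subset, fun hs => ?_⟩
    obtain ⟨l, hl⟩ := List.exists_mem_of_ne_nil _ h0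
    simpa [hl] using hs (hC.2.2 hl)

/-- A petal at `b` of a flower with heart `a` comes from a clause through both `a` and `b`. So once
no two-element heart has a large flower, the pairs created from a one-element heart have small
degrees. -/
theorem deg_petals_le {a b : α} (i : ℕ) (φ : List (List α)) :
    deg i [b] (petals [a] (flower (i + 1) [a] φ)) ≤ deg (i + 1) [a, b] φ ∧
      deg i [a] (petals [a] (flower (i + 1) [a] φ)) = 0 := by
  simp only [deg, flower, petals, ← List.countP_eq_length_filter, List.countP_map,
    List.countP_filter]
  refine ⟨List.countP_mono_left fun C _ h => ?_, List.countP_eq_zero.2 fun C _ h => ?_⟩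
  · simp only [sub, List.mem_singleton, Function.comp_apply, List.all_cons, List.mem_filter,
      List.all_nil, Bool.and_true, Bool.and_eq_true, decide_eq_true_eq, Bool.not_eq_true',
      decide_eq_false_iff_not] at h ⊢
    exact ⟨h.2.1, h.2.2, h.1.2.1⟩
  · simp [sub] at h

/-- The amounts by which the potential drops in the two branches. -/
def Drops (c e d d₁ d₂ : ℕ) : Prop :=
  (d₁ = c + e ∧ d₂ = c * (c + e)) ∨ (d₁ = 1 ∧ d₂ = e * (c + e)) ∨ (d₁ = c + e ∧ d₂ = d)

theorem deg_lt_of_forall {i k : ℕ} {h : List α} {H : List (List α)}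
    (hH : ∀ h ∈ H, (flower i h φ).length < k) (hk : 1 ≤ k) (hh : flower i h φ ≠ [] → h ∈ H) :
    deg i h φ < k := by
  by_cases h0 : flower i h φ = []
  · simp [deg, h0]; omega
  · exact hH h (hh h0)

theorem mem_hearts₁_of_flower {i : ℕ} {a : α} (h : flower i [a] φ ≠ []) : [a] ∈ hearts₁ φ := by
  obtain ⟨C, hC⟩ := List.exists_mem_of_ne_nil _ h
  simp only [flower, List.mem_filter, Bool.and_eq_true, decide_eq_true_eq, sub_iff] at hC
  exact mem_hearts₁.2 ⟨C, hC.1, a, by simpa using hC.2.2, rfl⟩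

theorem mem_hearts₂_of_flower {i : ℕ} {a b : α} (hab : b ≠ a) (h : flower i [a, b] φ ≠ []) :
    [a, b] ∈ hearts₂ φ := by
  obtain ⟨C, hC⟩ := List.exists_mem_of_ne_nil _ h
  simp only [flower, List.mem_filter, Bool.and_eq_true, decide_eq_true_eq, sub_iff] at hC
  exact mem_hearts₂.2 ⟨C, hC.1, a, hC.2.2 (by simp), b, hC.2.2 (by simp), hab, rfl⟩

theorem length_eq_cnt (hφ : Good U φ) : φ.length = cnt 1 φ + cnt 2 φ + cnt 3 φ := by
  have h1 := hφ.ne_nil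
  have h2 := hφ.length_le
  clear hφ
  simp only [cnt, ← List.countP_eq_length_filter]
  induction φ with
  | nil => simp
  | cons C φ ih =>
    have := ih (fun D hD => h1 D (by simp [hD])) (fun D hD => h2 D (by simp [hD]))
    have h3 := h2 C (by simp)
    have h4 := List.length_pos_iff.2 (h1 C (by simp))
    simp only [List.countP_cons, List.length_cons, this]
    obtain h | h | h : C.length = 1 ∨ C.length = 2 ∨ C.length = 3 := by omega
    all_goals simp [h]; omega

theorem Good.cnt_le (hφ : Good U φ) {i k : ℕ} (hi : 1 ≤ i) (h : ∀ a, deg i [a] φ ≤ k) :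
    cnt i φ ≤ k * U.card := by
  have h1 := sum_deg U i φ hφ.nodup hφ.mem
  have h2 := Finset.sum_le_card_nsmul U (fun a => deg i [a] φ) k fun a _ => h a
  rw [smul_eq_mul, mul_comm] at h2
  nlinarith

/-- A step of the sparsification either stops, at a system with few clauses, or branches. -/
theorem Good.children_spec (hφ : Good U φ) {c e d : ℕ} (hc : 1 ≤ c) (he : 1 ≤ e) (hd : 1 ≤ d)
    (hK : ∀ a, deg 2 [a] φ ≤ c + e) :
    (children c e d φ = [] ∧ φ.length ≤ (1 + c + d) * U.card) ∨
    ∃ i h d₁ d₂, children c e d φ = branch (flower i h φ, h) φ ∧ flower i h φ ≠ [] ∧ h.Nodup ∧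
      Drops c e d d₁ d₂ ∧ Good U (addAll [h] φ) ∧ Good U (addAll (petals h (flower i h φ)) φ) ∧
      (∀ a, deg 2 [a] (addAll [h] φ) ≤ c + e) ∧
      (∀ a, deg 2 [a] (addAll (petals h (flower i h φ)) φ) ≤ c + e) ∧
      potential U (c + e) (addAll [h] φ) + d₁ ≤ potential U (c + e) φ ∧
      potential U (c + e) (addAll (petals h (flower i h φ)) φ) + d₂ ≤ potential U (c + e) φ := by
  have heq : ∀ q L, select c e d φ = q :: L → children c e d φ = branch q φ := fun q L h => by
    simp [children, h]
  unfold select at heq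
  -- First kind: an element in at least `c` pairs. Heart and petals are units, so no pair is created
  -- and the degree bound persists.
  rcases h1 : ((hearts₁ φ).map fun h => (flower 2 h φ, h)).filter
    (fun q => decide (c ≤ q.1.length)) with _ | ⟨q, L⟩
  swap
  · rw [h1] at heq
    have hq : q ∈ q :: L := by simp
    rw [← h1] at hq
    obtain ⟨hq, hl⟩ := List.mem_filter.1 hq
    obtain ⟨h, hh, rfl⟩ := List.mem_map.1 hq
    obtain ⟨C, hC, a, ha, rfl⟩ := mem_hearts₁.1 hh
    simp only [decide_eq_true_eq] at hl
    have hF : flower 2 [a] φ ≠ [] := List.length_pos_iff.1 (by omega)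
    have hA := hφ.addable_heart (h := [a]) (by simp) (by simp) (i := 2) (by simp) hF
    obtain ⟨hB, hBl⟩ := hφ.addable_petals (h := [a]) (by simp) (by simp) (i := 2) (by simp)
    obtain ⟨hA1, hA2⟩ := hφ.add_units hA (by simp) hK
    obtain ⟨hB1, hB2⟩ := hφ.add_units hB (by simpa using hBl) hK
    refine Or.inr ⟨2, [a], _, _, heq _ _ rfl, hF, by simp, Or.inl ⟨rfl, rfl⟩, hφ.add hA,
      hφ.add hB, hA1, hB1, by simpa using hA2, le_trans (Nat.add_le_add_left ?_ _) hB2⟩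
    exact Nat.mul_le_mul_right _ (by simpa [petals] using hl)
  rw [List.filter_eq_nil_iff] at h1
  simp only [List.mem_map, decide_eq_true_eq, not_le, forall_exists_index, and_imp,
    forall_apply_eq_imp_iff₂] at h1
  -- Without flowers of the first kind, the degrees in pairs are below `c`, which leaves room up to
  -- the bound `c + e` for new pairs.
  have hK1 : ∀ a, deg 2 [a] φ < c := fun a =>
    deg_lt_of_forall h1 hc mem_hearts₁_of_flower
  rw [List.filter_eq_nil_iff.2 (by simpa using h1), List.nil_append] at heq
  rcases h2 : ((hearts₂ φ).map fun h => (flower 3 h φ, h)).filter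
    (fun q => decide (e ≤ q.1.length)) with _ | ⟨q, L⟩
  swap
  · rw [h2] at heq
    have hq : q ∈ q :: L := by simp
    rw [← h2] at hq
    obtain ⟨hq, hl⟩ := List.mem_filter.1 hq
    obtain ⟨h, hh, rfl⟩ := List.mem_map.1 hq
    obtain ⟨C, hC, a, ha, b, hb, hab, rfl⟩ := mem_hearts₂.1 hh
    simp only [decide_eq_true_eq] at hl
    have hn : [a, b].Nodup := by simpa [eq_comm] using hab
    have hF : flower 3 [a, b] φ ≠ [] := List.length_pos_iff.1 (by omega)
    have hA := hφ.addable_heart hn (by simp) (i := 3) (by simp) hF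
    obtain ⟨hB, hBl⟩ := hφ.addable_petals hn (by simp) (i := 3) (by simp)
    -- Second kind: the heart is a single new pair, which raises a degree by at most one.
    obtain ⟨hA1, hA2⟩ := hφ.add_pairs hA (by simp) (K := c + e) fun x => by
      have : deg 2 [x] [[a, b]] ≤ 1 := List.length_filter_le _ _
      have := hK1 x
      omega
    obtain ⟨hB1, hB2⟩ := hφ.add_units hB (by simpa using hBl) hK
    refine Or.inr ⟨3, [a, b], _, _, heq _ _ rfl, hF, hn, Or.inr (Or.inl ⟨rfl, rfl⟩), hφ.add hA,
      hφ.add hB, hA1, hB1, by simpa using hA2, le_trans (Nat.add_le_add_left ?_ _) hB2⟩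
    exact Nat.mul_le_mul_right _ (by simpa [petals] using hl)
  rw [List.filter_eq_nil_iff] at h2
  simp only [List.mem_map, decide_eq_true_eq, not_le, forall_exists_index, and_imp,
    forall_apply_eq_imp_iff₂] at h2
  have hK2 : ∀ a b, b ≠ a → deg 3 [a, b] φ < e := fun a b hab =>
    deg_lt_of_forall h2 he (mem_hearts₂_of_flower hab)
  rw [List.filter_eq_nil_iff.2 (by simpa using h2), List.nil_append] at heq
  rcases h3 : ((hearts₁ φ).map fun h => (flower 3 h φ, h)).filter
    (fun q => decide (d ≤ q.1.length)) with _ | ⟨q, L⟩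
  swap
  · rw [h3] at heq
    have hq : q ∈ q :: L := by simp
    rw [← h3] at hq
    obtain ⟨hq, hl⟩ := List.mem_filter.1 hq
    obtain ⟨h, hh, rfl⟩ := List.mem_map.1 hq
    obtain ⟨C, hC, a, ha, rfl⟩ := mem_hearts₁.1 hh
    simp only [decide_eq_true_eq] at hl
    have hF : flower 3 [a] φ ≠ [] := List.length_pos_iff.1 (by omega)
    have hA := hφ.addable_heart (h := [a]) (by simp) (by simp) (i := 3) (by simp) hF
    obtain ⟨hB, hBl⟩ := hφ.addable_petals (h := [a]) (by simp) (by simp) (i := 3) (by simp)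
    obtain ⟨hA1, hA2⟩ := hφ.add_units hA (by simp) hK
    -- Third kind: an element `x` gets fewer than `e` new pairs, because the two-element hearts `a,
    -- x` have small flowers by now, and it has fewer than `c` old ones.
    obtain ⟨hB1, hB2⟩ := hφ.add_pairs hB (by simpa using hBl) (K := c + e) fun x => by
      have h4 := hK1 x
      have h5 := deg_petals_le (a := a) (b := x) 2 φ
      simp only [Nat.reduceAdd] at h5
      by_cases hx : x = a
      · subst hx
        rw [h5.2]; omega
      · have := hK2 a x hx
        omega
    refine Or.inr ⟨3, [a], _, _, heq _ _ rfl, hF, by simp, Or.inr (Or.inr ⟨rfl, rfl⟩), hφ.add hA,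
      hφ.add hB, hA1, hB1, by simpa using hA2, le_trans (Nat.add_le_add_left ?_ _) hB2⟩
    simpa [petals] using hl
  rw [List.filter_eq_nil_iff] at h3
  simp only [List.mem_map, decide_eq_true_eq, not_le, forall_exists_index, and_imp,
    forall_apply_eq_imp_iff₂] at h3
  have hK3 : ∀ a, deg 3 [a] φ < d := fun a =>
    deg_lt_of_forall h3 hd mem_hearts₁_of_flower
  refine Or.inl ⟨?_, ?_⟩
  · have h1' : ∀ h ∈ hearts₁ φ, ¬ c ≤ (flower 2 h φ).length := fun h hh => (h1 h hh).not_ge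
    have h2' : ∀ h ∈ hearts₂ φ, ¬ e ≤ (flower 3 h φ).length := fun h hh => (h2 h hh).not_ge
    have h3' : ∀ h ∈ hearts₁ φ, ¬ d ≤ (flower 3 h φ).length := fun h hh => (h3 h hh).not_ge
    have : select c e d φ = [] := by
      simp only [select, List.append_eq_nil_iff, List.filter_eq_nil_iff, List.mem_map,
        forall_exists_index, and_imp, forall_apply_eq_imp_iff₂, decide_eq_true_eq]
      exact ⟨h1', h2', h3'⟩
    simp [children, this]
  -- With no large flower left, the degrees bound the numbers of units, pairs and triples by 1, `c`
  -- and `d` times the number of elements.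
  · rw [length_eq_cnt hφ]
    have e1 := hφ.cnt_one_le
    have e2 := hφ.cnt_le (i := 2) (by omega) fun a => (hK1 a).le
    have e3 := hφ.cnt_le (i := 3) (by omega) fun a => (hK3 a).le
    rw [add_mul, add_mul, one_mul]
    omega

end Sparsify

/-! ### Sparsification in polynomial time, and its parameters. -/

namespace Sparsify

set_option linter.unusedSectionVars false
variable {α β : Type} [DataEnc α] [DecidableEq α] [PolyTimeEq α] [DataEnc β]

theorem polyTime_sub {f g : β → List α} (hf : PolyTime f) (hg : PolyTime g) :
    PolyTime (fun a => sub (f a) (g a)) :=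
  .all hf (.mem .snd (.comp hg .fst))

theorem polyTime_addAll {f g : β → List (List α)} (hf : PolyTime f) (hg : PolyTime g) :
    PolyTime (fun a => addAll (f a) (g a)) :=
  .append hf (.filter hg (.not (.any (.comp hf .fst) (polyTime_sub .snd (.snd' .fst)))))

theorem polyTime_flower (i : ℕ) {f : β → List α} {g : β → List (List α)} (hf : PolyTime f)
    (hg : PolyTime g) : PolyTime (fun a => flower i (f a) (g a)) :=
  .filter hg (.and (.length_eq .snd i) (polyTime_sub (.comp hf .fst) .snd))

theorem polyTime_petals {f : β → List α} {g : β → List (List α)} (hf : PolyTime f)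
    (hg : PolyTime g) : PolyTime (fun a => petals (f a) (g a)) :=
  .map hg (.filter .snd (.not (.mem .snd (.comp hf (.comp .fst .fst)))))

theorem polyTime_hearts₁ : PolyTime (fun φ : List (List α) => hearts₁ φ) :=
  .flatMap .id (.map .snd (.cons .snd (.const [])))

theorem polyTime_hearts₂ : PolyTime (fun φ : List (List α) => hearts₂ φ) :=
  .flatMap .id (.flatMap .snd (.map (.filter (.snd' .fst) (.not (.eq .snd (.snd' .fst))))
    (.cons (.snd' .fst) (.cons .snd (.const [])))))

theorem polyTime_select (c e d : ℕ) : PolyTime (fun φ : List (List α) => select c e d φ) :=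
  .append (.filter (.map polyTime_hearts₁ (.pair (polyTime_flower 2 .snd .fst) .snd))
    (.le_length (.fst' .snd) c)) <|
  .append (.filter (.map polyTime_hearts₂ (.pair (polyTime_flower 3 .snd .fst) .snd))
    (.le_length (.fst' .snd) e))
    (.filter (.map polyTime_hearts₁ (.pair (polyTime_flower 3 .snd .fst) .snd))
    (.le_length (.fst' .snd) d))

theorem polyTime_children (c e d : ℕ) : PolyTime (fun φ : List (List α) => children c e d φ) := by
  have h : PolyTime fun φ : List (List α) => (select c e d φ).headD ([], []) :=
    .headD (polyTime_select c e d) (.const ([], []))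
  exact .cond (.isEmpty (polyTime_select c e d)) (.const []) <|
    .cons (polyTime_addAll (.cons (.snd' h) (.const [])) .id) <|
    .cons (polyTime_addAll (polyTime_petals (.snd' h) (.fst' h)) .id) (.const [])

/-- Removing repetitions. -/
def nub (l : List α) : List α := l.foldr (fun b s => bif decide (b ∈ s) then s else b :: s) []

theorem nub_cons (a : α) (l : List α) : nub (a :: l) = if a ∈ nub l then nub l else a :: nub l := by
  rw [nub, List.foldr_cons, ← nub]
  split_ifs with h <;> simp [h]

theorem mem_nub {a : α} {l : List α} : a ∈ nub l ↔ a ∈ l := by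
  induction l with
  | nil => simp [nub]
  | cons b l ih =>
    rw [nub_cons]
    split_ifs with h
    · refine ⟨fun h' => by simp [ih.1 h'], fun h' => ?_⟩
      rcases List.mem_cons.1 h' with rfl | h'
      · exact h
      · exact ih.2 h'
    · simp [ih]

theorem nodup_nub (l : List α) : (nub l).Nodup := by
  induction l with
  | nil => simp [nub]
  | cons b l ih =>
    rw [nub_cons]
    split_ifs with h
    · exact ih
    · exact List.nodup_cons.2 ⟨h, ih⟩

theorem nub_sublist (l : List α) : (nub l).Sublist l := by
  induction l with
  | nil => simp [nub]
  | cons b l ih =>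
    rw [nub_cons]
    split_ifs with h
    · exact ih.trans (List.sublist_cons_self _ _)
    · exact ih.cons_cons _

theorem polyTime_nub : PolyTime (fun l : List α => nub l) := by
  refine .foldr (g := fun _ b s => bif decide (b ∈ s) then s else b :: s) .id (.const [])
    (.cond (.mem (.snd' .snd) (.fst' .snd)) (.fst' .snd) (.cons (.snd' .snd) (.fst' .snd)))
    Polynomial.X fun a l₁ l₂ h => ?_
  rw [Polynomial.eval_X, h]
  exact codeSize_sublist ((nub_sublist l₂).trans (List.sublist_append_right _ _))

/-- The minimal clauses. -/
def reduce (φ : List (List α)) : List (List α) :=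
  φ.foldr (fun C s => bif s.any (fun D => sub D C) then s else addAll [C] s) []

theorem reduce_cons (C : List α) (φ : List (List α)) : reduce (C :: φ) =
    if (reduce φ).any (fun D => sub D C) = true then reduce φ else addAll [C] (reduce φ) := by
  rw [reduce, List.foldr_cons, ← reduce, Bool.cond_eq_ite]

theorem hits_reduce (S : α → Prop) (φ : List (List α)) : Hits S (reduce φ) ↔ Hits S φ := by
  induction φ with
  | nil => rfl
  | cons C φ ih =>
    have hcons : Hits S (C :: φ) ↔ (∃ l ∈ C, S l) ∧ Hits S φ := by simp [Hits]
    rw [reduce_cons, hcons, ← ih]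
    split_ifs with h
    · refine ⟨fun hS => ⟨?_, hS⟩, fun hS => hS.2⟩
      obtain ⟨D, hD, hs⟩ := List.any_eq_true.1 h
      obtain ⟨l, hl, hSl⟩ := hS D hD
      exact ⟨l, sub_iff.1 hs hl, hSl⟩
    · exact ⟨fun hS => ⟨hS C (by simp [addAll]), hits_addAll hS⟩,
        fun hS => Hits.add (by simpa [Hits] using hS.1) hS.2⟩

theorem mem_of_mem_reduce {φ : List (List α)} {C : List α} (h : C ∈ reduce φ) : C ∈ φ := by
  induction φ with
  | nil => exact h
  | cons D φ ih =>
    rw [reduce_cons] at h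
    split_ifs at h with h'
    · simp [ih h]
    · rcases List.mem_append.1 h with h | h
      · simp_all
      · simp [ih (List.mem_filter.1 h).1]

theorem antichain_reduce (φ : List (List α)) :
    (reduce φ).Pairwise fun C D => ¬ C ⊆ D ∧ ¬ D ⊆ C := by
  induction φ with
  | nil => exact List.Pairwise.nil
  | cons C φ ih =>
    rw [reduce_cons]
    split_ifs with h
    · exact ih
    · refine List.pairwise_cons.2 ⟨fun D hD => ?_, ih.filter _⟩
      obtain ⟨hD, h'⟩ := List.mem_filter.1 hD
      rw [List.any_eq_true] at h
      refine ⟨fun hs => by simp [sub_iff.2 hs] at h', fun hs => h ⟨D, hD, sub_iff.2 hs⟩⟩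

theorem good_reduce (U : Finset α) (φ : List (List α)) (h : ∀ C ∈ φ, C.Nodup ∧ C ≠ [] ∧
    C.length ≤ 3 ∧ ∀ l ∈ C, l ∈ U) : Good U (reduce φ) :=
  ⟨fun C hC => (h C (mem_of_mem_reduce hC)).1, fun C hC => (h C (mem_of_mem_reduce hC)).2.1,
    fun C hC => (h C (mem_of_mem_reduce hC)).2.2.1, fun C hC => (h C (mem_of_mem_reduce hC)).2.2.2,
    antichain_reduce φ⟩

theorem polyTime_reduce : PolyTime (fun φ : List (List α) => reduce φ) := by
  refine .foldr (g := fun (_ : List (List α)) (C : List α) (s : List (List α)) =>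
      bif s.any (fun D => sub D C) then s else addAll [C] s) .id (.const [])
    (.cond (.any (l := fun q : _ × (List (List α) × List α) => q.2.1)
        (p := fun q D => sub D q.2.2) (.fst' .snd) (polyTime_sub .snd (.snd' (.snd' .fst))))
      (.fst' .snd)
      (polyTime_addAll (.cons (.snd' .snd) (.const [])) (.fst' .snd)))
    Polynomial.X fun φ l₁ l₂ h => ?_
  have key : codeSize (reduce l₂) ≤ codeSize l₂ := by
    clear h
    induction l₂ with
    | nil => simp [reduce]
    | cons C l ih =>
      rw [reduce_cons]
      split_ifs
      · simp; omega
      · have := codeSize_append [C] ((reduce l).filter fun D => !List.any [C] fun p => sub p D)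
        have h2 := codeSize_sublist (List.filter_sublist (l := reduce l)
          (p := fun D => !List.any [C] fun p => sub p D))
        rw [addAll]
        simp only [codeSize_cons, codeSize_nil] at this ⊢
        omega
  rw [Polynomial.eval_X, h]
  exact key.trans (codeSize_sublist (List.sublist_append_right _ _))

/-- The clauses satisfying `q` are all subsumed, and the added clauses take no more room than these.
Hence systems never grow along the search, and one size bound serves for all its nodes. -/
theorem codeSize_addAll_le {φ P : List (List α)} (q : List α → Bool)
    (hP : codeSize P ≤ codeSize (φ.filter q)) (hq : ∀ C ∈ φ, q C = true → ∃ p ∈ P, p ⊆ C) :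
    codeSize (addAll P φ) ≤ codeSize φ := by
  have h1 := codeSize_perm (List.filter_append_perm q φ)
  have h2 := codeSize_append (φ.filter q) (φ.filter fun C => !q C)
  have h3 := codeSize_append P (φ.filter fun C => !P.any fun p => sub p C)
  have h4 : (φ.filter fun C => !P.any fun p => sub p C).Sublist (φ.filter fun C => !q C) := by
    have : φ.filter (fun C => !P.any fun p => sub p C) =
        (φ.filter (fun C => !q C)).filter fun C => !P.any fun p => sub p C := by
      rw [List.filter_filter]
      refine List.filter_congr fun C hC => ?_
      cases h : q C
      · simp
      · obtain ⟨p, hp, hs⟩ := hq C hC h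
        have : P.any (fun p => sub p C) = true := List.any_eq_true.2 ⟨p, hp, sub_iff.2 hs⟩
        simp [this]
    rw [this]
    exact List.filter_sublist
  have h5 := codeSize_sublist h4
  have h6 : (addAll P φ) = P ++ φ.filter fun C => !P.any fun p => sub p C := rfl
  rw [h6]
  omega

theorem codeSize_heart_le {i : ℕ} {h : List α} {φ : List (List α)} (hn : h.Nodup)
    (hF : flower i h φ ≠ []) : codeSize (addAll [h] φ) ≤ codeSize φ := by
  refine codeSize_addAll_le (fun C => decide (C.length = i) && sub h C) ?_ fun C hC hq => ?_
  · obtain ⟨C, hC⟩ := List.exists_mem_of_ne_nil _ hF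
    have h1 := codeSize_mem hC
    obtain ⟨l, hl, hs⟩ := hn.subperm (sub_iff.1 (Bool.and_eq_true_iff.1 (List.mem_filter.1 hC).2).2)
    have h2 := codeSize_sublist hs
    rw [codeSize_perm hl] at h2
    simp only [codeSize_cons, codeSize_nil]
    exact le_trans (by omega) h1
  · exact ⟨h, by simp, sub_iff.1 (Bool.and_eq_true_iff.1 hq).2⟩

theorem codeSize_petals_le {i : ℕ} {h : List α} {φ : List (List α)} :
    codeSize (addAll (petals h (flower i h φ)) φ) ≤ codeSize φ := by
  refine codeSize_addAll_le (fun C => decide (C.length = i) && sub h C) ?_ fun C hC hq => ?_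
  · change codeSize (petals h (flower i h φ)) ≤ codeSize (flower i h φ)
    generalize flower i h φ = F
    induction F with
    | nil => exact le_rfl
    | cons C F ih =>
      have := codeSize_sublist (List.filter_sublist (l := C) (p := fun l => !decide (l ∈ h)))
      simp only [petals, List.map_cons, codeSize_cons] at ih ⊢
      omega
  · exact ⟨_, List.mem_map.2 ⟨C, List.mem_filter.2 ⟨hC, hq⟩, rfl⟩, List.filter_sublist.subset⟩

/-- Thresholds for which the sparsification tree is small. -/
theorem exists_thresholds {ε : ℝ} (hε : 0 < ε) : ∃ c e d : ℕ, 1 ≤ c ∧ 1 ≤ e ∧ 1 ≤ d ∧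
    ∃ x : ℝ, 1 ≤ x ∧ (∀ n : ℕ, x ^ (2 * (c + e) * (2 * n)) ≤ 2 ^ (ε * n)) ∧
      ∀ d₁ d₂ m m₁ m₂ : ℕ, Drops c e d d₁ d₂ → m₁ + d₁ ≤ m → m₂ + d₂ ≤ m →
        x ^ m₁ + x ^ m₂ ≤ x ^ m := by
  -- A quarter, since the exponent in question is `4 * n` times `c + e`, and the `(c + e)`-th power
  -- of `x` will be `R`.
  set a : ℝ := ε / 4 with ha
  have ha0 : 0 < a := by positivity
  set R : ℝ := 2 ^ a with hR
  have hR1 : 1 < R := Real.one_lt_rpow (by norm_num) ha0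
  have hr0 : 0 < R⁻¹ := by positivity
  have hr1 : R⁻¹ < 1 := inv_lt_one_of_one_lt₀ hR1
  -- This serves the drops `c + e` and `c * (c + e)`, whose branching inequality reads `R⁻¹ + R⁻¹ ^
  -- c ≤ 1`.
  obtain ⟨c, hc1, hc⟩ : ∃ c : ℕ, 1 ≤ c ∧ R⁻¹ ^ c ≤ 1 - R⁻¹ := by
    have h := (tendsto_pow_atTop_nhds_zero_of_lt_one hr0.le hr1).eventually_le_const
      (show (0 : ℝ) < 1 - R⁻¹ by linarith)
    obtain ⟨c, h1, h2⟩ := (h.and (eventually_ge_atTop 1)).exists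
    exact ⟨c, h2, h1⟩
  -- This serves the drops 1 and `e * (c + e)`. Such an `e` exists because exponential decay beats
  -- linear growth.
  obtain ⟨e, he1, he⟩ : ∃ e : ℕ, 1 ≤ e ∧ (c + e : ℝ) * R⁻¹ ^ e ≤ 1 - R⁻¹ := by
    have h1 := (tendsto_pow_atTop_nhds_zero_of_lt_one hr0.le hr1).const_mul (c : ℝ)
    have h2 := tendsto_self_mul_const_pow_of_lt_one hr0.le hr1
    have h := (h1.add h2).eventually_le_const (show (c : ℝ) * 0 + 0 < 1 - R⁻¹ by simp; linarith)
    obtain ⟨e, h1, h2⟩ := (h.and (eventually_ge_atTop 1)).exists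
    exact ⟨e, h2, by linarith⟩
  have hK0 : (0 : ℝ) < (c + e : ℕ) := by positivity
  set x : ℝ := 2 ^ (a / (c + e : ℕ)) with hx
  have hx1 : 1 ≤ x := Real.one_le_rpow (by norm_num) (by positivity)
  have hxK : x ^ (c + e) = R := by
    rw [hx, hR, ← Real.rpow_natCast, ← Real.rpow_mul (by norm_num), div_mul_cancel₀ _ hK0.ne']
  have hx0 : 0 < x := by linarith
  have hyK : x⁻¹ ^ (c + e) = R⁻¹ := by rw [inv_pow, hxK]
  have hy0 : 0 < x⁻¹ := by positivity
  have hy1 : x⁻¹ ≤ 1 := inv_le_one_of_one_le₀ hx1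
  -- With `d = c * (c + e)` the third kind of flower has the same drops as the first.
  refine ⟨c, e, c * (c + e), hc1, he1, Nat.mul_pos hc1 (by omega), x, hx1, fun n => ?_, ?_⟩
  · rw [show 2 * (c + e) * (2 * n) = (c + e) * (4 * n) by ring, pow_mul, hxK, hR,
      ← Real.rpow_natCast, ← Real.rpow_mul (by norm_num)]
    refine le_of_eq ?_
    congr 1
    rw [ha]; push_cast; ring
  · intro d₁ d₂ m m₁ m₂ hd h₁ h₂
    have key : x⁻¹ ^ d₁ + x⁻¹ ^ d₂ ≤ 1 := by
      have h3 : x⁻¹ ^ (c + e) + x⁻¹ ^ (c * (c + e)) ≤ 1 := by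
        rw [mul_comm c, pow_mul, hyK]; linarith
      rcases hd with ⟨rfl, rfl⟩ | ⟨rfl, rfl⟩ | ⟨rfl, rfl⟩
      · exact h3
      · rw [mul_comm e, pow_mul, hyK, pow_one]
        -- Bernoulli's inequality turns the knowledge that the `(c + e)`-th power of `x⁻¹` is `R⁻¹`
        -- into a lower bound for `1 - x⁻¹`.
        have hb := one_add_mul_le_pow (show (-2 : ℝ) ≤ x⁻¹ - 1 by linarith) (c + e)
        rw [add_sub_cancel, hyK] at hb
        push_cast at hb
        have hce : (0 : ℝ) < c + e := by exact_mod_cast hK0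
        have : (c + e : ℝ) * R⁻¹ ^ e ≤ (c + e) * (1 - x⁻¹) := by nlinarith
        have := le_of_mul_le_mul_left this hce
        linarith
      · exact h3
    have hpow : ∀ d m' : ℕ, m' + d ≤ m → x ^ m' ≤ x ^ m * x⁻¹ ^ d := fun d m' h => by
      have h4 : x ^ m' = x ^ (m' + d) * x⁻¹ ^ d := by
        rw [pow_add, mul_assoc, ← mul_pow, mul_inv_cancel₀ hx0.ne', one_pow, mul_one]
      rw [h4]
      exact mul_le_mul_of_nonneg_right (pow_le_pow_right₀ hx1 h) (by positivity)
    have h5 := hpow _ _ h₁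
    have h6 := hpow _ _ h₂
    have h7 : x ^ m * (x⁻¹ ^ d₁ + x⁻¹ ^ d₂) ≤ x ^ m * 1 :=
      mul_le_mul_of_nonneg_left key (by positivity)
    linarith

end Sparsify

/-! ## Triangles that realize a bipartite incidence structure -/

/-- The triangles used: `row` and `col` triangles meet each other, the `link` triangles meet each
other, and `link a b` meets exactly `row a` and `col b`. -/
inductive Shape : Type
  | row (a : ℕ)
  | col (b : ℕ)
  | link (a b : ℕ)
  deriving DecidableEq

namespace Shape

/-- The corners, at scale `2 ^ L`. -/
def corner (L : ℕ) : Shape → Fin 3 → ℤ × ℤ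
  | row a => ![(-2 ^ a, 2 ^ L - 4 ^ a), (-2 ^ L, 2 ^ L), (-2 ^ L, 0)]
  | col b => ![(-2 ^ b, -(2 ^ L - 4 ^ b)), (-2 ^ L, -2 ^ L), (-2 ^ L, 0)]
  | link a b => ![(-2 ^ a, 2 ^ L - 4 ^ a), (-2 ^ b, -(2 ^ L - 4 ^ b)), (2 ^ L, 0)]

/-- The corners as points of the plane. -/
noncomputable def point (L : ℕ) (v : Shape) (j : Fin 3) : Plane :=
  !₂[(((v.corner L j).1 : ℚ) : ℝ), (((v.corner L j).2 : ℚ) : ℝ)]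

/-- The triangle. -/
noncomputable def triangle (L : ℕ) (v : Shape) : Set Plane :=
  convexHull ℝ (Set.range (v.point L))

/-- All indices are less than `T`. -/
def Below (T : ℕ) : Shape → Prop
  | row a => a < T
  | col b => b < T
  | link a b => a < T ∧ b < T

/-- The intersection relation. -/
def Meets : Shape → Shape → Prop
  | link a _, row i => a = i
  | link _ b, col j => b = j
  | row i, link a _ => a = i
  | col j, link _ b => b = j
  | _, _ => True

theorem meets_comm (v w : Shape) : v.Meets w ↔ w.Meets v := by
  cases v <;> cases w <;> simp [Meets]

end Shape

/-- The cross products are twice the signed areas of the triangles that `q` spans with the sides;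
divided by that of the whole triangle they are the barycentric coordinates of `q`. -/
theorem mem_of_cross_nonneg {S : Set Plane} (hS : Convex ℝ S) {A B C q : Plane} (hA : A ∈ S)
    (hB : B ∈ S) (hC : C ∈ S)
    (hD : 0 < (B 0 - A 0) * (C 1 - A 1) - (B 1 - A 1) * (C 0 - A 0))
    (h₁ : 0 ≤ (B 0 - q 0) * (C 1 - q 1) - (B 1 - q 1) * (C 0 - q 0))
    (h₂ : 0 ≤ (C 0 - q 0) * (A 1 - q 1) - (C 1 - q 1) * (A 0 - q 0))
    (h₃ : 0 ≤ (A 0 - q 0) * (B 1 - q 1) - (A 1 - q 1) * (B 0 - q 0)) : q ∈ S := by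
  set D := (B 0 - A 0) * (C 1 - A 1) - (B 1 - A 1) * (C 0 - A 0) with hDdef
  have h := hS.sum_mem (t := Finset.univ)
    (w := ![((B 0 - q 0) * (C 1 - q 1) - (B 1 - q 1) * (C 0 - q 0)) / D,
      ((C 0 - q 0) * (A 1 - q 1) - (C 1 - q 1) * (A 0 - q 0)) / D,
      ((A 0 - q 0) * (B 1 - q 1) - (A 1 - q 1) * (B 0 - q 0)) / D]) (z := ![A, B, C]) ?_ ?_ ?_
  · convert h
    simp only [Fin.sum_univ_three, Matrix.cons_val]
    ext j
    have hD' := hD.ne'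
    fin_cases j
    · simp only [Fin.zero_eta, PiLp.add_apply, PiLp.smul_apply, smul_eq_mul]
      field_simp
      rw [hDdef]; ring
    · simp only [Fin.mk_one, PiLp.add_apply, PiLp.smul_apply, smul_eq_mul]
      field_simp
      rw [hDdef]; ring
  · intro i _
    fin_cases i <;> simp <;> positivity
  · simp only [Fin.sum_univ_three, Matrix.cons_val]
    field_simp
    rw [hDdef]; ring
  · intro i _
    fin_cases i <;> simpa

theorem abs_sub_le_of_mem_closedBall {c q : Plane} {r : ℝ} (h : q ∈ Metric.closedBall c r)
    (j : Fin 2) : |q j - c j| ≤ r := by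
  have h1 := PiLp.norm_apply_le (q - c) j
  rw [Metric.mem_closedBall, dist_eq_norm] at h
  simpa using h1.trans h

theorem norm_le_of_abs_le {q : Plane} {s : ℝ} (h0 : |q 0| ≤ s) (h1 : |q 1| ≤ s) :
    ‖q‖ ≤ 2 * s := by
  have hs : 0 ≤ s := (abs_nonneg _).trans h0
  rw [EuclideanSpace.norm_eq, Real.sqrt_le_left (by positivity)]
  simp only [Fin.sum_univ_two, Real.norm_eq_abs]
  nlinarith [abs_nonneg (q 0), abs_nonneg (q 1)]

/-! ### Fatness and intersection pattern of the triangles. -/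

namespace Shape

variable {L T : ℕ}

/-- The choice of `L` gives `a + b + 3 ≤ L`. So both coordinates of a tip differ from those of (0, ±
2 ^ L) by at most an eighth of the scale, and every triangle is a small perturbation of one of three
fixed ones. -/
theorem scale_bounds (hL : L = 2 * T + 3) {a b : ℕ} (ha : a < T) (hb : b < T) :
    (1 : ℝ) ≤ 2 ^ a ∧ (1 : ℝ) ≤ 2 ^ b ∧ (2 : ℝ) ^ a * 2 ^ b * 8 ≤ 2 ^ L ∧
    (4 : ℝ) ^ a = 2 ^ a * 2 ^ a ∧ (4 : ℝ) ^ b = 2 ^ b * 2 ^ b ∧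
    (2 : ℝ) ^ a * 2 ^ a * 8 ≤ 2 ^ L ∧ (2 : ℝ) ^ b * 2 ^ b * 8 ≤ 2 ^ L := by
  have key : ∀ a b : ℕ, a < T → b < T → (2 : ℝ) ^ a * 2 ^ b * 8 ≤ 2 ^ L := fun a b ha hb => by
    rw [← pow_add, show (8 : ℝ) = 2 ^ 3 by norm_num, ← pow_add]
    exact pow_le_pow_right₀ (by norm_num) (by omega)
  have h4 : ∀ a : ℕ, (4 : ℝ) ^ a = 2 ^ a * 2 ^ a := fun a => by rw [← mul_pow]; norm_num
  exact ⟨one_le_pow₀ (by norm_num), one_le_pow₀ (by norm_num), key a b ha hb, h4 a, h4 b,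
    key a a ha ha, key b b hb hb⟩

theorem point_mem (v : Shape) (j : Fin 3) : v.point L j ∈ v.triangle L :=
  subset_convexHull ℝ _ ⟨j, rfl⟩

theorem triangle_subset {v : Shape} {S : Set Plane} (hS : Convex ℝ S) (h : ∀ j, v.point L j ∈ S) :
    v.triangle L ⊆ S :=
  convexHull_min (by rintro _ ⟨j, rfl⟩; exact h j) hS

theorem triangle_subset_closedBall (hL : L = 2 * T + 3) {v : Shape} (hv : v.Below T) :
    v.triangle L ⊆ Metric.closedBall 0 (2 * 2 ^ L) := by
  refine triangle_subset (convex_closedBall _ _) fun j => ?_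
  rw [mem_closedBall_zero_iff]
  have hs : (0 : ℝ) < 2 ^ L := by positivity
  cases v with
  | row a =>
    obtain ⟨h1, -, h2, h3, -⟩ := scale_bounds hL hv hv
    apply norm_le_of_abs_le <;> rw [abs_le] <;> fin_cases j <;> simp [point, corner, h3] <;>
      first | positivity | (try constructor) <;> nlinarith
  | col a =>
    obtain ⟨h1, -, h2, h3, -⟩ := scale_bounds hL hv hv
    apply norm_le_of_abs_le <;> rw [abs_le] <;> fin_cases j <;> simp [point, corner, h3] <;>
      first | positivity | (try constructor) <;> nlinarith
  | link a b =>
    obtain ⟨h1, h1', h2, h3, h3', h4, h5⟩ := scale_bounds hL hv.1 hv.2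
    apply norm_le_of_abs_le <;> rw [abs_le] <;> fin_cases j <;> simp [point, corner, h3, h3'] <;>
      first | positivity | (try constructor) <;> nlinarith

/-- Here `e` and `f` are the displacements of the tip from (0, s). The disk is chosen to lie on the
inner side of every edge for all displacements of at most s / 8. -/
theorem closedBall_subset_upper {S : Set Plane} (hS : Convex ℝ S) {s e f : ℝ} (hs : 0 < s)
    (he' : 8 * e ≤ s) (hf : 0 ≤ f) (hf' : 8 * f ≤ s) (hA : !₂[-e, s - f] ∈ S)
    (hB : !₂[-s, s] ∈ S) (hC : !₂[-s, 0] ∈ S) :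
    Metric.closedBall !₂[-(7 / 10 * s), 6 / 10 * s] (s / 20) ⊆ S := by
  intro q hq
  have hx := abs_le.1 (abs_sub_le_of_mem_closedBall hq 0)
  have hy := abs_le.1 (abs_sub_le_of_mem_closedBall hq 1)
  simp at hx hy
  obtain ⟨x1, x2⟩ := hx
  obtain ⟨y1, y2⟩ := hy
  refine mem_of_cross_nonneg hS hA hB hC ?_ ?_ ?_ ?_ <;> simp
  · nlinarith
  · nlinarith
  · nlinarith [mul_nonneg (show 0 ≤ s + q 0 by linarith) (show 0 ≤ q 1 - s / 2 by linarith),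
      mul_nonneg (show 0 ≤ 2 / 5 * s - (s + q 0) by linarith) (show 0 ≤ q 1 by linarith),
      mul_nonneg (show 0 ≤ s + q 0 by linarith) hf,
      mul_nonneg (show 0 ≤ - (q 0) - e - s / 2 by linarith) (show 0 ≤ q 1 by linarith)]
  · nlinarith [mul_nonneg (show 0 ≤ s + q 0 by linarith) (show 0 ≤ s - f - q 1 by linarith),
      mul_nonneg (show 0 ≤ - (q 0) - e by linarith) (show 0 ≤ s - q 1 by linarith)]

theorem closedBall_subset_lower {S : Set Plane} (hS : Convex ℝ S) {s e f : ℝ} (hs : 0 < s)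
    (he' : 8 * e ≤ s) (hf : 0 ≤ f) (hf' : 8 * f ≤ s) (hA : !₂[-e, -(s - f)] ∈ S)
    (hB : !₂[-s, -s] ∈ S) (hC : !₂[-s, 0] ∈ S) :
    Metric.closedBall !₂[-(7 / 10 * s), -(6 / 10 * s)] (s / 20) ⊆ S := by
  intro q hq
  have hx := abs_le.1 (abs_sub_le_of_mem_closedBall hq 0)
  have hy := abs_le.1 (abs_sub_le_of_mem_closedBall hq 1)
  simp at hx hy
  obtain ⟨x1, x2⟩ := hx
  obtain ⟨y1, y2⟩ := hy
  refine mem_of_cross_nonneg hS hA hC hB ?_ ?_ ?_ ?_ <;> simp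
  · nlinarith
  · nlinarith
  · nlinarith [mul_nonneg (show 0 ≤ s + q 0 by linarith) (show 0 ≤ s - f + q 1 by linarith),
      mul_nonneg (show 0 ≤ - (q 0) - e by linarith) (show 0 ≤ s + q 1 by linarith)]
  · nlinarith [mul_nonneg (show 0 ≤ s + q 0 by linarith) (show 0 ≤ -(q 1) - s / 2 by linarith),
      mul_nonneg (show 0 ≤ 2 / 5 * s - (s + q 0) by linarith) (show 0 ≤ -(q 1) by linarith),
      mul_nonneg (show 0 ≤ s + q 0 by linarith) hf,
      mul_nonneg (show 0 ≤ - (q 0) - e - s / 2 by linarith) (show 0 ≤ -(q 1) by linarith)]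

theorem closedBall_subset_right {S : Set Plane} (hS : Convex ℝ S) {s e f e' f' : ℝ} (hs : 0 < s)
    (h1 : 0 ≤ e) (h2 : 8 * e ≤ s) (h4 : 8 * f ≤ s) (h5 : 0 ≤ e') (h6 : 8 * e' ≤ s)
    (h8 : 8 * f' ≤ s) (hA : !₂[-e, s - f] ∈ S) (hB : !₂[-e', -(s - f')] ∈ S)
    (hC : !₂[s, 0] ∈ S) : Metric.closedBall !₂[35 / 100 * s, 0] (s / 20) ⊆ S := by
  intro q hq
  have hx := abs_le.1 (abs_sub_le_of_mem_closedBall hq 0)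
  have hy := abs_le.1 (abs_sub_le_of_mem_closedBall hq 1)
  simp at hx hy
  obtain ⟨x1, x2⟩ := hx
  obtain ⟨y1, y2⟩ := hy
  refine mem_of_cross_nonneg hS hA hB hC ?_ ?_ ?_ ?_ <;> simp
  · nlinarith [mul_nonneg (show 0 ≤ s - f by linarith) (show 0 ≤ s + e' by linarith),
      mul_nonneg (show 0 ≤ s - f' by linarith) (show 0 ≤ s + e by linarith)]
  · nlinarith [mul_nonneg (show 0 ≤ q 0 + e' by linarith) (show 0 ≤ q 1 + s / 20 by linarith),
      mul_nonneg (show 0 ≤ s - q 0 - s / 2 by linarith) (show 0 ≤ s - f' + q 1 - s / 2 by linarith)]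
  · nlinarith [mul_nonneg (show 0 ≤ q 0 + e by linarith) (show 0 ≤ s / 20 - q 1 by linarith),
      mul_nonneg (show 0 ≤ s - q 0 - s / 2 by linarith) (show 0 ≤ s - f - q 1 - s / 2 by linarith)]
  · nlinarith [mul_nonneg (show 0 ≤ q 0 + e by linarith) (show 0 ≤ s - f' + q 1 by linarith),
      mul_nonneg (show 0 ≤ q 0 + e' by linarith) (show 0 ≤ s - f - q 1 by linarith)]

theorem exists_closedBall_subset (hL : L = 2 * T + 3) {v : Shape} (hv : v.Below T) :
    ∃ c, Metric.closedBall c (2 ^ L / 20) ⊆ v.triangle L := by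
  have hs : (0 : ℝ) < 2 ^ L := by positivity
  have hconv : Convex ℝ (v.triangle L) := convex_convexHull ℝ _
  have hA := point_mem (L := L) v 0
  have hB := point_mem (L := L) v 1
  have hC := point_mem (L := L) v 2
  cases v with
  | row a =>
    obtain ⟨h1, -, h2, h3, -⟩ := scale_bounds hL hv hv
    simp [point, corner, h3] at hA hB hC
    exact ⟨_, closedBall_subset_upper hconv hs (by nlinarith) (by positivity)
      (by linarith) hA hB hC⟩
  | col a =>
    obtain ⟨h1, -, h2, h3, -⟩ := scale_bounds hL hv hv
    simp [point, corner, h3] at hA hB hC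
    exact ⟨_, closedBall_subset_lower hconv hs (e := 2 ^ a) (f := 2 ^ a * 2 ^ a)
      (by nlinarith) (by positivity) (by linarith) (by convert hA using 3; simp) hB hC⟩
  | link a b =>
    obtain ⟨h1, h1', h2, h3, h3', h4, h5⟩ := scale_bounds hL hv.1 hv.2
    simp [point, corner, h3, h3'] at hA hB hC
    exact ⟨_, closedBall_subset_right hconv hs (e := 2 ^ a) (f := 2 ^ a * 2 ^ a) (e' := 2 ^ b)
      (f' := 2 ^ b * 2 ^ b) (by positivity) (by nlinarith) (by linarith)
      (by positivity) (by nlinarith) (by linarith) hA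
      (by convert hB using 3; simp) hC⟩

theorem disjoint_of_separated {v w : Shape} (p q r : ℝ)
    (hv : ∀ j, p * v.point L j 0 + q * v.point L j 1 ≤ r)
    (hw : ∀ j, r < p * w.point L j 0 + q * w.point L j 1) :
    ¬ (v.triangle L ∩ w.triangle L).Nonempty := by
  rintro ⟨x, hx, hx'⟩
  let g : Plane →ₗ[ℝ] ℝ := p • (EuclideanSpace.proj 0 : Plane →L[ℝ] ℝ).toLinearMap +
    q • (EuclideanSpace.proj 1 : Plane →L[ℝ] ℝ).toLinearMap
  have hg : ∀ x : Plane, g x = p * x 0 + q * x 1 := fun x => by simp [g]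
  have h1 : g x ≤ r := triangle_subset (convex_halfSpace_le g.isLinear r)
    (fun j => by simpa [hg] using hv j) hx
  have h2 : r < g x := triangle_subset (convex_halfSpace_gt g.isLinear r)
    (fun j => by simpa [hg] using hw j) hx'
  linarith

/-- The separating line is the tangent of the parabola y = 2 ^ L - x ^ 2 at the tip of row `i`,
where x = -2 ^ i and the slope is 2 * 2 ^ i. The tip of row `a` lies strictly below it, with excess
(2 ^ a - 2 ^ i) ^ 2; the other corners of the link are far below it, and those of the row are on it
or above. -/
theorem not_inter_row_link (hL : L = 2 * T + 3) {i a b : ℕ} (hi : i < T) (ha : a < T) (hb : b < T)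
    (h : a ≠ i) : ¬ ((row i).triangle L ∩ (link a b).triangle L).Nonempty := by
  have hs : (0 : ℝ) < 2 ^ L := by positivity
  obtain ⟨i1, a1, -, i2, a2, i3, a3⟩ := scale_bounds hL hi ha
  obtain ⟨-, b1, ib, -, b2, -, b3⟩ := scale_bounds hL hi hb
  have hne : (0 : ℝ) < (2 ^ a - 2 ^ i) ^ 2 :=
    sq_pos_of_ne_zero (sub_ne_zero.2 fun h' => h (Nat.pow_right_injective le_rfl (by
      simpa using (by exact_mod_cast h' : (2 : ℕ) ^ _ = 2 ^ _))))
  refine disjoint_of_separated (2 * 2 ^ i) (-1) (-(2 * 2 ^ i * 2 ^ i) - (2 ^ L - 4 ^ i))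
    (fun j => ?_) (fun j => ?_) <;> fin_cases j <;> simp [point, corner, i2, a2, b2] <;> nlinarith

theorem not_inter_col_link (hL : L = 2 * T + 3) {i a b : ℕ} (hi : i < T) (ha : a < T) (hb : b < T)
    (h : b ≠ i) : ¬ ((col i).triangle L ∩ (link a b).triangle L).Nonempty := by
  have hs : (0 : ℝ) < 2 ^ L := by positivity
  obtain ⟨i1, a1, ia, i2, a2, i3, a3⟩ := scale_bounds hL hi ha
  obtain ⟨-, b1, -, -, b2, -, b3⟩ := scale_bounds hL hi hb
  have hne : (0 : ℝ) < (2 ^ b - 2 ^ i) ^ 2 :=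
    sq_pos_of_ne_zero (sub_ne_zero.2 fun h' => h (Nat.pow_right_injective le_rfl (by
      simpa using (by exact_mod_cast h' : (2 : ℕ) ^ _ = 2 ^ _))))
  refine disjoint_of_separated (2 * 2 ^ i) 1 (-(2 * 2 ^ i * 2 ^ i) - (2 ^ L - 4 ^ i))
    (fun j => ?_) (fun j => ?_) <;> fin_cases j <;> simp [point, corner, i2, a2, b2] <;> nlinarith

theorem inter_of_point_eq {v w : Shape} {j k : Fin 3} (h : v.corner L j = w.corner L k) :
    (v.triangle L ∩ w.triangle L).Nonempty := by
  refine ⟨v.point L j, point_mem v j, ?_⟩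
  have : v.point L j = w.point L k := by simp [point, h]
  rw [this]
  exact point_mem w k

/-- Triangles that are meant to meet share a corner: rows and columns the leftmost point of the
x-axis in use, links the rightmost one, and a link the tips of its row and column. -/
theorem inter_nonempty_iff (hL : L = 2 * T + 3) {v w : Shape} (hv : v.Below T) (hw : w.Below T) :
    (v.triangle L ∩ w.triangle L).Nonempty ↔ v.Meets w := by
  have hrl : ∀ i a b, i < T → a < T → b < T →
      (((row i).triangle L ∩ (link a b).triangle L).Nonempty ↔ a = i) := fun i a b hi ha hb =>
    ⟨fun h => by_contra fun h' => not_inter_row_link hL hi ha hb h' h,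
      fun h => inter_of_point_eq (j := 0) (k := 0) (by simp [corner, h])⟩
  have hcl : ∀ i a b, i < T → a < T → b < T →
      (((col i).triangle L ∩ (link a b).triangle L).Nonempty ↔ b = i) := fun i a b hi ha hb =>
    ⟨fun h => by_contra fun h' => not_inter_col_link hL hi ha hb h' h,
      fun h => inter_of_point_eq (j := 0) (k := 1) (by simp [corner, h])⟩
  cases v <;> cases w
  case row.link i a b => exact hrl i a b hv hw.1 hw.2
  case col.link i a b => exact hcl i a b hv hw.1 hw.2
  case link.row a b i => rw [Set.inter_comm]; exact hrl i a b hw hv.1 hv.2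
  case link.col a b i => rw [Set.inter_comm]; exact hcl i a b hw hv.1 hv.2
  all_goals
    simp only [Meets, iff_true]
    exact inter_of_point_eq (j := 2) (k := 2) (by simp [corner])

/-- Equal triangles meet the same triangles, so a suitable third shape tells two different shapes
apart. Two indices are needed in order to have one that differs from a given index. -/
theorem triangle_injective (hL : L = 2 * T + 3) (hT : 2 ≤ T) {v w : Shape} (hv : v.Below T)
    (hw : w.Below T) (h : v.triangle L = w.triangle L) : v = w := by
  have key : ∀ u : Shape, u.Below T → (v.Meets u ↔ w.Meets u) := fun u hu => by
    rw [← inter_nonempty_iff hL hv hu, ← inter_nonempty_iff hL hw hu, h]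
  have other : ∀ a : ℕ, ∃ b < T, a ≠ b := fun a => by
    rcases Nat.eq_zero_or_pos a with rfl | ha
    · exact ⟨1, hT, by omega⟩
    · exact ⟨0, by omega, by omega⟩
  cases v <;> cases w <;> simp only [Below] at hv hw
  case row.row a a' =>
    have := (key (link a 0) ⟨hv, by omega⟩).1 rfl
    simp only [Meets] at this; rw [this]
  case col.col a a' =>
    have := (key (link 0 a) ⟨by omega, hv⟩).1 rfl
    simp only [Meets] at this; rw [this]
  case link.link a b a' b' =>
    have h1 := (key (row a) hv.1).1 rfl
    have h2 := (key (col b) hv.2).1 rfl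
    simp only [Meets] at h1 h2; rw [h1, h2]
  case row.link a a' b' =>
    obtain ⟨b, hb, hne⟩ := other b'
    exact absurd ((key (col b) hb).1 trivial) hne
  case link.row a' b' a =>
    obtain ⟨b, hb, hne⟩ := other b'
    exact absurd ((key (col b) hb).2 trivial) hne
  case col.link a a' b' =>
    obtain ⟨b, hb, hne⟩ := other a'
    exact absurd ((key (row b) hb).1 trivial) hne
  case link.col a' b' a =>
    obtain ⟨b, hb, hne⟩ := other a'
    exact absurd ((key (row b) hb).2 trivial) hne
  case row.col a b =>
    obtain ⟨c, hc, hne⟩ := other b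
    have := (key (link a c) ⟨hv, hc⟩).1 rfl
    exact absurd this.symm hne
  case col.row b a =>
    obtain ⟨c, hc, hne⟩ := other b
    have := (key (link a c) ⟨hw, hc⟩).2 rfl
    exact absurd this.symm hne

end Shape

/-- A convex hull with interior points affinely spans the plane, and three points can do so only if
they are independent. -/
theorem affineIndependent_of_closedBall_subset {p : Fin 3 → Plane} {c : Plane} {r : ℝ} (hr : 0 < r)
    (h : Metric.closedBall c r ⊆ convexHull ℝ (Set.range p)) : AffineIndependent ℝ p := by
  have h1 : (interior (convexHull ℝ (Set.range p))).Nonempty :=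
    ⟨c, interior_mono h (Metric.ball_subset_interior_closedBall (Metric.mem_ball_self hr))⟩
  rw [interior_convexHull_nonempty_iff_affineSpan_eq_top] at h1
  rw [affineIndependent_iff_finrank_vectorSpan_eq ℝ p (n := 2) (by simp)]
  rw [← direction_affineSpan, h1, AffineSubspace.direction_top, finrank_top]
  simp

theorem fat_of_closedBall {S : Set Plane} {c : Plane} {r R : ℝ} (hr : 0 < r)
    (h1 : Metric.closedBall c r ⊆ S) (h2 : S ⊆ Metric.closedBall 0 R) :
    r / R ≤ inRadius S / outRadius S ∧ Metric.diam S ≤ 2 * R ∧ r ≤ Metric.diam S := by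
  have hdist : ∀ (c : Plane) (r : ℝ), 0 ≤ r →
      ∃ x ∈ Metric.closedBall c r, ∃ y ∈ Metric.closedBall c r, dist x y = 2 * r := by
    intro c r hr
    have hn : ‖(!₂[r, 0] : Plane)‖ = r := by
      rw [EuclideanSpace.norm_eq]; simp [Real.sqrt_sq hr]
    refine ⟨c + !₂[r, 0], by simp [hn], c - !₂[r, 0], by simp [hn], ?_⟩
    rw [dist_eq_norm, show c + !₂[r, 0] - (c - !₂[r, 0]) = (2 : ℝ) • (!₂[r, 0] : Plane) by
      rw [two_smul]; abel, norm_smul, hn]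
    simp
  have hle : ∀ (c c' : Plane) (r R : ℝ), 0 ≤ r → Metric.closedBall c r ⊆ Metric.closedBall c' R →
      r ≤ R := by
    intro c c' r R hr h
    obtain ⟨x, hx, y, hy, hxy⟩ := hdist c r hr
    have := dist_triangle_right x y c'
    have h1 := Metric.mem_closedBall.1 (h hx)
    have h2 := Metric.mem_closedBall.1 (h hy)
    linarith
  have hR : 0 < R := hr.trans_le (hle _ _ _ _ hr.le (h1.trans h2))
  have hin : r ≤ inRadius S := by
    refine le_csSup ⟨R, ?_⟩ ⟨hr.le, c, h1⟩
    rintro r' ⟨hr', c', hc'⟩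
    exact hle _ _ _ _ hr' (hc'.trans h2)
  have hout : outRadius S ≤ R := csInf_le ⟨0, fun _ h => h.1⟩ ⟨hR.le, 0, h2⟩
  -- Positivity of the outer radius is needed for comparing the quotients.
  have hout' : r ≤ outRadius S := by
    refine le_csInf ⟨R, hR.le, 0, h2⟩ ?_
    rintro R' ⟨hR', c', hc'⟩
    exact hle _ _ _ _ hr.le (h1.trans hc')
  refine ⟨div_le_div₀ (hr.le.trans hin) hin (hr.trans_le hout') hout,
    (Metric.diam_mono h2 Metric.isBounded_closedBall).trans (Metric.diam_closedBall hR.le), ?_⟩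
  obtain ⟨x, hx, y, hy, hxy⟩ := hdist c r hr.le
  have := Metric.dist_le_diam_of_mem (Metric.isBounded_closedBall.subset h2) (h1 hx) (h1 hy)
  linarith

/-! ## The target graph and instances built from shapes -/

/-- The reflexive octahedron: only the pairs `i, i + 3` are not adjacent. -/
def octahedron : LoopGraph (Fin 6) where
  Adj i j := i = j ∨ i.val % 3 ≠ j.val % 3
  symm _ _ h := h.imp Eq.symm Ne.symm

instance : DecidableRel octahedron.Adj := fun i j =>
  inferInstanceAs (Decidable (i = j ∨ i.val % 3 ≠ j.val % 3))

theorem octahedron_isReflexive : octahedron.IsReflexive := fun _ => Or.inl rfl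

/-- Residues modulo 3 are distinct on a clique. -/
theorem octahedron_mrc : octahedron.mrc = 3 := by
  have h : ∀ m, (∃ S : Finset (Fin 6), octahedron.IsReflexiveClique S ∧ S.card = m) → m ≤ 3 := by
    rintro m ⟨S, hS, rfl⟩
    rw [← Finset.card_range 3]
    refine Finset.card_le_card_of_injOn (fun i => i.val % 3)
      (fun i _ => by simpa using Nat.mod_lt _ (by norm_num)) fun i hi j hj hij => ?_
    by_contra hne
    exact (hS.2 i hi j hj hne).elim hne (fun h => h hij)
  refine le_antisymm (csSup_le ⟨0, ∅, by simp [LoopGraph.IsReflexiveClique]⟩ h) ?_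
  refine le_csSup ⟨3, h⟩ ⟨{0, 1, 2}, ?_, rfl⟩
  unfold LoopGraph.IsReflexiveClique
  decide

namespace Shape

variable {T : ℕ} {vs : List (Shape × List Bool)}

/-- The instance on given shapes, with lists given by masks. -/
def toInstance (T : ℕ) (vs : List (Shape × List Bool)) : TriangleInstance 6 where
  n := vs.length
  G :=
    { Adj := fun u v => u ≠ v ∧ (vs.get u).1.Meets (vs.get v).1
      symm := ⟨fun _ _ h => ⟨h.1.symm, (meets_comm _ _).1 h.2⟩⟩
      loopless := ⟨fun _ h => h.1 rfl⟩ }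
  L := fun v => Finset.univ.filter fun a => (vs.get v).2.getD a.val false = true
  corner := fun v j =>
    ((((vs.get v).1.corner (2 * T + 3) j).1 : ℚ), (((vs.get v).1.corner (2 * T + 3) j).2 : ℚ))

theorem get_injective (hn : (vs.map Prod.fst).Nodup) {u v : Fin vs.length}
    (h : (vs.get u).1 = (vs.get v).1) : u = v := by
  have h1 := hn.getElem_inj_iff (i := u.val) (j := v.val) (hi := by simp) (hj := by simp)
  simp only [List.getElem_map] at h1
  exact Fin.ext (h1.1 (by simpa using h))

theorem isValid_toInstance (hT : 2 ≤ T) (hb : ∀ q ∈ vs, q.1.Below T)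
    (hn : (vs.map Prod.fst).Nodup) : (toInstance T vs).IsValid (1 / 40) 80 := by
  have hb' : ∀ v : Fin vs.length, (vs.get v).1.Below T := fun v => hb _ (List.get_mem vs v)
  have hs : (0 : ℝ) < 2 ^ (2 * T + 3) := by positivity
  -- With s the scale, a disk of radius s / 20 inside and one of radius 2 s around give 1 / 40;
  -- diameters between s / 20 and 4 s give the factor 80.
  have hfat : ∀ v : Fin vs.length, 1 / 40 ≤ inRadius ((vs.get v).1.triangle (2 * T + 3)) /
      outRadius ((vs.get v).1.triangle (2 * T + 3)) ∧
      Metric.diam ((vs.get v).1.triangle (2 * T + 3)) ≤ 4 * 2 ^ (2 * T + 3) ∧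
      2 ^ (2 * T + 3) / 20 ≤ Metric.diam ((vs.get v).1.triangle (2 * T + 3)) := fun v => by
    obtain ⟨c, hc⟩ := exists_closedBall_subset rfl (hb' v)
    obtain ⟨h1, h2, h3⟩ := fat_of_closedBall (by positivity) hc
      (triangle_subset_closedBall rfl (hb' v))
    refine ⟨le_of_eq_of_le ?_ h1, h2.trans_eq (by ring), h3⟩
    field_simp
    norm_num
  refine ⟨fun v => ?_, fun u v h => ?_, fun u v => ?_, ?_, ?_⟩
  · obtain ⟨c, hc⟩ := exists_closedBall_subset rfl (hb' v)
    exact affineIndependent_of_closedBall_subset (by positivity) hc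
  · exact get_injective hn (triangle_injective rfl hT (hb' u) (hb' v) h)
  · change _ ↔ u ≠ v ∧ ((vs.get u).1.triangle (2 * T + 3) ∩
      (vs.get v).1.triangle (2 * T + 3)).Nonempty
    rw [inter_nonempty_iff rfl (hb' u) (hb' v)]
    rfl
  · rintro _ ⟨v, rfl⟩
    exact (hfat v).1
  · rintro _ ⟨v, rfl⟩ _ ⟨w, rfl⟩
    have h1 := (hfat v).2.1
    have h2 := (hfat w).2.2
    change Metric.diam ((vs.get v).1.triangle (2 * T + 3)) /
      Metric.diam ((vs.get w).1.triangle (2 * T + 3)) ≤ 80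
    rw [div_le_iff₀ (by linarith [show (0 : ℝ) < 2 ^ (2 * T + 3) / 20 by positivity])]
    linarith

/-- As no shape occurs twice, colours can be attached to shapes instead of positions in the list. -/
theorem hasListHom_toInstance_iff (hn : (vs.map Prod.fst).Nodup) :
    (toInstance T vs).HasListHom octahedron ↔ ∃ c : Shape → Fin 6,
      (∀ q ∈ vs, q.2.getD (c q.1).val false = true) ∧
      ∀ q ∈ vs, ∀ q' ∈ vs, q.1 ≠ q'.1 → q.1.Meets q'.1 → octahedron.Adj (c q.1) (c q'.1) := by
  constructor
  · rintro ⟨h, h1, h2⟩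
    classical
    let c : Shape → Fin 6 := fun s =>
      if hs : ∃ v : Fin vs.length, (vs.get v).1 = s then h hs.choose else 0
    have hc : ∀ v : Fin vs.length, c (vs.get v).1 = h v := fun v => by
      have hs : ∃ w : Fin vs.length, (vs.get w).1 = (vs.get v).1 := ⟨v, rfl⟩
      simp only [c, dif_pos hs]
      exact congrArg h (get_injective hn hs.choose_spec)
    refine ⟨c, fun q hq => ?_, fun q hq q' hq' hne hm => ?_⟩
    · obtain ⟨v, rfl⟩ := List.get_of_mem hq
      rw [hc]
      exact (Finset.mem_filter.1 (h2 v)).2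
    · obtain ⟨v, rfl⟩ := List.get_of_mem hq
      obtain ⟨w, rfl⟩ := List.get_of_mem hq'
      rw [hc, hc]
      exact h1 v w ⟨fun h => hne (by rw [h]), hm⟩
  · rintro ⟨c, h1, h2⟩
    refine ⟨fun v => c (vs.get v).1, fun u v huv => ?_, fun v => ?_⟩
    · exact h2 _ (List.get_mem vs u) _ (List.get_mem vs v)
        (fun h => huv.1 (get_injective hn h)) huv.2
    · exact Finset.mem_filter.2 ⟨Finset.mem_univ _, h1 _ (List.get_mem vs v)⟩

end Shape

/-! ## Incidence structures -/

/-- `x` is in the set given by the mask `m`. -/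
def InMask (m : List Bool) (x : Fin 3) : Prop := m.getD x.val false = true

instance (m : List Bool) (x : Fin 3) : Decidable (InMask m x) :=
  inferInstanceAs (Decidable (_ = _))

/-- A keyed mask. -/
abbrev Entry : Type := List Bool × List Bool

/-- A mask, and the entries of a row. -/
abbrev Row : Type := List Bool × List Entry

/-- The elements of a list with the number of their successors, in unary. -/
def enumUnary {α : Type} : List α → List (List Bool × α)
  | [] => []
  | a :: l => (l.map fun _ => false, a) :: enumUnary l

section
variable {α : Type}

theorem length_enumUnary (l : List α) : (enumUnary l).length = l.length := by
  induction l <;> simp_all [enumUnary]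

theorem map_snd_enumUnary (l : List α) : (enumUnary l).map Prod.snd = l := by
  induction l <;> simp_all [enumUnary]

theorem enumUnary_lt {l : List α} {q : List Bool × α} (h : q ∈ enumUnary l) :
    q.1.length < l.length := by
  induction l with
  | nil => simp [enumUnary] at h
  | cons a l ih =>
    rcases List.mem_cons.1 h with rfl | h
    · simp
    · exact (ih h).trans (by simp)

theorem pairwise_enumUnary (l : List α) :
    (enumUnary l).Pairwise fun p q => q.1.length < p.1.length := by
  induction l with
  | nil => exact List.Pairwise.nil
  | cons a l ih => exact List.pairwise_cons.2 ⟨fun q hq => by simpa using enumUnary_lt hq, ih⟩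

theorem exists_enumUnary_inverse [Nonempty α] (l : List α) :
    ∃ g : ℕ → α, ∀ q ∈ enumUnary l, g q.1.length = q.2 := by
  induction l with
  | nil => exact ⟨fun _ => Classical.arbitrary α, fun q h => by simp [enumUnary] at h⟩
  | cons a l ih =>
    obtain ⟨g, hg⟩ := ih
    refine ⟨Function.update g l.length a, fun q hq => ?_⟩
    rcases List.mem_cons.1 hq with rfl | h
    · simp
    · rw [Function.update_of_ne (enumUnary_lt h).ne, hg q h]

theorem exists_mem_enumUnary {l : List α} {a : α} (h : a ∈ l) : ∃ u, (u, a) ∈ enumUnary l := by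
  rw [← map_snd_enumUnary l] at h
  obtain ⟨⟨u, a'⟩, h', rfl⟩ := List.mem_map.1 h
  exact ⟨u, h'⟩

end

/-- The position of a key, in unary. -/
def position (cols : List Entry) (κ : List Bool) : List Bool :=
  (((enumUnary cols).filter fun q => decide (q.2.1 = κ)).map Prod.fst).headD []

theorem position_mem {cols : List Entry} {κ : List Bool} (h : κ ∈ cols.map Prod.fst) :
    ∃ m, (position cols κ, (κ, m)) ∈ enumUnary cols := by
  obtain ⟨⟨κ', m⟩, h', rfl⟩ := List.mem_map.1 h
  obtain ⟨u, hu⟩ := exists_mem_enumUnary h'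
  dsimp only
  have hne : ((enumUnary cols).filter fun q => decide (q.2.1 = κ')) ≠ [] :=
    List.ne_nil_of_mem (List.mem_filter.2 ⟨hu, by simp⟩)
  unfold position
  rcases hF : (enumUnary cols).filter fun q => decide (q.2.1 = κ') with _ | ⟨⟨u', κ'', m'⟩, F⟩
  · exact absurd hF hne
  · have : (u', κ'', m') ∈ (enumUnary cols).filter fun q => decide (q.2.1 = κ') := by simp [hF]
    obtain ⟨h1, h2⟩ := List.mem_filter.1 this
    simp only [decide_eq_true_eq] at h2
    rw [hF]
    exact ⟨m', by simpa [h2] using h1⟩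

/-- Some values for rows and columns are such that every entry has a value different from both. -/
def IncidenceSat (cols : List Entry) (rows : List Row) : Prop :=
  ∃ cc : List Bool → Fin 3, (∀ q ∈ cols, InMask q.2 (cc q.1)) ∧
    ∀ row ∈ rows, ∃ c, InMask row.1 c ∧ ∀ e ∈ row.2, ∃ x, InMask e.2 x ∧ x ≠ c ∧ x ≠ cc e.1

/-- Shapes in terms of lists. -/
abbrev RawShape : Type := Bool × (Bool × (List Bool × List Bool))

/-- The shape with the given code. -/
def RawShape.toShape (q : RawShape) : Shape :=
  bif q.1 then Shape.link q.2.2.1.length q.2.2.2.length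
  else bif q.2.1 then Shape.col q.2.2.2.length else Shape.row q.2.2.1.length

/-- The vertices for a row. -/
def rowVertices (cols : List Entry) (q : List Bool × Row) : List (RawShape × List Bool) :=
  ((false, (false, (q.1, []))), [false, false, false] ++ q.2.1) ::
    q.2.2.map fun e => ((true, (false, (q.1, position cols e.1))), e.2 ++ [false, false, false])

/-- All vertices. -/
def vertices (cols : List Entry) (rows : List Row) : List (RawShape × List Bool) :=
  ((enumUnary cols).map fun q =>
    ((false, (true, ([], q.1))), [false, false, false] ++ q.2.2)) ++
  (enumUnary rows).flatMap (rowVertices cols)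

/-- The vertices, with their shapes. -/
def shapes (cols : List Entry) (rows : List Row) : List (Shape × List Bool) :=
  (vertices cols rows).map fun q => (q.1.toShape, q.2)

/-- Keys are not repeated, and masks have three bits. -/
structure Proper (cols : List Entry) (rows : List Row) : Prop where
  nodup : (cols.map Prod.fst).Nodup
  mask : ∀ q ∈ cols, q.2.length = 3
  row_mask : ∀ row ∈ rows, row.1.length = 3
  row_nodup : ∀ row ∈ rows, (row.2.map Prod.fst).Nodup
  row_mem : ∀ row ∈ rows, ∀ e ∈ row.2, e.1 ∈ cols.map Prod.fst ∧ e.2.length = 3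

variable {cols : List Entry} {rows : List Row}

theorem mem_shapes {q : Shape × List Bool} : q ∈ shapes cols rows ↔
    (∃ p ∈ enumUnary cols, q = (Shape.col p.1.length, [false, false, false] ++ p.2.2)) ∨
    ∃ p ∈ enumUnary rows, q = (Shape.row p.1.length, [false, false, false] ++ p.2.1) ∨
      ∃ e ∈ p.2.2, q = (Shape.link p.1.length (position cols e.1).length,
        e.2 ++ [false, false, false]) := by
  simp only [shapes, vertices, rowVertices, List.map_append, List.map_flatMap, List.mem_append,
    List.mem_flatMap, List.map_map, List.map_cons, List.mem_cons, List.mem_map, Function.comp_apply,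
    RawShape.toShape, cond_true, cond_false, @eq_comm _ q]

theorem Proper.position_lt (h : Proper cols rows) {row : Row} (hr : row ∈ rows) {e : Entry}
    (he : e ∈ row.2) : (position cols e.1).length < cols.length := by
  obtain ⟨m, hm⟩ := position_mem (h.row_mem row hr e he).1
  exact enumUnary_lt hm

theorem row_mem_of_enumUnary {p : List Bool × Row} (h : p ∈ enumUnary rows) : p.2 ∈ rows := by
  rw [← map_snd_enumUnary rows]
  exact List.mem_map_of_mem h

theorem Proper.below (h : Proper cols rows) {T : ℕ} (hc : cols.length ≤ T) (hr : rows.length ≤ T) :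
    ∀ q ∈ shapes cols rows, q.1.Below T := by
  intro q hq
  rcases mem_shapes.1 hq with ⟨p, hp, rfl⟩ | ⟨p, hp, rfl | ⟨e, he, rfl⟩⟩
  · exact (enumUnary_lt hp).trans_le hc
  · exact (enumUnary_lt hp).trans_le hr
  · exact ⟨(enumUnary_lt hp).trans_le hr,
      (h.position_lt (row_mem_of_enumUnary hp) he).trans_le hc⟩

theorem Proper.nodup_shapes (h : Proper cols rows) :
    ((shapes cols rows).map Prod.fst).Nodup := by
  have e : (shapes cols rows).map Prod.fst =
      (enumUnary cols).map (fun p => Shape.col p.1.length) ++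
      (enumUnary rows).flatMap fun p => Shape.row p.1.length ::
        p.2.2.map fun e => Shape.link p.1.length (position cols e.1).length := by
    simp [shapes, vertices, rowVertices, List.map_flatMap, RawShape.toShape, Function.comp_def]
  rw [e, List.nodup_append]
  refine ⟨?_, List.nodup_flatMap.2 ⟨fun p hp => ?_, ?_⟩, ?_⟩
  · exact List.pairwise_map.2 ((pairwise_enumUnary cols).imp fun h h' => by
      simp only [Shape.col.injEq] at h'; omega)
  · refine List.nodup_cons.2 ⟨by simp, ?_⟩
    have hr := row_mem_of_enumUnary hp
    refine List.pairwise_map.2 ((List.pairwise_map.1 (h.row_nodup _ hr)).imp_of_mem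
      fun {e e'} he he' hne h' => hne ?_)
    simp only [Shape.link.injEq, true_and] at h'
    obtain ⟨m, hm⟩ := position_mem (h.row_mem _ hr e he).1
    obtain ⟨m', hm'⟩ := position_mem (h.row_mem _ hr e' he').1
    obtain ⟨g, hg⟩ := exists_enumUnary_inverse cols
    have h1 := hg _ hm
    have h2 := hg _ hm'
    simp only [h'] at h1 h2
    rw [h1] at h2
    exact (Prod.mk.inj h2).1
  · refine (pairwise_enumUnary rows).imp fun {p p'} hlt => ?_
    simp only [Function.onFun, List.disjoint_left, List.mem_cons, List.mem_map]
    rintro _ (rfl | ⟨e, he, rfl⟩) (h' | ⟨e', he', h'⟩) <;> simp at h' <;> omega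
  · simp only [List.mem_map, List.mem_flatMap, List.mem_cons]
    rintro _ ⟨p, hp, rfl⟩ _ ⟨p', hp', rfl | ⟨e, he, rfl⟩⟩ <;> simp

/-- Masks are padded so that rows and columns take the colours 3, 4, 5 and links the colours 0, 1,
2. Either triple is a clique with loops, so that the many intersections within a class are void,
while x and y + 3 are adjacent exactly if x ≠ y. What remains of a link is the existence of a value
in its mask that differs from those of its row and its column. -/
theorem hasListHom_shapes_iff (h : Proper cols rows) (T : ℕ) :
    (Shape.toInstance T (shapes cols rows)).HasListHom octahedron ↔ IncidenceSat cols rows := by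
  rw [Shape.hasListHom_toInstance_iff h.nodup_shapes]
  let red : Fin 6 → Fin 3 := fun x => ⟨x.val % 3, Nat.mod_lt _ (by norm_num)⟩
  have low : ∀ (m : List Bool) (x : Fin 6), m.length = 3 →
      (m ++ [false, false, false]).getD x.val false = true → x.val < 3 ∧ InMask m (red x) := by
    intro m x hm hx
    rw [List.length_eq_three] at hm
    obtain ⟨a, b, c, rfl⟩ := hm
    fin_cases x <;> simp [InMask, red] at hx ⊢ <;> exact hx
  have high : ∀ (m : List Bool) (x : Fin 6), m.length = 3 →
      ([false, false, false] ++ m).getD x.val false = true → 3 ≤ x.val ∧ InMask m (red x) := by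
    intro m x hm hx
    rw [List.length_eq_three] at hm
    obtain ⟨a, b, c, rfl⟩ := hm
    fin_cases x <;> simp [InMask, red] at hx ⊢ <;> exact hx
  have red_ne : ∀ x y : Fin 6, x.val < 3 → 3 ≤ y.val → octahedron.Adj x y → red x ≠ red y := by
    rintro x y hx hy (rfl | h)
    · omega
    · exact fun h' => h (congrArg Fin.val h')
  have huniq : ∀ κ m m', (κ, m) ∈ cols → (κ, m') ∈ cols → m = m' := fun κ m m' h1 h2 =>
    (Prod.mk.inj (List.inj_on_of_nodup_map h.nodup h1 h2 rfl)).2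
  have hcol : ∀ p ∈ enumUnary cols, p.2 ∈ cols := fun p hp => by
    rw [← map_snd_enumUnary cols]
    exact List.mem_map_of_mem hp
  constructor
  · rintro ⟨c, h1, h2⟩
    have hc : ∀ κ ∈ cols.map Prod.fst, ∃ m, (κ, m) ∈ cols ∧
        (Shape.col (position cols κ).length, [false, false, false] ++ m) ∈ shapes cols rows := by
      intro κ hκ
      obtain ⟨m, hm⟩ := position_mem hκ
      exact ⟨m, hcol _ hm, mem_shapes.2 (Or.inl ⟨_, hm, rfl⟩)⟩
    refine ⟨fun κ => red (c (Shape.col (position cols κ).length)), fun q hq => ?_,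
      fun row hrow => ?_⟩
    · obtain ⟨m, hm, hs⟩ := hc q.1 (List.mem_map_of_mem hq)
      have := huniq _ _ _ hq hm
      rw [this]
      exact (high m _ (h.mask _ hm) (h1 _ hs)).2
    · obtain ⟨u, hu⟩ := exists_mem_enumUnary hrow
      have hsr : (Shape.row u.length, [false, false, false] ++ row.1) ∈ shapes cols rows :=
        mem_shapes.2 (Or.inr ⟨_, hu, Or.inl rfl⟩)
      obtain ⟨r1, r2⟩ := high _ _ (h.row_mask row hrow) (h1 _ hsr)
      refine ⟨_, r2, fun e he => ?_⟩
      obtain ⟨hκ, hm⟩ := h.row_mem row hrow e he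
      have hse : (Shape.link u.length (position cols e.1).length, e.2 ++ [false, false, false]) ∈
        shapes cols rows := mem_shapes.2 (Or.inr ⟨_, hu, Or.inr ⟨e, he, rfl⟩⟩)
      obtain ⟨m, hm', hsc⟩ := hc e.1 hκ
      obtain ⟨e1, e2⟩ := low _ _ hm (h1 _ hse)
      refine ⟨_, e2, red_ne _ _ e1 r1 (h2 _ hse _ hsr (by simp) rfl), red_ne _ _ e1 ?_
        (h2 _ hse _ hsc (by simp) rfl)⟩
      exact (high m _ (h.mask _ hm') (h1 _ hsc)).1
  · rintro ⟨cc, h1, h2⟩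
    choose! r hr1 hr2 using h2
    have hX : ∀ row, ∃ X : List Bool → Fin 3, row ∈ rows → ∀ e ∈ row.2,
        InMask e.2 (X e.1) ∧ X e.1 ≠ r row ∧ X e.1 ≠ cc e.1 := by
      intro row
      -- The value of a link is made a function of the key alone, which is possible since keys are
      -- not repeated within a row.
      have : ∀ κ, ∃ x, row ∈ rows → ∀ e ∈ row.2, e.1 = κ →
          InMask e.2 x ∧ x ≠ r row ∧ x ≠ cc e.1 := by
        intro κ
        by_cases hk : row ∈ rows ∧ ∃ e ∈ row.2, e.1 = κ
        · obtain ⟨hrow, e, he, rfl⟩ := hk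
          obtain ⟨x, hx⟩ := hr2 row hrow e he
          refine ⟨x, fun _ e' he' hee => ?_⟩
          rwa [List.inj_on_of_nodup_map (h.row_nodup row hrow) he' he hee]
        · exact ⟨0, fun hrow e he hee => absurd ⟨hrow, e, he, hee⟩ hk⟩
      choose X hX using this
      exact ⟨X, fun hrow e he => hX e.1 hrow e he rfl⟩
    choose X hX using hX
    obtain ⟨g, hg⟩ := exists_enumUnary_inverse rows
    obtain ⟨k, hk⟩ := exists_enumUnary_inverse cols
    have hpos : ∀ κ ∈ cols.map Prod.fst, (k (position cols κ).length).1 = κ := fun κ hκ => by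
      obtain ⟨m, hm⟩ := position_mem hκ
      rw [hk _ hm]
    let lo : Fin 3 → Fin 6 := fun y => ⟨y.val, by omega⟩
    let up : Fin 3 → Fin 6 := fun y => ⟨y.val + 3, by omega⟩
    have hlo : ∀ m y, InMask m y → (m ++ [false, false, false]).getD (lo y).val false = true := by
      intro m y hy
      simp only [InMask, List.getD_eq_getElem?_getD] at hy ⊢
      by_cases hlt : y.val < m.length
      · rwa [List.getElem?_append_left hlt]
      · rw [List.getElem?_eq_none (by omega)] at hy
        simp at hy
    have hup : ∀ m y, InMask m y → ([false, false, false] ++ m).getD (up y).val false = true := by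
      intro m y hy
      simpa [InMask, up] using hy
    have hll : ∀ x y, octahedron.Adj (lo x) (lo y) := by decide
    have huu : ∀ x y, octahedron.Adj (up x) (up y) := by decide
    have hlu : ∀ x y, x ≠ y → octahedron.Adj (lo x) (up y) := by decide
    let c : Shape → Fin 6 := fun
      | Shape.row a => up (r (g a))
      | Shape.col b => up (cc (k b).1)
      | Shape.link a b => lo (X (g a) (k b).1)
    have hlink : ∀ p ∈ enumUnary rows, ∀ e ∈ p.2.2, c (Shape.link p.1.length
        (position cols e.1).length) = lo (X p.2 e.1) := fun p hp e he => by
      simp only [c, hg p hp, hpos _ (h.row_mem _ (row_mem_of_enumUnary hp) e he).1]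
    have hrowc : ∀ p ∈ enumUnary rows, c (Shape.row p.1.length) = up (r p.2) := fun p hp => by
      simp only [c, hg p hp]
    have hcolc : ∀ p ∈ enumUnary cols, c (Shape.col p.1.length) = up (cc p.2.1) := fun p hp => by
      simp only [c, hk p hp]
    have hrl : ∀ p ∈ enumUnary rows, ∀ p' ∈ enumUnary rows, ∀ e ∈ p'.2.2,
        p'.1.length = p.1.length → octahedron.Adj (lo (X p'.2 e.1)) (up (r p.2)) := by
      intro p hp p' hp' e he hlen
      have : p'.2 = p.2 := by rw [← hg p hp, ← hg p' hp', hlen]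
      rw [← this]
      exact hlu _ _ (hX _ (row_mem_of_enumUnary hp') e he).2.1
    have hcl : ∀ p ∈ enumUnary cols, ∀ p' ∈ enumUnary rows, ∀ e ∈ p'.2.2,
        (position cols e.1).length = p.1.length →
        octahedron.Adj (lo (X p'.2 e.1)) (up (cc p.2.1)) := by
      intro p hp p' hp' e he hlen
      have : e.1 = p.2.1 := by
        rw [← hk p hp, ← hlen, hpos _ (h.row_mem _ (row_mem_of_enumUnary hp') e he).1]
      rw [← this]
      exact hlu _ _ (hX _ (row_mem_of_enumUnary hp') e he).2.2
    refine ⟨c, fun q hq => ?_, fun q hq q' hq' _ hm => ?_⟩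
    · rcases mem_shapes.1 hq with ⟨p, hp, rfl⟩ | ⟨p, hp, rfl | ⟨e, he, rfl⟩⟩
      · rw [hcolc p hp]
        exact hup _ _ (h1 _ (hcol p hp))
      · rw [hrowc p hp]
        exact hup _ _ (hr1 _ (row_mem_of_enumUnary hp))
      · rw [hlink p hp e he]
        exact hlo _ _ (hX _ (row_mem_of_enumUnary hp) e he).1
    · rcases mem_shapes.1 hq with ⟨p, hp, rfl⟩ | ⟨p, hp, rfl | ⟨e, he, rfl⟩⟩ <;>
      rcases mem_shapes.1 hq' with ⟨p', hp', rfl⟩ | ⟨p', hp', rfl | ⟨e', he', rfl⟩⟩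
      · rw [hcolc p hp, hcolc p' hp']; exact huu _ _
      · rw [hcolc p hp, hrowc p' hp']; exact huu _ _
      · rw [hcolc p hp, hlink p' hp' e' he']
        exact octahedron.symm _ _ (hcl p hp p' hp' e' he' hm)
      · rw [hrowc p hp, hcolc p' hp']; exact huu _ _
      · rw [hrowc p hp, hrowc p' hp']; exact huu _ _
      · rw [hrowc p hp, hlink p' hp' e' he']
        exact octahedron.symm _ _ (hrl p hp p' hp' e' he' hm)
      · rw [hlink p hp e he, hcolc p' hp']; exact hcl p' hp' p hp e he hm
      · rw [hlink p hp e he, hrowc p' hp']; exact hrl p' hp' p hp e he hm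
      · rw [hlink p hp e he, hlink p' hp' e' he']; exact hll _ _

theorem length_vertices (cols : List Entry) (rows : List Row) {k : ℕ}
    (hk : ∀ row ∈ rows, row.2.length = k) :
    (shapes cols rows).length = cols.length + (k + 1) * rows.length := by
  rw [shapes, List.length_map, vertices, List.length_append, List.length_map, length_enumUnary]
  congr 1
  induction rows with
  | nil => simp [enumUnary]
  | cons row rows ih =>
    rw [enumUnary, List.flatMap_cons, List.length_append, ih fun r hr => hk r (by simp [hr])]
    simp only [rowVertices, List.length_cons, List.length_map, hk row (by simp)]
    ring

/-! ## Computing the encoding of an instance -/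

theorem bits_two_pow_mul (a : ℕ) {n : ℕ} (hn : n ≠ 0) :
    (2 ^ a * n).bits = List.replicate a false ++ n.bits := by
  induction a with
  | zero => simp
  | succ a ih =>
    rw [pow_succ', mul_assoc, Nat.bit0_bits _ (by positivity), ih, List.replicate_succ,
      List.cons_append]

theorem bits_two_pow (a : ℕ) : (2 ^ a).bits = List.replicate a false ++ [true] := by
  simpa using bits_two_pow_mul a one_ne_zero

theorem bits_two_pow_sub_one (k : ℕ) : (2 ^ k - 1).bits = List.replicate k true := by
  induction k with
  | zero => simp
  | succ k ih =>
    have : 2 ^ (k + 1) - 1 = 2 * (2 ^ k - 1) + 1 := by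
      have := Nat.one_le_two_pow (n := k)
      omega
    rw [this, Nat.bit1_bits, ih, List.replicate_succ]

/-- In binary this is a run of ones above a run of zeros, so it can be written down from the
exponents in unary. This is why the tips have powers of two as abscissas. -/
theorem bits_two_pow_sub {a L : ℕ} (h : a < L) :
    (2 ^ L - 2 ^ a).bits = List.replicate a false ++ List.replicate (L - a) true := by
  obtain ⟨k, rfl⟩ := Nat.exists_eq_add_of_lt h
  have h1 : 2 ^ (a + k + 1) - 2 ^ a = 2 ^ a * (2 ^ (k + 1) - 1) := by
    rw [Nat.mul_sub, mul_one, ← pow_add, add_assoc]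
  have h2 : 2 ^ (k + 1) - 1 ≠ 0 := by
    have := Nat.one_lt_two_pow (n := k + 1) (by omega)
    omega
  rw [h1, bits_two_pow_mul a h2, bits_two_pow_sub_one]
  congr 2
  omega

/-- Codes of rational numbers. -/
abbrev RawRat : Type := (Bool × List Bool) × List Bool

theorem encRat_intCast (z : ℤ) :
    encRat (z : ℚ) = Data.cons (encInt z) (code [true]) := by
  rw [encRat, Rat.num_intCast, Rat.den_intCast, encNat, Nat.one_bits]
  rfl

theorem encRat_natCast (n : ℕ) :
    encRat ((n : ℤ) : ℚ) = code (((false, n.bits), [true]) : RawRat) := by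
  rw [encRat_intCast, encInt, decide_eq_false (by omega)]
  rfl

theorem encRat_neg_natCast {n : ℕ} (hn : n ≠ 0) :
    encRat ((-(n : ℤ) : ℤ) : ℚ) = code (((true, n.bits), [true]) : RawRat) := by
  rw [encRat_intCast, encInt, decide_eq_true (by omega), Int.natAbs_neg, Int.natAbs_natCast]
  rfl

/-! ### Corners and adjacency in terms of bit lists. -/

namespace RawShape

/-- The bits of `2 ^ u.length`. -/
def powBits (u : List Bool) : List Bool := (u.map fun _ => false) ++ [true]

/-- The bits of `2 ^ l.length - 4 ^ u.length`. -/
def gapBits (l u : List Bool) : List Bool :=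
  ((u ++ u).map fun _ => false) ++ (l.drop (u ++ u).length).map fun _ => true

/-- The number with given sign and bits. -/
def rat (b : Bool) (l : List Bool) : RawRat := ((b, l), [true])

/-- The codes of the corners. -/
def corners (l : List Bool) (q : RawShape) : List (RawRat × RawRat) :=
  bif q.1 then
    [(rat true (powBits q.2.2.1), rat false (gapBits l q.2.2.1)),
     (rat true (powBits q.2.2.2), rat true (gapBits l q.2.2.2)),
     (rat false (powBits l), rat false [])]
  else bif q.2.1 then
    [(rat true (powBits q.2.2.2), rat true (gapBits l q.2.2.2)),
     (rat true (powBits l), rat true (powBits l)), (rat true (powBits l), rat false [])]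
  else
    [(rat true (powBits q.2.2.1), rat false (gapBits l q.2.2.1)),
     (rat true (powBits l), rat false (powBits l)), (rat true (powBits l), rat false [])]

theorem code_rat_two_pow (u : List Bool) :
    code (rat false (powBits u)) = encRat (((2 ^ u.length : ℤ) : ℚ)) := by
  have := encRat_natCast (2 ^ u.length)
  rw [bits_two_pow] at this
  simp only [Nat.cast_pow, Nat.cast_ofNat] at this
  rw [this, rat, powBits, List.map_const']

theorem code_rat_neg_two_pow (u : List Bool) :
    code (rat true (powBits u)) = encRat (((-2 ^ u.length : ℤ) : ℚ)) := by
  have := encRat_neg_natCast (n := 2 ^ u.length) (by positivity)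
  rw [bits_two_pow] at this
  simp only [Nat.cast_pow, Nat.cast_ofNat] at this
  rw [this, rat, powBits, List.map_const']

theorem cast_gap {a L : ℕ} (h : 2 * a < L) :
    ((2 ^ L - 2 ^ (2 * a) : ℕ) : ℤ) = 2 ^ L - 4 ^ a := by
  rw [Nat.cast_sub (Nat.pow_le_pow_right (by norm_num) h.le), pow_mul]
  norm_num

theorem gapBits_eq {l u : List Bool} (h : 2 * u.length < l.length) :
    gapBits l u = (2 ^ l.length - 2 ^ (2 * u.length)).bits := by
  rw [bits_two_pow_sub h, gapBits]
  simp [List.map_const', two_mul]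

theorem code_rat_gap {l u : List Bool} (h : 2 * u.length < l.length) :
    code (rat false (gapBits l u)) = encRat (((2 ^ l.length - 4 ^ u.length : ℤ) : ℚ)) := by
  rw [← cast_gap h, encRat_natCast, rat, gapBits_eq h]

theorem code_rat_neg_gap {l u : List Bool} (h : 2 * u.length < l.length) :
    code (rat true (gapBits l u)) = encRat (((-(2 ^ l.length - 4 ^ u.length) : ℤ) : ℚ)) := by
  have h0 : 2 ^ l.length - 2 ^ (2 * u.length) ≠ 0 := by
    have := Nat.pow_lt_pow_right (show 1 < 2 by norm_num) h
    omega
  rw [← cast_gap h, encRat_neg_natCast h0, rat, gapBits_eq h]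

theorem code_rat_zero : code (rat false []) = encRat (((0 : ℤ) : ℚ)) := by
  have := encRat_natCast 0
  simpa [rat] using this.symm

theorem code_corners {l : List Bool} {T : ℕ} (hl : l.length = 2 * T + 3) {q : RawShape}
    (hq : q.toShape.Below T) : code (corners l q) = encList (List.ofFn fun j : Fin 3 =>
      Data.cons (encRat ((q.toShape.corner (2 * T + 3) j).1 : ℚ))
        (encRat ((q.toShape.corner (2 * T + 3) j).2 : ℚ))) := by
  rw [← hl]
  -- The general lemma of this name would also take apart the codes of the rationals, which are
  -- pairs themselves; this instance stops at them.
  have code_pair : ∀ a b : RawRat, code (a, b) = Data.cons (code a) (code b) := fun _ _ => rfl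
  obtain ⟨x, side, a, b⟩ := q
  cases x
  · cases side
    · have ha : a.length < T := hq
      simp only [corners, cond_false, code_cons, code_pair, code_nil, code_rat_neg_two_pow,
        code_rat_two_pow, code_rat_zero, code_rat_gap (show 2 * a.length < l.length by omega),
        toShape, Shape.corner, List.ofFn_succ, List.ofFn_zero]
      rfl
    · have hb : b.length < T := hq
      simp only [corners, cond_false, cond_true, code_cons, code_pair, code_nil,
        code_rat_neg_two_pow, code_rat_zero,
        code_rat_neg_gap (show 2 * b.length < l.length by omega),
        toShape, Shape.corner, List.ofFn_succ, List.ofFn_zero]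
      rfl
  · have ha : a.length < T := hq.1
    have hb : b.length < T := hq.2
    simp only [corners, cond_true, code_cons, code_pair, code_nil,
      code_rat_neg_two_pow, code_rat_two_pow, code_rat_zero,
      code_rat_gap (show 2 * a.length < l.length by omega),
      code_rat_neg_gap (show 2 * b.length < l.length by omega),
      toShape, Shape.corner, List.ofFn_succ, List.ofFn_zero]
    rfl

/-- Equality of lengths. -/
def sameLength (u v : List Bool) : Bool := (u.drop v.length).isEmpty && (v.drop u.length).isEmpty

theorem sameLength_eq (u v : List Bool) : sameLength u v = decide (u.length = v.length) := by
  rw [Bool.eq_iff_iff]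
  simp [sameLength]
  omega

/-- Adjacency of vertices. -/
def adj (q q' : RawShape) : Bool :=
  bif q.1 then
    bif q'.1 then !(sameLength q.2.2.1 q'.2.2.1 && sameLength q.2.2.2 q'.2.2.2)
    else bif q'.2.1 then sameLength q.2.2.2 q'.2.2.2 else sameLength q.2.2.1 q'.2.2.1
  else bif q'.1 then
    bif q.2.1 then sameLength q'.2.2.2 q.2.2.2 else sameLength q'.2.2.1 q.2.2.1
  else bif q.2.1 then
    bif q'.2.1 then !sameLength q.2.2.2 q'.2.2.2 else true
  else
    bif q'.2.1 then true else !sameLength q.2.2.1 q'.2.2.1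

theorem adj_iff (q q' : RawShape) :
    adj q q' = true ↔ q.toShape ≠ q'.toShape ∧ q.toShape.Meets q'.toShape := by
  obtain ⟨x, side, a, b⟩ := q
  obtain ⟨x', side', a', b'⟩ := q'
  cases x <;> cases x' <;> cases side <;> cases side' <;>
    simp [adj, toShape, Shape.Meets, sameLength_eq, imp_iff_not_or]

/-- The encoding of the instance with the vertices `V`, where `l` is the scale in unary. -/
def rawInstance (l : List Bool) (V : List (RawShape × List Bool)) :
    List (List (RawRat × RawRat) × (List Bool × List Bool)) :=
  V.map fun q => (corners l q.1, (q.2, V.map fun q' => adj q.1 q'.1))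

theorem code_rawInstance {l : List Bool} {T : ℕ} (hl : l.length = 2 * T + 3)
    {V : List (RawShape × List Bool)} (hV : ∀ q ∈ V, q.1.toShape.Below T ∧ q.2.length = 6)
    (hn : ((V.map fun q => (q.1.toShape, q.2)).map Prod.fst).Nodup) :
    code (rawInstance l V) = (Shape.toInstance T (V.map fun q => (q.1.toShape, q.2))).enc := by
  have hlen : (V.map fun q => (q.1.toShape, q.2)).length = V.length := by simp
  rw [TriangleInstance.enc]
  change encList ((rawInstance l V).map code) = _
  congr 1
  refine List.ext_getElem ?_ fun i h1 h2 => ?_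
  · simp [rawInstance, Shape.toInstance]
  have hi : i < V.length := by simpa [rawInstance] using h1
  obtain ⟨hb, hm⟩ := hV _ (List.getElem_mem hi)
  simp only [rawInstance, List.getElem_map, List.getElem_ofFn, code_pair]
  rw [code_corners hl hb]
  congr 1
  · congr 1
    refine congrArg _ (funext fun j => ?_)
    simp [Shape.toInstance]
  congr 1
  · change encList (V[i].2.map encBool) = _
    congr 1
    refine List.ext_getElem (by simp [hm]) fun j h3 h4 => ?_
    have hj : j < 6 := by simpa using h4
    simp only [List.getElem_map, List.getElem_ofFn]
    congr 1
    have hj' : j < V[i].2.length := by omega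
    rw [Bool.eq_iff_iff]
    simp [Shape.toInstance, hj']
  · change encList ((V.map fun q' => adj V[i].1 q'.1).map encBool) = _
    congr 1
    refine List.ext_getElem (by simp [Shape.toInstance]) fun j h3 h4 => ?_
    have hj : j < V.length := by simpa using h3
    simp only [List.getElem_map, List.getElem_ofFn]
    congr 1
    rw [Bool.eq_iff_iff, adj_iff]
    -- The encoding decides adjacency classically, so this instance has to be named.
    refine Iff.trans ?_ (@decide_eq_true_iff _ (Classical.propDecidable _)).symm
    simp only [Shape.toInstance, List.get_eq_getElem, List.getElem_map]
    refine and_congr_left fun _ => not_congr ⟨fun h => ?_, fun h => ?_⟩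
    · have := Shape.get_injective hn (u := ⟨i, by simpa using hi⟩) (v := ⟨j, by simpa using hj⟩)
        (by simpa using h)
      exact this
    · have h' : i = j := congrArg Fin.val h
      subst h'
      rfl

variable {α : Type} [DataEnc α]

theorem polyTime_powBits {f : α → List Bool} (hf : PolyTime f) :
    PolyTime (fun a => powBits (f a)) :=
  .append (.map hf (.const false)) (.const [true])

theorem polyTime_gapBits {f g : α → List Bool} (hf : PolyTime f) (hg : PolyTime g) :
    PolyTime (fun a => gapBits (f a) (g a)) :=
  .append (.map (.append hg hg) (.const false)) (.map (.drop (.append hg hg) hf) (.const true))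

theorem polyTime_rat (b : Bool) {f : α → List Bool} (hf : PolyTime f) :
    PolyTime (fun a => rat b (f a)) :=
  .pair (.pair (.const b) hf) (.const [true])

theorem polyTime_corners {f : α → List Bool} {g : α → RawShape} (hf : PolyTime f)
    (hg : PolyTime g) : PolyTime (fun a => corners (f a) (g a)) := by
  have ha : PolyTime fun a => (g a).2.2.1 := .fst' (.snd' (.snd' hg))
  have hb : PolyTime fun a => (g a).2.2.2 := .snd' (.snd' (.snd' hg))
  have hz : PolyTime fun a => (rat true (powBits (f a)), rat false []) :=
    .pair (polyTime_rat true (polyTime_powBits hf)) (.const (rat false []))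
  exact .cond (.fst' hg)
    (.cons (.pair (polyTime_rat true (polyTime_powBits ha)) (polyTime_rat false (polyTime_gapBits hf ha))) <|
      .cons (.pair (polyTime_rat true (polyTime_powBits hb)) (polyTime_rat true (polyTime_gapBits hf hb))) <|
      .cons (.pair (polyTime_rat false (polyTime_powBits hf)) (.const (rat false []))) (.const []))
    (.cond (.fst' (.snd' hg))
      (.cons (.pair (polyTime_rat true (polyTime_powBits hb)) (polyTime_rat true (polyTime_gapBits hf hb))) <|
        .cons (.pair (polyTime_rat true (polyTime_powBits hf)) (polyTime_rat true (polyTime_powBits hf))) <|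
        .cons hz (.const []))
      (.cons (.pair (polyTime_rat true (polyTime_powBits ha)) (polyTime_rat false (polyTime_gapBits hf ha))) <|
        .cons (.pair (polyTime_rat true (polyTime_powBits hf)) (polyTime_rat false (polyTime_powBits hf))) <|
        .cons hz (.const [])))

theorem polyTime_sameLength {f g : α → List Bool} (hf : PolyTime f) (hg : PolyTime g) :
    PolyTime (fun a => sameLength (f a) (g a)) :=
  .and (.isEmpty (.drop hg hf)) (.isEmpty (.drop hf hg))

theorem polyTime_adj {f g : α → RawShape} (hf : PolyTime f) (hg : PolyTime g) :
    PolyTime (fun a => adj (f a) (g a)) := by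
  have ha : PolyTime fun a => (f a).2.2.1 := .fst' (.snd' (.snd' hf))
  have hb : PolyTime fun a => (f a).2.2.2 := .snd' (.snd' (.snd' hf))
  have ha' : PolyTime fun a => (g a).2.2.1 := .fst' (.snd' (.snd' hg))
  have hb' : PolyTime fun a => (g a).2.2.2 := .snd' (.snd' (.snd' hg))
  have hs : PolyTime fun a => (f a).2.1 := .fst' (.snd' hf)
  have hs' : PolyTime fun a => (g a).2.1 := .fst' (.snd' hg)
  exact .cond (.fst' hf)
    (.cond (.fst' hg) (.not (.and (polyTime_sameLength ha ha') (polyTime_sameLength hb hb')))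
      (.cond hs' (polyTime_sameLength hb hb') (polyTime_sameLength ha ha')))
    (.cond (.fst' hg)
      (.cond hs (polyTime_sameLength hb' hb) (polyTime_sameLength ha' ha))
      (.cond hs (.cond hs' (.not (polyTime_sameLength hb hb')) (.const true))
        (.cond hs' (.const true) (.not (polyTime_sameLength ha ha')))))

theorem polyTime_rawInstance {f : α → List Bool} {g : α → List (RawShape × List Bool)}
    (hf : PolyTime f) (hg : PolyTime g) : PolyTime (fun a => rawInstance (f a) (g a)) :=
  .map hg <| .pair (polyTime_corners (.comp hf .fst) (.fst' .snd)) <|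
    .pair (.snd' .snd) <| .map (.comp hg .fst) (polyTime_adj (.fst' (.snd' .fst)) (.fst' .snd))

end RawShape

/-! ### The encoded instance in polynomial time. -/

section
variable {α β : Type} [DataEnc α] [DataEnc β]

/-- The fold from the right carries the unary number of the elements seen so far, besides the
enumeration. The output has quadratic size. -/
theorem polyTime_enumUnary {f : α → List β} (hf : PolyTime f) :
    PolyTime (fun a => enumUnary (f a)) := by
  let g : β → List Bool × List (List Bool × β) → List Bool × List (List Bool × β) := fun b s =>
    (false :: s.1, (s.1, b) :: s.2)
  have key : ∀ l : List β, l.foldr g ([], []) = (l.map fun _ => false, enumUnary l) := by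
    intro l
    induction l with
    | nil => rfl
    | cons b l ih => rw [List.foldr_cons, ih]; rfl
  have hu : ∀ l : List β, codeSize (l.map fun _ => false) ≤ codeSize l := by
    intro l
    induction l with
    | nil => simp
    | cons b l ih =>
      have := codeSize_pos b
      simp only [List.map_cons, codeSize_cons, codeSize_false]
      omega
  have hz : ∀ l : List β, codeSize (enumUnary l) ≤ codeSize l * (2 * codeSize l) := by
    intro l
    induction l with
    | nil => simp [enumUnary]
    | cons b l ih =>
      have := hu l
      simp only [enumUnary, codeSize_cons, codeSize_pair]
      have := codeSize_pos b
      nlinarith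
  have h : PolyTime (fun l : List β => l.foldr g ([], [])) := by
    refine .foldr (l := fun l : List β => l) (g := fun _ => g) .id (.const ([], []))
      (.pair (.cons (.const false) (.fst' (.fst' .snd)))
        (.cons (.pair (.fst' (.fst' .snd)) (.snd' .snd)) (.snd' (.fst' .snd))))
      (Polynomial.X + Polynomial.X * (2 * Polynomial.X) + 1) fun a l₁ l₂ h => ?_
    have h1 := codeSize_sublist (h ▸ List.sublist_append_right l₁ l₂ : l₂.Sublist a)
    have h2 := hu l₂
    have h3 := (hz l₂).trans (Nat.mul_le_mul h1 (Nat.mul_le_mul_left 2 h1))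
    rw [key]
    simp only [codeSize_pair, Polynomial.eval_add, Polynomial.eval_mul, Polynomial.eval_X,
      Polynomial.eval_ofNat, Polynomial.eval_one]
    omega
  exact (PolyTime.snd' (PolyTime.comp h hf)).congr fun a => by rw [key]

theorem polyTime_position {f : α → List Entry} {g : α → List Bool} (hf : PolyTime f)
    (hg : PolyTime g) : PolyTime (fun a => position (f a) (g a)) :=
  .headD (.map (.filter (polyTime_enumUnary hf) (.eq (.fst' (.snd' .snd)) (.comp hg .fst)))
    (.fst' .snd)) (.const [])

theorem polyTime_rowVertices {f : α → List Entry} {g : α → List Bool × Row} (hf : PolyTime f)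
    (hg : PolyTime g) : PolyTime (fun a => rowVertices (f a) (g a)) :=
  .cons (.pair (.pair (.const false) (.pair (.const false) (.pair (.fst' hg) (.const []))))
      (.append (.const [false, false, false]) (.fst' (.snd' hg)))) <|
    .map (.snd' (.snd' hg)) <|
      .pair (.pair (.const true) (.pair (.const false) (.pair (.fst' (.comp hg .fst))
        (polyTime_position (.comp hf .fst) (.fst' .snd)))))
        (.append (.snd' .snd) (.const [false, false, false]))

theorem polyTime_vertices {f : α → List Entry} {g : α → List Row} (hf : PolyTime f)
    (hg : PolyTime g) : PolyTime (fun a => vertices (f a) (g a)) :=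
  .append
    (.map (polyTime_enumUnary hf) <| .pair (.pair (.const false) (.pair (.const true)
      (.pair (.const []) (.fst' .snd)))) (.append (.const [false, false, false]) (.snd' (.snd' .snd))))
    (.flatMap (polyTime_enumUnary hg) (polyTime_rowVertices (.comp hf .fst) .snd))

/-- A bound for the number of rows and columns, in unary. -/
def unaryBound (cols : List Entry) (rows : List Row) : List Bool :=
  (cols.map fun _ => false) ++ ((rows.map fun _ => false) ++ [false, false])

/-- The exponent of the scale, in unary. -/
def unaryScale (cols : List Entry) (rows : List Row) : List Bool :=
  unaryBound cols rows ++ (unaryBound cols rows ++ [false, false, false])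

theorem polyTime_unaryBound {f : α → List Entry} {g : α → List Row} (hf : PolyTime f)
    (hg : PolyTime g) : PolyTime (fun a => unaryBound (f a) (g a)) :=
  .append (.map hf (.const false)) (.append (.map hg (.const false)) (.const [false, false]))

/-- The encoding of the instance for an incidence structure. -/
def incidenceInstance (cols : List Entry) (rows : List Row) :
    List (List (RawRat × RawRat) × (List Bool × List Bool)) :=
  RawShape.rawInstance (unaryScale cols rows) (vertices cols rows)

theorem polyTime_incidenceInstance {f : α → List Entry} {g : α → List Row} (hf : PolyTime f)
    (hg : PolyTime g) : PolyTime (fun a => incidenceInstance (f a) (g a)) :=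
  RawShape.polyTime_rawInstance (.append (polyTime_unaryBound hf hg)
    (.append (polyTime_unaryBound hf hg) (.const [false, false, false]))) (polyTime_vertices hf hg)

end

/-- Incidence structures are polynomial-time reducible to triangle instances. -/
theorem exists_instance_of_incidence {cols : List Entry} {rows : List Row} (h : Proper cols rows)
    {k : ℕ} (hk : ∀ row ∈ rows, row.2.length = k) :
    ∃ I : TriangleInstance 6, I.enc = code (incidenceInstance cols rows) ∧
      I.IsValid (1 / 40) 80 ∧ (I.HasListHom octahedron ↔ IncidenceSat cols rows) ∧
      I.n = cols.length + (k + 1) * rows.length := by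
  -- Large enough for all indices, and at least 2, as needed for distinct triangles. It is the
  -- length of `unaryBound`.
  set T := cols.length + rows.length + 2 with hT
  refine ⟨Shape.toInstance T (shapes cols rows), ?_,
    Shape.isValid_toInstance (by omega) (h.below (by omega) (by omega)) h.nodup_shapes,
    hasListHom_shapes_iff h T, length_vertices cols rows hk⟩
  refine (RawShape.code_rawInstance (T := T) ?_ (fun q hq => ⟨?_, ?_⟩) h.nodup_shapes).symm
  · simp [unaryScale, unaryBound, hT]; omega
  · exact h.below (by omega) (by omega) (q.1.toShape, q.2) (List.mem_map.2 ⟨q, hq, rfl⟩)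
  · have hq' : (q.1.toShape, q.2) ∈ shapes cols rows := List.mem_map.2 ⟨q, hq, rfl⟩
    have h3 : ∀ {p p' : Shape × List Bool}, p = p' → p.2.length = p'.2.length :=
      fun h => by rw [h]
    rcases mem_shapes.1 hq' with ⟨p, hp, e⟩ | ⟨p, hp, e | ⟨e, he, e'⟩⟩
    · have := h3 e
      have h4 : p.2 ∈ cols := by
        rw [← map_snd_enumUnary cols]; exact List.mem_map_of_mem hp
      simpa [h.mask _ h4] using this
    · simpa [h.row_mask _ (row_mem_of_enumUnary hp)] using h3 e
    · simpa [(h.row_mem _ (row_mem_of_enumUnary hp) e he).2] using h3 e'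

open Sparsify

/-! ## From satisfiability to incidence structures -/

/-- Literals: the key of a variable, and a sign. -/
abbrev Lit : Type := List Bool × Bool

/-- Satisfiability of a list of clauses. -/
def SatCnf (φ : List (List Lit)) : Prop :=
  ∃ a : List Bool → Bool, Hits (fun l : Lit => a l.1 = l.2) φ

/-- The variables that occur. -/
def keys (φ : List (List Lit)) : List (List Bool) := nub (φ.flatMap fun C => C.map Prod.fst)

/-- The three columns of a variable. -/
def varCols (x : List Bool) : List Entry :=
  [(false :: false :: x, [false, true, true]), (false :: true :: x, [true, false, true]),
   (true :: false :: x, [true, true, false])]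

/-- The two rows of a variable. -/
def varRows (x : List Bool) : List Row :=
  [([true, true, false], [(false :: false :: x, [true, true, false]),
     (false :: true :: x, [true, true, false]), (true :: false :: x, [true, true, false])]),
   ([true, true, false], varCols x)]

/-- The row for a clause with three literals. -/
def litRow (l₀ l₁ l₂ : Lit) : Row :=
  ([true, true, true],
   [(false :: false :: l₀.1, bif l₀.2 then [true, true, false] else [true, false, true]),
    (false :: true :: l₁.1, bif l₁.2 then [false, true, true] else [true, true, false]),
    (true :: false :: l₂.1, bif l₂.2 then [false, true, true] else [true, false, true])])

/-- The row of a clause. -/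
def clauseRow (C : List Lit) : Row :=
  litRow (C.headD ([], false)) ((C.tail ++ C).headD ([], false))
    ((C.tail.tail ++ C).headD ([], false))

/-- All columns. -/
def satCols (φ : List (List Lit)) : List Entry := (keys φ).flatMap varCols

/-- All rows. -/
def satRows (φ : List (List Lit)) : List Row := (keys φ).flatMap varRows ++ φ.map clauseRow

/-- Short clauses are padded with their first literal; the defaults of `headD` are never reached.
Repetitions do no harm, as the three positions use different columns of a variable. -/
theorem exists_clauseRow_eq {C : List Lit} (h0 : C ≠ []) (h3 : C.length ≤ 3) :
    ∃ l₀ ∈ C, ∃ l₁ ∈ C, ∃ l₂ ∈ C, clauseRow C = litRow l₀ l₁ l₂ ∧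
      ∀ l ∈ C, l = l₀ ∨ l = l₁ ∨ l = l₂ := by
  match C, h0, h3 with
  | [a], _, _ => exact ⟨a, by simp, a, by simp, a, by simp, rfl, by simp⟩
  | [a, b], _, _ => exact ⟨a, by simp, b, by simp, a, by simp, rfl, by simp⟩
  | [a, b, c], _, _ => exact ⟨a, by simp, b, by simp, c, by simp, rfl, by simp⟩
  | _ :: _ :: _ :: _ :: _, _, h => simp only [List.length_cons] at h; omega

theorem mem_keys {φ : List (List Lit)} {C : List Lit} {l : Lit} (hC : C ∈ φ) (hl : l ∈ C) :
    l.1 ∈ keys φ :=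
  mem_nub.2 (List.mem_flatMap.2 ⟨C, hC, List.mem_map_of_mem hl⟩)

section
variable {φ : List (List Lit)}

theorem proper_sat (hφ : ∀ C ∈ φ, C ≠ [] ∧ C.length ≤ 3) : Proper (satCols φ) (satRows φ) := by
  have hmem : ∀ x ∈ keys φ, false :: false :: x ∈ (satCols φ).map Prod.fst ∧
      false :: true :: x ∈ (satCols φ).map Prod.fst ∧
      true :: false :: x ∈ (satCols φ).map Prod.fst := fun x hx => by
    simp [satCols, varCols, hx]
  have hrow : ∀ row ∈ satRows φ, (∃ x ∈ keys φ, row ∈ varRows x) ∨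
      ∃ l₀ l₁ l₂ : Lit, l₀.1 ∈ keys φ ∧ l₁.1 ∈ keys φ ∧ l₂.1 ∈ keys φ ∧
        row = litRow l₀ l₁ l₂ := by
    intro row hrow
    rcases List.mem_append.1 hrow with h | h
    · exact Or.inl (by simpa using h)
    · obtain ⟨C, hC, rfl⟩ := List.mem_map.1 h
      obtain ⟨l₀, h₀, l₁, h₁, l₂, h₂, e, -⟩ :=
        exists_clauseRow_eq (hφ C hC).1 (hφ C hC).2
      exact Or.inr ⟨l₀, l₁, l₂, mem_keys hC h₀, mem_keys hC h₁, mem_keys hC h₂, e⟩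
  refine ⟨?_, ?_, fun row h => ?_, fun row h => ?_, fun row h e he => ?_⟩
  · rw [satCols, List.map_flatMap, List.nodup_flatMap]
    refine ⟨fun x _ => by simp [varCols], (nodup_nub _).imp fun {x y} hne => ?_⟩
    simp [Function.onFun, varCols, List.disjoint_left, hne]
  · simp only [satCols, List.mem_flatMap, varCols, List.mem_cons, List.not_mem_nil, or_false]
    rintro q ⟨x, -, rfl | rfl | rfl⟩ <;> rfl
  · rcases hrow row h with ⟨x, -, h⟩ | ⟨l₀, l₁, l₂, -, -, -, rfl⟩
    · simp only [varRows, List.mem_cons, List.not_mem_nil, or_false] at h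
      rcases h with rfl | rfl <;> rfl
    · rfl
  · rcases hrow row h with ⟨x, -, h⟩ | ⟨l₀, l₁, l₂, -, -, -, rfl⟩
    · simp only [varRows, List.mem_cons, List.not_mem_nil, or_false] at h
      rcases h with rfl | rfl <;> simp [varCols]
    · simp [litRow]
  · rcases hrow row h with ⟨x, hx, h⟩ | ⟨l₀, l₁, l₂, h₀, h₁, h₂, rfl⟩
    · obtain ⟨m0, m1, m2⟩ := hmem x hx
      simp only [varRows, List.mem_cons, List.not_mem_nil, or_false] at h
      rcases h with rfl | rfl <;>
      · simp only [varCols, List.mem_cons, List.not_mem_nil, or_false] at he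
        rcases he with rfl | rfl | rfl <;> exact ⟨by assumption, rfl⟩
    · simp only [litRow, List.mem_cons, List.not_mem_nil, or_false] at he
      rcases he with rfl | rfl | rfl
      · exact ⟨(hmem _ h₀).1, by cases l₀.2 <;> rfl⟩
      · exact ⟨(hmem _ h₁).2.1, by cases l₁.2 <;> rfl⟩
      · exact ⟨(hmem _ h₂).2.2, by cases l₂.2 <;> rfl⟩

/-- A value for the row that is compatible with the values of its three columns. -/
def RowOk (row m₀ m₁ m₂ : List Bool) (v₀ v₁ v₂ : Fin 3) : Prop :=
  ∃ c, InMask row c ∧ (∃ x, InMask m₀ x ∧ x ≠ c ∧ x ≠ v₀) ∧ (∃ x, InMask m₁ x ∧ x ≠ c ∧ x ≠ v₁) ∧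
    ∃ x, InMask m₂ x ∧ x ≠ c ∧ x ≠ v₂

instance (row m₀ m₁ m₂ : List Bool) (v₀ v₁ v₂ : Fin 3) : Decidable (RowOk row m₀ m₁ m₂ v₀ v₁ v₂) :=
  inferInstanceAs (Decidable (∃ _, _))

theorem rowOk_iff {cc : List Bool → Fin 3} {row m₀ m₁ m₂ κ₀ κ₁ κ₂ : List Bool} :
    (∃ c, InMask row c ∧ ∀ e ∈ [(κ₀, m₀), (κ₁, m₁), (κ₂, m₂)], ∃ x, InMask e.2 x ∧ x ≠ c ∧
      x ≠ cc e.1) ↔ RowOk row m₀ m₁ m₂ (cc κ₀) (cc κ₁) (cc κ₂) := by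
  simp [RowOk]

/-- In the first row all masks are {0, 1}, so a row value `c` forces the three columns into {c, 2}.
In the second row, `c = 0` forces the last two columns to be 0 and `c = 1` forces the first and the
last to be 1. Together with the masks of the columns only (2, 0, 0), for true, and (1, 2, 1), for
false, survive. -/
theorem var_values : ∀ v₀ v₁ v₂ : Fin 3, InMask [false, true, true] v₀ →
    InMask [true, false, true] v₁ → InMask [true, true, false] v₂ →
    RowOk [true, true, false] [true, true, false] [true, true, false] [true, true, false] v₀ v₁ v₂ →
    RowOk [true, true, false] [false, true, true] [true, false, true] [true, true, false] v₀ v₁ v₂ →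
    (v₀ = if v₂ = 0 then 2 else 1) ∧ (v₁ = if v₂ = 0 then 0 else 2) ∧ (v₂ = 0 ∨ v₂ = 1) := by
  decide

theorem var_ok : ∀ b : Bool,
    RowOk [true, true, false] [true, true, false] [true, true, false] [true, true, false]
      (bif b then 2 else 1) (bif b then 0 else 2) (bif b then 0 else 1) ∧
    RowOk [true, true, false] [false, true, true] [true, false, true] [true, true, false]
      (bif b then 2 else 1) (bif b then 0 else 2) (bif b then 0 else 1) ∧
    InMask [false, true, true] (bif b then 2 else 1) ∧
    InMask [true, false, true] (bif b then 0 else 2) ∧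
    InMask [true, true, false] (bif b then 0 else 1) := by
  decide

/-- The value of the row is the position of a true literal. The mask of position `j` consists of `j`
and a value depending on the sign. If the row has value `j`, then the link must take the other
value, which is free exactly if the literal is true; or else the mask also contains a value that the
column never has. For position 0 the roles are as follows: the column has values 1 and 2, so the
link takes 0 whenever the row does not. -/
theorem clause_ok : ∀ b₀ b₁ b₂ s₀ s₁ s₂ : Bool,
    RowOk [true, true, true] (bif s₀ then [true, true, false] else [true, false, true])
      (bif s₁ then [false, true, true] else [true, true, false])
      (bif s₂ then [false, true, true] else [true, false, true])
      (bif b₀ then 2 else 1) (bif b₁ then 0 else 2) (bif b₂ then 0 else 1) ↔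
    (b₀ = s₀ ∨ b₁ = s₁ ∨ b₂ = s₂) := by
  decide

theorem incidenceSat_iff (hφ : ∀ C ∈ φ, C ≠ [] ∧ C.length ≤ 3) :
    IncidenceSat (satCols φ) (satRows φ) ↔ SatCnf φ := by
  constructor
  · rintro ⟨cc, h1, h2⟩
    let a : List Bool → Bool := fun x => decide (cc (true :: false :: x) = 0)
    have hv : ∀ x ∈ keys φ, cc (false :: false :: x) = (bif a x then 2 else 1) ∧
        cc (false :: true :: x) = (bif a x then 0 else 2) ∧
        cc (true :: false :: x) = (bif a x then 0 else 1) := by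
      intro x hx
      have hc : ∀ q ∈ varCols x, InMask q.2 (cc q.1) := fun q hq =>
        h1 q (List.mem_flatMap.2 ⟨x, hx, hq⟩)
      have hr : ∀ row ∈ varRows x, _ := fun row hrow =>
        h2 row (List.mem_append_left _ (List.mem_flatMap.2 ⟨x, hx, hrow⟩))
      obtain ⟨e0, e1, e2⟩ := var_values _ _ _
        (hc (false :: false :: x, [false, true, true]) (by simp [varCols]))
        (hc (false :: true :: x, [true, false, true]) (by simp [varCols]))
        (hc (true :: false :: x, [true, true, false]) (by simp [varCols]))
        (rowOk_iff.1 (hr _ (List.mem_cons_self ..)))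
        (rowOk_iff.1 (hr _ (List.mem_cons_of_mem _ (List.mem_cons_self ..))))
      simp only [a, e0, e1]
      rcases e2 with e2 | e2 <;> simp [e2]
    refine ⟨a, fun C hC => ?_⟩
    obtain ⟨l₀, h₀, l₁, h₁, l₂, h₂, e, -⟩ :=
      exists_clauseRow_eq (hφ C hC).1 (hφ C hC).2
    have hr := h2 (clauseRow C) (List.mem_append_right _ (List.mem_map_of_mem hC))
    rw [e] at hr
    have hr' := rowOk_iff.1 hr
    rw [(hv _ (mem_keys hC h₀)).1, (hv _ (mem_keys hC h₁)).2.1, (hv _ (mem_keys hC h₂)).2.2] at hr'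
    rcases (clause_ok _ _ _ _ _ _).1 hr' with h | h | h
    · exact ⟨l₀, h₀, h⟩
    · exact ⟨l₁, h₁, h⟩
    · exact ⟨l₂, h₂, h⟩
  · rintro ⟨a, ha⟩
    let cc : List Bool → Fin 3 := fun
      | false :: false :: x => bif a x then 2 else 1
      | false :: true :: x => bif a x then 0 else 2
      | true :: false :: x => bif a x then 0 else 1
      -- No column has such a key.
      | _ => 0
    refine ⟨cc, fun q hq => ?_, fun row hrow => ?_⟩
    · obtain ⟨x, -, hq⟩ := List.mem_flatMap.1 hq
      obtain ⟨-, -, m0, m1, m2⟩ := var_ok (a x)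
      simp only [varCols, List.mem_cons, List.not_mem_nil, or_false] at hq
      rcases hq with rfl | rfl | rfl
      · exact m0
      · exact m1
      · exact m2
    · rcases List.mem_append.1 hrow with h | h
      · obtain ⟨x, -, hq⟩ := List.mem_flatMap.1 h
        obtain ⟨r1, r2, -⟩ := var_ok (a x)
        simp only [varRows, List.mem_cons, List.not_mem_nil, or_false] at hq
        rcases hq with rfl | rfl
        · exact rowOk_iff.2 r1
        · exact rowOk_iff.2 r2
      · obtain ⟨C, hC, rfl⟩ := List.mem_map.1 h
        obtain ⟨l₀, h₀, l₁, h₁, l₂, h₂, e, hl⟩ :=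
          exists_clauseRow_eq (hφ C hC).1 (hφ C hC).2
        rw [e]
        refine rowOk_iff.2 ((clause_ok _ _ _ _ _ _).2 ?_)
        obtain ⟨l, hlC, hs⟩ := ha C hC
        rcases hl l hlC with rfl | rfl | rfl
        · exact Or.inl hs
        · exact Or.inr (Or.inl hs)
        · exact Or.inr (Or.inr hs)

/-- The encoding of the instance for a list of clauses. -/
def satInstance (φ : List (List Lit)) : List (List (RawRat × RawRat) × (List Bool × List Bool)) :=
  incidenceInstance (satCols φ) (satRows φ)

theorem exists_instance_of_cnf (hφ : ∀ C ∈ φ, C ≠ [] ∧ C.length ≤ 3) :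
    ∃ I : TriangleInstance 6, I.enc = code (satInstance φ) ∧ I.IsValid (1 / 40) 80 ∧
      (I.HasListHom octahedron ↔ SatCnf φ) ∧ I.n = 11 * (keys φ).length + 4 * φ.length := by
  obtain ⟨I, h1, h2, h3, h4⟩ := exists_instance_of_incidence (proper_sat hφ) (k := 3) fun row h => by
    rcases List.mem_append.1 h with h | h
    · obtain ⟨x, -, h⟩ := List.mem_flatMap.1 h
      simp only [varRows, List.mem_cons, List.not_mem_nil, or_false] at h
      rcases h with rfl | rfl <;> rfl
    · obtain ⟨C, -, rfl⟩ := List.mem_map.1 h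
      rfl
  refine ⟨I, h1, h2, h3.trans (incidenceSat_iff hφ), ?_⟩
  have e1 : (satCols φ).length = 3 * (keys φ).length := by
    simp [satCols, varCols, List.length_flatMap, mul_comm]
  have e2 : (satRows φ).length = 2 * (keys φ).length + φ.length := by
    simp [satRows, varRows, List.length_flatMap, mul_comm]
  rw [h4, e1, e2]
  ring

end

/-! ### The reduction from satisfiability in polynomial time. -/

section
variable {α : Type} [DataEnc α]

theorem polyTime_varCols {f : α → List Bool} (hf : PolyTime f) :
    PolyTime (fun a => varCols (f a)) :=
  .cons (.pair (.cons (.const false) (.cons (.const false) hf)) (.const _)) <|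
  .cons (.pair (.cons (.const false) (.cons (.const true) hf)) (.const _)) <|
  .cons (.pair (.cons (.const true) (.cons (.const false) hf)) (.const _)) (.const [])

theorem polyTime_varRows {f : α → List Bool} (hf : PolyTime f) :
    PolyTime (fun a => varRows (f a)) :=
  .cons (.pair (.const _) <|
    .cons (.pair (.cons (.const false) (.cons (.const false) hf)) (.const _)) <|
    .cons (.pair (.cons (.const false) (.cons (.const true) hf)) (.const _)) <|
    .cons (.pair (.cons (.const true) (.cons (.const false) hf)) (.const _)) (.const [])) <|
  .cons (.pair (.const _) (polyTime_varCols hf)) (.const [])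

theorem polyTime_litRow {f g h : α → Lit} (hf : PolyTime f) (hg : PolyTime g) (hh : PolyTime h) :
    PolyTime (fun a => litRow (f a) (g a) (h a)) :=
  .pair (.const _) <|
    .cons (.pair (.cons (.const false) (.cons (.const false) (.fst' hf)))
      (.cond (.snd' hf) (.const _) (.const _))) <|
    .cons (.pair (.cons (.const false) (.cons (.const true) (.fst' hg)))
      (.cond (.snd' hg) (.const _) (.const _))) <|
    .cons (.pair (.cons (.const true) (.cons (.const false) (.fst' hh)))
      (.cond (.snd' hh) (.const _) (.const _))) (.const [])

theorem polyTime_clauseRow {f : α → List Lit} (hf : PolyTime f) :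
    PolyTime (fun a => clauseRow (f a)) :=
  polyTime_litRow (.headD hf (.const _)) (.headD (.append (.tail hf) hf) (.const _))
    (.headD (.append (.tail (.tail hf)) hf) (.const _))

theorem polyTime_keys : PolyTime (fun φ : List (List Lit) => keys φ) :=
  .comp (g := fun l : List (List Bool) => nub l) polyTime_nub (.flatMap .id (.map .snd (.fst' .snd)))

theorem polyTime_satInstance : PolyTime (fun φ : List (List Lit) => satInstance φ) :=
  polyTime_incidenceInstance (.flatMap polyTime_keys (polyTime_varCols .snd))
    (.append (.flatMap polyTime_keys (polyTime_varRows .snd)) (.map .id (polyTime_clauseRow .snd)))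

end

/-! ## Formulas as lists of clauses -/

/-- The clauses of a formula as lists of literals. -/
def rawClauses (φ : Formula3) : List (List Lit) :=
  φ.clauses.map fun c => List.ofFn fun j : Fin 3 => ((c j).1.val.bits, (c j).2)

theorem enc_formula (φ : Formula3) : φ.enc = code (φ.numVars.bits, rawClauses φ) := by
  rw [Formula3.enc, code_pair]
  congr 1
  change _ = encList ((rawClauses φ).map code)
  rw [rawClauses, List.map_map]
  congr 1

theorem bits_injective : Function.Injective Nat.bits := by
  intro m n h
  have h1 : ∀ n : ℕ, n =
      (n.bits.map fun b => bif b then 1 else 0).foldr (fun b s => b + 2 * s) 0 := by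
    intro n
    induction n using Nat.binaryRec' with
    | zero => simp
    | bit b n hb ih =>
      rw [Nat.bits_append_bit n b hb, List.map_cons, List.foldr_cons, ← ih]
      cases b
      · simp [Nat.bit]
      · simp [Nat.bit]; ring
  rw [h1 m, h1 n, h]

/-- All literals of a formula with `N` variables. -/
def allLits (N : ℕ) : Finset Lit :=
  (Finset.range N ×ˢ (Finset.univ : Finset Bool)).image fun p => (p.1.bits, p.2)

theorem card_allLits_le (N : ℕ) : (allLits N).card ≤ 2 * N := by
  refine Finset.card_image_le.trans ?_
  simp [mul_comm]

theorem satCnf_rawClauses (φ : Formula3) : SatCnf (rawClauses φ) ↔ φ.Satisfiable := by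
  have key : ∀ (a : List Bool → Bool), Hits (fun l : Lit => a l.1 = l.2) (rawClauses φ) ↔
      ∀ c ∈ φ.clauses, ∃ j : Fin 3, a (c j).1.val.bits = (c j).2 := by
    intro a
    simp only [Hits, rawClauses, List.forall_mem_map, List.mem_ofFn]
    exact forall₂_congr fun c _ => by simp only [exists_exists_eq_and]
  constructor
  · rintro ⟨a, ha⟩
    exact ⟨fun i => a i.val.bits, (key a).1 ha⟩
  · rintro ⟨a, ha⟩
    classical
    let b : List Bool → Bool := fun l =>
      if h : ∃ i : Fin φ.numVars, i.val.bits = l then a h.choose else false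
    have hb : ∀ i : Fin φ.numVars, b i.val.bits = a i := fun i => by
      have h : ∃ j : Fin φ.numVars, j.val.bits = i.val.bits := ⟨i, rfl⟩
      simp only [b, dif_pos h]
      exact congrArg a (Fin.ext (bits_injective h.choose_spec))
    refine ⟨b, (key b).2 fun c hc => ?_⟩
    obtain ⟨j, hj⟩ := ha c hc
    exact ⟨j, by rw [hb, hj]⟩

/-- Literals that are tagged with their position in a clause. -/
abbrev TagLit : Type := (Bool × Bool) × Lit

/-- The clause with its first three literals tagged by position. -/
def tagClause (C : List Lit) : List TagLit :=
  [((false, false), C.headD ([], false)), ((false, true), C.tail.headD ([], false)),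
    ((true, false), C.tail.tail.headD ([], false))]

/-- The literal is true under the assignment. -/
def TagHolds (a : List Bool → Bool) (l : TagLit) : Prop := a l.2.1 = l.2.2

/-- All tagged literals of a formula with `N` variables. -/
def tagLits (N : ℕ) : Finset TagLit := Finset.univ ×ˢ allLits N

theorem card_tagLits_le (N : ℕ) : (tagLits N).card ≤ 8 * N := by
  have := card_allLits_le N
  rw [tagLits, Finset.card_product]
  simp only [Finset.card_univ, Fintype.card_prod, Fintype.card_bool]
  omega

/-- The first formula of the sparsification. -/
def start (q : List Bool × List (List Lit)) : List (List TagLit) := reduce (q.2.map tagClause)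

theorem polyTime_start : PolyTime start :=
  .comp (g := fun l : List (List TagLit) => reduce l) polyTime_reduce <|
    .map .snd <|
      .cons (.pair (.const _) (.headD .snd (.const _))) <|
      .cons (.pair (.const _) (.headD (.tail .snd) (.const _))) <|
      .cons (.pair (.const _) (.headD (.tail (.tail .snd)) (.const _))) (.const [])

/-- The tags keep the three entries of a clause distinct, even if a literal is repeated. -/
theorem good_start (φ : Formula3) :
    Good (tagLits φ.numVars) (start (φ.numVars.bits, rawClauses φ)) := by
  refine good_reduce _ _ fun C hC => ?_
  obtain ⟨D, hD, rfl⟩ := List.mem_map.1 hC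
  obtain ⟨c, -, rfl⟩ := List.mem_map.1 hD
  refine ⟨by simp [tagClause], by simp [tagClause], by simp [tagClause], fun l hl => ?_⟩
  have h : ∀ j, ((c j).1.val.bits, (c j).2) ∈ allLits φ.numVars := fun j =>
    Finset.mem_image.2 ⟨((c j).1.val, (c j).2), by simp, rfl⟩
  refine Finset.mem_product.2 ⟨Finset.mem_univ _, ?_⟩
  simp only [tagClause, List.mem_cons, List.not_mem_nil, or_false] at hl
  rcases hl with rfl | rfl | rfl
  · exact h 0
  · exact h 1
  · exact h 2

theorem hits_start (φ : Formula3) (a : List Bool → Bool) :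
    Hits (TagHolds a) (start (φ.numVars.bits, rawClauses φ)) ↔
      Hits (fun l : Lit => a l.1 = l.2) (rawClauses φ) := by
  refine (hits_reduce _ _).trans ?_
  simp only [Hits, List.forall_mem_map, rawClauses]
  exact forall₂_congr fun c _ => by simp [tagClause, TagHolds]

theorem satisfiable_iff_start (φ : Formula3) :
    φ.Satisfiable ↔ ∃ a, Hits (TagHolds a) (start (φ.numVars.bits, rawClauses φ)) := by
  rw [← satCnf_rawClauses]
  exact exists_congr fun a => (hits_start φ a).symm

/-- Owing to the tags all clauses start with length three, so the degree bound required by the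
sparsification holds trivially. Without them, repeated literals could produce many pairs through one
literal. -/
theorem deg_two_start (q : List Bool × List (List Lit)) (h : List TagLit) :
    deg 2 h (start q) = 0 := by
  simp only [deg, flower, List.length_eq_zero_iff, List.filter_eq_nil_iff, Bool.and_eq_true,
    decide_eq_true_eq, not_and]
  intro C hC h2
  obtain ⟨D, -, rfl⟩ := List.mem_map.1 (mem_of_mem_reduce hC)
  simp [tagClause] at h2

/-- The list of clauses without tags. -/
def untag (φ : List (List TagLit)) : List (List Lit) := φ.map fun C => C.map Prod.snd

theorem polyTime_untag : PolyTime untag := .map .id (.map .snd (.snd' .snd))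

theorem length_keys_untag_le {U : Finset TagLit} {φ : List (List TagLit)} (hφ : Good U φ) :
    (keys (untag φ)).length ≤ U.card := by
  have hn : (keys (untag φ)).Nodup := nodup_nub _
  rw [← List.toFinset_card_of_nodup hn]
  refine (Finset.card_le_card fun x hx => ?_).trans
    (Finset.card_image_le (f := fun l : TagLit => l.2.1))
  rw [List.mem_toFinset, keys, mem_nub, List.mem_flatMap] at hx
  obtain ⟨C, hC, hx⟩ := hx
  obtain ⟨D, hD, rfl⟩ := List.mem_map.1 hC
  obtain ⟨k, hk, rfl⟩ := List.mem_map.1 hx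
  obtain ⟨l, hl, rfl⟩ := List.mem_map.1 hk
  exact Finset.mem_image_of_mem (fun l : TagLit => l.2.1) (hφ.mem D hD l hl)

/-- Satisfiability of sparse formulas is linearly reducible to triangle instances. -/
theorem exists_instance_of_good {U : Finset TagLit} {φ : List (List TagLit)} (hφ : Good U φ) {m : ℕ}
    (hm : φ.length ≤ m * U.card) :
    ∃ I : TriangleInstance 6, I.enc = code (satInstance (untag φ)) ∧ I.IsValid (1 / 40) 80 ∧
      (I.HasListHom octahedron ↔ ∃ a, Hits (TagHolds a) φ) ∧ I.n ≤ (11 + 4 * m) * U.card := by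
  obtain ⟨I, h1, h2, h3, h4⟩ := exists_instance_of_cnf (φ := untag φ) fun C hC => by
    obtain ⟨D, hD, rfl⟩ := List.mem_map.1 hC
    exact ⟨by simpa using hφ.ne_nil D hD, by simpa using hφ.length_le D hD⟩
  refine ⟨I, h1, h2, h3.trans (exists_congr fun a => ?_), ?_⟩
  · simp only [Hits, untag, List.forall_mem_map]
    exact forall₂_congr fun C _ => by simp only [List.mem_map, exists_exists_and_eq_and, TagHolds]
  · have := length_keys_untag_le hφ
    have e : (untag φ).length = φ.length := by simp [untag]
    rw [h4, e]
    nlinarith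

/-! ## Running a program on many inputs -/

/-- A bound on the variables of an expression. -/
def Expr.bound : Expr → ℕ
  | var i => i + 1
  | nil => 0
  | cons a b => max a.bound b.bound
  | hd a => a.bound
  | tl a => a.bound

/-- A bound on the variables of a program. -/
def Program.bound : Program → ℕ
  | assign i e => max (i + 1) e.bound
  | seq c d => max c.bound d.bound
  | cond e c d => max e.bound (max c.bound d.bound)
  | loop e c => max e.bound c.bound

theorem Expr.eval_congr {m : ℕ} {s s' : Store} (h : ∀ j < m, s j = s' j) {e : Expr}
    (he : e.bound ≤ m) : e.eval s = e.eval s' := by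
  induction e with
  | var i => exact h i he
  | nil => rfl
  | cons a b iha ihb =>
    simp only [Expr.bound, max_le_iff] at he
    simp only [Expr.eval, iha he.1, ihb he.2]
  | hd a ih => simp only [Expr.eval, ih he]
  | tl a ih => simp only [Expr.eval, ih he]

/-- Variables from `m` on have no influence and are not changed. -/
theorem Runs.frame {P : Program} {s₀ s₀' : Store} {t m : ℕ} (h : Runs P s₀ t s₀')
    (hm : P.bound ≤ m) {s : Store} (hs : ∀ j < m, s j = s₀ j) :
    ∃ s', Runs P s t s' ∧ (∀ j < m, s' j = s₀' j) ∧ ∀ j, m ≤ j → s' j = s j := by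
  induction h generalizing s with
  | assign i e s₁ =>
    simp only [Program.bound, max_le_iff] at hm
    refine ⟨_, Runs.assign i e s, fun j hj => ?_, fun j hj => ?_⟩
    · rw [Expr.eval_congr hs hm.2]
      rcases eq_or_ne j i with rfl | hne
      · simp
      · simp [hne, hs j hj]
    · exact Function.update_of_ne (by omega) _ _
  | seq _ _ ih₁ ih₂ =>
    simp only [Program.bound, max_le_iff] at hm
    obtain ⟨s₁, r₁, a₁, b₁⟩ := ih₁ hm.1 hs
    obtain ⟨s₂, r₂, a₂, b₂⟩ := ih₂ hm.2 a₁
    exact ⟨s₂, r₁.seq r₂, a₂, fun j hj => (b₂ j hj).trans (b₁ j hj)⟩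
  | condTrue he _ ih =>
    simp only [Program.bound, max_le_iff] at hm
    obtain ⟨s₁, r₁, a₁, b₁⟩ := ih hm.2.1 hs
    exact ⟨s₁, .condTrue (by rwa [Expr.eval_congr hs hm.1]) r₁, a₁, b₁⟩
  | condFalse he _ ih =>
    simp only [Program.bound, max_le_iff] at hm
    obtain ⟨s₁, r₁, a₁, b₁⟩ := ih hm.2.2 hs
    exact ⟨s₁, .condFalse (by rwa [Expr.eval_congr hs hm.1]) r₁, a₁, b₁⟩
  | loopStop he =>
    simp only [Program.bound, max_le_iff] at hm
    exact ⟨s, .loopStop (by rwa [Expr.eval_congr hs hm.1]), hs, fun _ _ => rfl⟩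
  | loopStep he _ _ ih₁ ih₂ =>
    have hm' := hm
    simp only [Program.bound, max_le_iff] at hm
    obtain ⟨s₁, r₁, a₁, b₁⟩ := ih₁ hm.2 hs
    obtain ⟨s₂, r₂, a₂, b₂⟩ := ih₂ hm' a₁
    exact ⟨s₂, .loopStep (by rwa [Expr.eval_congr hs hm.1]) r₁ r₂, a₂,
      fun j hj => (b₂ j hj).trans (b₁ j hj)⟩

/-- The program that empties the variables below `m`. -/
def clear : ℕ → Program
  | 0 => Program.assign 0 (Expr.var 0)
  | m + 1 => Program.seq (clear m) (Program.assign m Expr.nil)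

theorem runs_clear (m : ℕ) (s : Store) :
    ∃ s', Runs (clear m) s (2 * m + 2) s' ∧ (∀ j < m, s' j = Data.nil) ∧
      ∀ j, m ≤ j → s' j = s j := by
  induction m with
  | zero =>
    refine ⟨_, Runs.assign 0 _ s, by simp, fun j _ => ?_⟩
    rcases eq_or_ne j 0 with rfl | h
    · simp [Expr.eval]
    · simp [h]
  | succ m ih =>
    obtain ⟨s₁, r, h1, h2⟩ := ih
    refine ⟨_, r.seq (Runs.assign m Expr.nil s₁), fun j hj => ?_, fun j hj => ?_⟩
    · rcases eq_or_ne j m with rfl | h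
      · simp [Expr.eval]
      · rw [Function.update_of_ne h]
        exact h1 j (by omega)
    · rw [Function.update_of_ne (by omega)]
      exact h2 j (by omega)

section
variable {ι α γ : Type} [DataEnc ι] [DataEnc α] [DataEnc γ]

/-- `Explores ch leaf a b n`: the search tree with root `a` and branching `ch` has `n` leaves, and
the disjunction of the answers at the leaves is `b`. -/
inductive Explores (ch : α → List α) (leaf : α → Prop → Prop) (S : ℕ) : α → Prop → ℕ → Prop
  | leaf {a : α} {b : Prop} : codeSize a ≤ S → ch a = [] → leaf a b → Explores ch leaf S a b 1
  | branch {a a₁ a₂ : α} {b b₁ b₂ : Prop} {n₁ n₂ : ℕ} : codeSize a ≤ S → ch a = [a₁, a₂] →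
      (b ↔ b₁ ∨ b₂) → Explores ch leaf S a₁ b₁ n₁ → Explores ch leaf S a₂ b₂ n₂ →
        Explores ch leaf S a b (n₁ + n₂)

/-- `P` gives the answer `b` on the input `x` within time `T`. -/
def Answers (P : Program) (T : ℕ) (x : Data) (b : Prop) : Prop :=
  ∃ t s, Runs P (initStore x) t s ∧ t ≤ T ∧ (s 0 ≠ Data.nil ↔ b)

/-- The body of the main loop of the search: a step of the depth-first search whose stack is in the
variable `m`, and whose answer is in the variable `m + 1`. -/
def searchBody (P chc gc : Program) (m : ℕ) : Program :=
  .seq (.assign (m + 2) (.hd (.var m))) <|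
  .seq (.assign m (.tl (.var m))) <|
  .seq (.assign (m + 3) (.var (m + 2))) <|
  .seq chc <|
  .cond (.var (m + 3))
    (.assign m (.cons (.hd (.var (m + 3))) (.cons (.hd (.tl (.var (m + 3)))) (.var m)))) <|
    .seq gc <| .seq (clear m) <| .seq (.assign 0 (.var (m + 2))) <| .seq P <|
    .cond (.var 0) (.assign (m + 1) (.cons .nil .nil)) (.assign (m + 1) (.var (m + 1)))

/-- The search program. -/
def searchProgram (P stc chc gc : Program) (m : ℕ) : Program :=
  .seq (.assign m (.var 0)) <| .seq stc <| .seq (.assign m (.cons (.var m) .nil)) <|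
  .seq (.assign (m + 1) .nil) <| .seq (.loop (.var m) (searchBody P chc gc m)) <|
  .assign 0 (.var (m + 1))

section
variable {ch : α → List α} {g : α → γ} {P chc gc : Program} {m S Tc Tg T : ℕ}

/-- The part common to leaves and inner nodes: the top of the stack is taken off and its children
are computed. What follows is left open as an arbitrary continuation. -/
theorem runs_search_prefix
    (hch : ∀ (a : α) (s : Store), codeSize a ≤ S → s (m + 3) = code a → ∃ t s', Runs chc s t s' ∧
      s' (m + 3) = code (ch a) ∧ (∀ j < m + 3, s' j = s j) ∧ t ≤ Tc)
    {a : α} {r : Data} {s : Store} (ha : codeSize a ≤ S) (hs : s m = Data.cons (code a) r) :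
    ∃ t s', t ≤ Tc + 8 ∧ s' m = r ∧ s' (m + 1) = s (m + 1) ∧ s' (m + 2) = code a ∧
      s' (m + 3) = code (ch a) ∧ ∀ t' s'', Runs (.cond (.var (m + 3))
        (.assign m (.cons (.hd (.var (m + 3))) (.cons (.hd (.tl (.var (m + 3)))) (.var m)))) <|
        .seq gc <| .seq (clear m) <| .seq (.assign 0 (.var (m + 2))) <| .seq P <|
        .cond (.var 0) (.assign (m + 1) (.cons .nil .nil)) (.assign (m + 1) (.var (m + 1))))
          s' t' s'' → Runs (searchBody P chc gc m) s (t + t') s'' := by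
  let s₁ := Function.update s (m + 2) (code a)
  let s₂ := Function.update s₁ m r
  let s₃ := Function.update s₂ (m + 3) (code a)
  have r₁ : Runs (.assign (m + 2) (.hd (.var m))) s 3 s₁ := by
    have := Runs.assign (m + 2) (.hd (.var m)) s
    simpa [Expr.eval, Expr.cost, hs, Data.hd] using this
  have r₂ : Runs (.assign m (.tl (.var m))) s₁ 3 s₂ := by
    have := Runs.assign m (.tl (.var m)) s₁
    simpa [Expr.eval, Expr.cost, hs, Data.tl, s₁] using this
  have r₃ : Runs (.assign (m + 3) (.var (m + 2))) s₂ 2 s₃ := by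
    have := Runs.assign (m + 3) (.var (m + 2)) s₂
    simpa [Expr.eval, Expr.cost, s₁, s₂] using this
  obtain ⟨t, s₄, r₄, e, fr, ht⟩ := hch a s₃ ha (by simp [s₃])
  refine ⟨3 + (3 + (2 + t)), s₄, by omega, ?_, ?_, ?_, e, fun t' s'' r' => ?_⟩
  · rw [fr _ (by omega)]; simp [s₃, s₂]
  · rw [fr _ (by omega)]; simp [s₃, s₂, s₁]
  · rw [fr _ (by omega)]; simp [s₃, s₂, s₁]
  · have := r₁.seq (r₂.seq (r₃.seq (r₄.seq r')))
    rwa [show 3 + (3 + (2 + t)) + t' = 3 + (3 + (2 + (t + t'))) by ring]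

/-- A tree with `n` leaves has `2 * n - 1` nodes, each costing at most `Tc + Tg + 2 * m + T + 30`;
one such term is moved to the left to avoid subtraction. The loop does not stop after a subtree but
goes on with the rest `r` of the stack, hence the continuation form, in which the two subtrees can
be chained. -/
theorem runs_search (hP : P.bound ≤ m) (hm : 1 ≤ m)
    (hch : ∀ (a : α) (s : Store), codeSize a ≤ S → s (m + 3) = code a → ∃ t s', Runs chc s t s' ∧
      s' (m + 3) = code (ch a) ∧ (∀ j < m + 3, s' j = s j) ∧ t ≤ Tc)
    (hg : ∀ (a : α) (s : Store), codeSize a ≤ S → s (m + 2) = code a → ∃ t s', Runs gc s t s' ∧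
      s' (m + 2) = code (g a) ∧ (∀ j < m + 2, s' j = s j) ∧ t ≤ Tg)
    {a : α} {b : Prop} {n : ℕ}
    (h : Explores ch (fun a b => Answers P T (code (g a)) b) S a b n) {r : Data} {s : Store}
    (hs : s m = Data.cons (code a) r) :
    ∃ t s', t + (Tc + Tg + 2 * m + T + 30) ≤ (Tc + Tg + 2 * m + T + 30) * (2 * n) ∧ s' m = r ∧
      (s' (m + 1) ≠ Data.nil ↔ s (m + 1) ≠ Data.nil ∨ b) ∧
      ∀ t' s'', Runs (.loop (.var m) (searchBody P chc gc m)) s' t' s'' →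
        Runs (.loop (.var m) (searchBody P chc gc m)) s (t + t') s'' := by
  have hne : ∀ {a : α} {r : Data} {s : Store}, s m = Data.cons (code a) r →
      (Expr.var m).eval s ≠ Data.nil := fun h => by simp [Expr.eval, h]
  induction h generalizing r s with
  | @leaf a b ha hc hl =>
    obtain ⟨t₁, s₁, ht₁, e0, e1, e2, e3, r₁⟩ :=
      runs_search_prefix (P := P) (gc := gc) hch ha hs
    obtain ⟨t₂, s₂, r₂, f2, fr, ht₂⟩ := hg a s₁ ha e2
    obtain ⟨s₃, r₃, c₃, d₃⟩ := runs_clear m s₂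
    let s₄ := Function.update s₃ 0 (code (g a))
    have r₄ : Runs (.assign 0 (.var (m + 2))) s₃ 2 s₄ := by
      have := Runs.assign 0 (.var (m + 2)) s₃
      simpa [Expr.eval, Expr.cost, d₃, f2] using this
    obtain ⟨t₅, s₅', r₅', ht₅, hb⟩ := hl
    -- `P` is only known to be correct from an initial store. On the variables below `m`, which are
    -- all that it sees, the cleared store agrees with one; stack and answer lie above and survive.
    obtain ⟨s₅, r₅, a₅, b₅⟩ := r₅'.frame hP (s := s₄) fun j hj => by
      rcases eq_or_ne j 0 with rfl | hj0
      · simp [s₄, initStore]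
      · simp [s₄, initStore, hj0, c₃ j hj]
    rw [← a₅ 0 hm] at hb
    have g4 : ∀ j, m ≤ j → s₄ j = s₂ j := fun j hj => by
      rw [show s₄ j = s₃ j from Function.update_of_ne (by omega) _ _, d₃ j hj]
    have g0 : s₅ m = r := by rw [b₅ _ le_rfl, g4 _ le_rfl, fr _ (by omega), e0]
    have g1 : s₅ (m + 1) = s (m + 1) := by
      rw [b₅ _ (by omega), g4 _ (by omega), fr _ (by omega), e1]
    obtain ⟨t₆, s₆, r₆, ht₆, k0, k1⟩ : ∃ t₆ s₆, Runs (.cond (.var 0)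
        (.assign (m + 1) (.cons .nil .nil)) (.assign (m + 1) (.var (m + 1)))) s₅ t₆ s₆ ∧ t₆ ≤ 6 ∧
        s₆ m = r ∧ (s₆ (m + 1) ≠ Data.nil ↔ s (m + 1) ≠ Data.nil ∨ b) := by
      by_cases h0 : s₅ 0 = Data.nil
      · refine ⟨_, _, .condFalse h0 (.assign _ _ _), by simp [Expr.cost], by simp [g0], ?_⟩
        have : ¬ b := fun hb' => hb.2 hb' h0
        simp [Expr.eval, g1, this]
      · refine ⟨_, _, .condTrue h0 (.assign _ _ _), by simp [Expr.cost], by simp [g0], ?_⟩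
        simp [Expr.eval, hb.1 h0]
    refine ⟨2 + (t₁ + (2 + (t₂ + (2 * m + 2 + (2 + (t₅ + t₆)))))), s₆, by omega, k0, k1,
      fun t' s'' r' => ?_⟩
    · have r₇ := r₁ _ _ (.condFalse (by simp [Expr.eval, e3, hc])
        (r₂.seq (r₃.seq (r₄.seq (r₅.seq r₆)))))
      exact .loopStep (hne hs) r₇ r'
  | @branch a a₁ a₂ b b₁ b₂ n₁ n₂ ha hc hb _ _ ih₁ ih₂ =>
    obtain ⟨t₀, s₀, ht₀, e0, e1, e2, e3, r₀⟩ :=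
      runs_search_prefix (P := P) (gc := gc) hch ha hs
    let s₁ := Function.update s₀ m (Data.cons (code a₁) (Data.cons (code a₂) r))
    have r₁ : Runs (.assign m (.cons (.hd (.var (m + 3)))
        (.cons (.hd (.tl (.var (m + 3)))) (.var m)))) s₀ 9 s₁ := by
      have := Runs.assign m (.cons (.hd (.var (m + 3)))
        (.cons (.hd (.tl (.var (m + 3)))) (.var m))) s₀
      simpa [Expr.eval, Expr.cost, e0, e3, hc, Data.hd, Data.tl] using this
    have r₂ := r₀ _ _ (.condTrue (by simp [Expr.eval, e3, hc]) r₁)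
    obtain ⟨t₃, s₃, ht₃, k0, k1, r₃⟩ := ih₁ (s := s₁) (r := Data.cons (code a₂) r) (by simp [s₁])
    obtain ⟨t₄, s₄, ht₄, l0, l1, r₄⟩ := ih₂ k0
    refine ⟨2 + (t₀ + (2 + 9)) + t₃ + t₄, s₄, ?_, l0, ?_, fun t' s'' r' => ?_⟩
    rotate_left 2
    · have := Runs.loopStep (hne hs) r₂ (r₃ _ _ (r₄ _ _ r'))
      rw [← add_assoc, ← add_assoc] at this
      exact this
    · rw [mul_add, mul_add]
      omega
    · rw [l1, k1, hb, show s₁ (m + 1) = s (m + 1) by simp [s₁, e1], or_assoc]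

end

/-- Depth-first search with a given program for the leaves. -/
theorem exists_search {st : ι → α} {ch : α → List α} {g : α → γ} (hst : PolyTime st)
    (hch : PolyTime ch) (hg : PolyTime g) (P : Program) :
    ∃ (Q : Program) (q : Polynomial ℕ), ∀ (i : ι) (S T n : ℕ) (b : Prop),
      Explores ch (fun a b => Answers P T (code (g a)) b) S (st i) b n → 1 ≤ n →
        Answers Q ((q.eval (codeSize i + S) + T) * (2 * n)) (code i) b := by
  obtain ⟨stc, p₁, hst⟩ := hst
  obtain ⟨chc, p₂, hch⟩ := hch
  obtain ⟨gc, p₃, hg⟩ := hg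
  obtain ⟨m, hm1, hm⟩ : ∃ m, 1 ≤ m ∧ P.bound ≤ m :=
    ⟨_, le_max_left _ _, le_max_right _ _⟩
  refine ⟨searchProgram P (stc m) (chc (m + 3)) (gc (m + 2)) m,
    p₁ + p₂ + p₃ + Polynomial.C (2 * m + 30), fun i S T n b h hn => ?_⟩
  let s₁ := Function.update (initStore (code i)) m (code i)
  have r₁ : Runs (.assign m (.var 0)) (initStore (code i)) 2 s₁ :=
    Runs.assign m (.var 0) (initStore (code i))
  obtain ⟨t₂, s₂, r₂, e₂, -, ht₂, -⟩ := hst i m s₁ (by simp [s₁])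
  let s₃ := Function.update s₂ m (Data.cons (code (st i)) Data.nil)
  have r₃ : Runs (.assign m (.cons (.var m) .nil)) s₂ 4 s₃ := by
    have := Runs.assign m (.cons (.var m) .nil) s₂
    simpa [Expr.eval, Expr.cost, e₂] using this
  let s₄ := Function.update s₃ (m + 1) Data.nil
  have r₄ : Runs (.assign (m + 1) .nil) s₃ 2 s₄ := Runs.assign (m + 1) .nil s₃
  obtain ⟨t₅, s₅, ht₅, k0, k1, r₅⟩ := runs_search hm hm1 (Tc := p₂.eval S)
    (Tg := p₃.eval S) (fun a s ha hs => by
      obtain ⟨t, s', r, e, fr, ht, -⟩ := hch a (m + 3) s hs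
      exact ⟨t, s', r, e, fr, ht.trans (eval_le_eval_of_le _ ha)⟩) (fun a s ha hs => by
      obtain ⟨t, s', r, e, fr, ht, -⟩ := hg a (m + 2) s hs
      exact ⟨t, s', r, e, fr, ht.trans (eval_le_eval_of_le _ ha)⟩) h (s := s₄) (r := Data.nil)
      (by simp [s₄, s₃])
  have r₆ := r₅ _ _ (.loopStop (by simpa [Expr.eval] using k0))
  refine ⟨_, _, r₁.seq (r₂.seq (r₃.seq (r₄.seq (r₆.seq (.assign 0 (.var (m + 1)) s₅))))), ?_, ?_⟩
  · have h1 := eval_le_eval_of_le p₁ (Nat.le_add_right (codeSize i) S)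
    have h2 := eval_le_eval_of_le p₂ (Nat.le_add_left S (codeSize i))
    have h3 := eval_le_eval_of_le p₃ (Nat.le_add_left S (codeSize i))
    simp only [Polynomial.eval_add, Polynomial.eval_C, Expr.cost]
    have h4 : (p₂.eval S + p₃.eval S + 2 * m + T + 30 + p₁.eval (codeSize i)) * (2 * n) ≤
        (p₁.eval (codeSize i + S) + p₂.eval (codeSize i + S) + p₃.eval (codeSize i + S) +
          (2 * m + 30) + T) * (2 * n) := Nat.mul_le_mul_right _ (by omega)
    have h5 : p₁.eval (codeSize i) ≤ p₁.eval (codeSize i) * (2 * n) :=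
      Nat.le_mul_of_pos_right _ (by omega)
    rw [add_mul] at h4
    omega
  · simp [Expr.eval, k1, s₄]

end

/-! ## Sparsification as a search -/

/-- Induction on the potential: with at most `x ^ m₁` and `x ^ m₂` leaves below the children there
are at most `x ^ m` in total, by the choice of `x`. Sizes do not grow, so `S` bounds all nodes. -/
theorem exists_explores {U : Finset TagLit} {c e d S : ℕ} (hc : 1 ≤ c) (he : 1 ≤ e) (hd : 1 ≤ d)
    {x : ℝ} (hx : 1 ≤ x) (hD : ∀ d₁ d₂ m m₁ m₂ : ℕ, Drops c e d d₁ d₂ → m₁ + d₁ ≤ m →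
      m₂ + d₂ ≤ m → x ^ m₁ + x ^ m₂ ≤ x ^ m)
    {leaf : List (List TagLit) → Prop → Prop}
    (hleaf : ∀ φ, Good U φ → codeSize φ ≤ S → φ.length ≤ (1 + c + d) * U.card →
      leaf φ (∃ a, Hits (TagHolds a) φ)) (φ : List (List TagLit)) (hφ : Good U φ)
    (hS : codeSize φ ≤ S) (hK : ∀ a, deg 2 [a] φ ≤ c + e) :
    ∃ n : ℕ, 1 ≤ n ∧ (n : ℝ) ≤ x ^ potential U (c + e) φ ∧
      Explores (children c e d) leaf S φ (∃ a, Hits (TagHolds a) φ) n := by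
  induction hm : potential U (c + e) φ using Nat.strong_induction_on generalizing φ with
  | _ m ih =>
    rcases hφ.children_spec hc he hd hK with ⟨h0, hl⟩ |
      ⟨i, h, d₁, d₂, h0, hF, hn, hd', h1, h2, k1, k2, m1, m2⟩
    · refine ⟨1, le_rfl, by simpa using one_le_pow₀ hx, .leaf hS h0 (hleaf φ hφ hS hl)⟩
    -- The potential drops strictly in both branches, as the induction requires.
    · have hpos : 1 ≤ d₁ ∧ 1 ≤ d₂ := by
        have : 1 ≤ c * (c + e) := Nat.mul_pos hc (by omega)
        have : 1 ≤ e * (c + e) := Nat.mul_pos he (by omega)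
        rcases hd' with ⟨rfl, rfl⟩ | ⟨rfl, rfl⟩ | ⟨rfl, rfl⟩ <;> omega
      obtain ⟨n₁, p₁, q₁, e₁⟩ := ih _ (by omega) _ h1 ((codeSize_heart_le hn hF).trans hS) k1 rfl
      obtain ⟨n₂, p₂, q₂, e₂⟩ := ih _ (by omega) _ h2 (codeSize_petals_le.trans hS) k2 rfl
      refine ⟨n₁ + n₂, by omega, ?_, .branch hS h0 ?_ e₁ e₂⟩
      · push_cast
        exact (add_le_add q₁ q₂).trans (hD _ _ _ _ _ hd' (hm ▸ m1) (hm ▸ m2))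
      · rw [← exists_or]
        exact exists_congr fun a => hits_branch _ _ _ _

/-! ## The lower bound -/

/-- The constant absorbs the finitely many small `n`, as the bound is needed for every instance. -/
theorem exists_add_mul_bound {f : ℕ → ℝ} (hf : f =o[atTop] (fun n : ℕ => (n : ℝ))) {ε : ℝ}
    (hε : 0 < ε) : ∃ B : ℝ, 0 ≤ B ∧ ∀ n, f n ≤ B + ε * n := by
  obtain ⟨n₀, h⟩ := eventually_atTop.1 (hf.def hε)
  refine ⟨∑ i ∈ Finset.range n₀, |f i|, Finset.sum_nonneg fun _ _ => abs_nonneg _, fun n => ?_⟩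
  have h0 : 0 ≤ ε * n := by positivity
  rcases lt_or_ge n n₀ with hn | hn
  · have := Finset.single_le_sum (f := fun i => |f i|) (fun _ _ => abs_nonneg _)
      (Finset.mem_range.2 hn)
    linarith [le_abs_self (f n)]
  · have h1 := h n hn
    have h2 : 0 ≤ ∑ i ∈ Finset.range n₀, |f i| := Finset.sum_nonneg fun _ _ => abs_nonneg _
    rw [Real.norm_eq_abs, Real.norm_eq_abs, Nat.abs_cast] at h1
    linarith [le_abs_self (f n)]

theorem PolyTime.exists_codeSize_le {α β : Type} [DataEnc α] [DataEnc β] {f : α → β}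
    (hf : PolyTime f) : ∃ p : Polynomial ℕ, ∀ a, codeSize (f a) ≤ p.eval (codeSize a) := by
  obtain ⟨_, p, h⟩ := hf
  refine ⟨p, fun a => ?_⟩
  obtain ⟨_, _, _, _, _, _, h⟩ := h a 0 (fun _ => code a) rfl
  exact h

/-- A subexponential algorithm for triangle instances gives fast algorithms for 3-SAT. -/
theorem exists_decides_of_solves {f : ℕ → ℝ} (hf : f =o[atTop] (fun n : ℕ => (n : ℝ)))
    {P : Program} (hP : SolvesLHom octahedron (1 / 40) 80 f P) {δ : ℝ} (hδ : 0 < δ) :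
    ∃ (Q : Program) (p : Polynomial ℕ), DecidesInTime Q Formula3.enc (fun _ => True)
      Formula3.Satisfiable
      (fun φ => (2 : ℝ) ^ (δ * (φ.numVars : ℝ)) * ((p.eval φ.enc.size : ℕ) : ℝ)) := by
  obtain ⟨p, hP⟩ := hP
  -- There are at most 8 N tagged literals, that is, twice 4 N; with δ / 8 this allows 2 ^ (δ N / 2)
  -- leaves. The other half of the exponent is left for the time spent at a leaf.
  obtain ⟨c, e, d, hc, he, hd, x, hx, hxn, hD⟩ := exists_thresholds (ε := δ / 8) (by positivity)
  -- The number of triangles at a leaf, per variable of the formula.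
  set A : ℕ := (11 + 4 * (1 + c + d)) * 8 with hA
  have hA0 : (0 : ℝ) < A := by positivity
  obtain ⟨B, hB, hfB⟩ := exists_add_mul_bound hf (ε := δ / (2 * A)) (by positivity)
  have hgt : PolyTime (fun φ : List (List TagLit) => satInstance (untag φ)) :=
    polyTime_satInstance.comp polyTime_untag
  obtain ⟨Q, q, hQ⟩ := exists_search polyTime_start (polyTime_children (α := TagLit) c e d) hgt P
  obtain ⟨p₁, size_start⟩ := polyTime_start.exists_codeSize_le
  obtain ⟨p₂, size_inst⟩ := hgt.exists_codeSize_le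
  obtain ⟨K, hK⟩ := exists_nat_ge ((2 : ℝ) ^ B)
  refine ⟨Q, 2 * q.comp (Polynomial.X + p₁) + Polynomial.C (2 * K) * p.comp (p₂.comp p₁),
    fun φ _ => ?_⟩
  set N := φ.numVars with hN
  set i : List Bool × List (List Lit) := (φ.numVars.bits, rawClauses φ) with hi
  have hz : φ.enc.size = codeSize i := by rw [enc_formula, codeSize]
  set z := codeSize i with hzi
  set S := p₁.eval z with hS
  set W : ℕ := p.eval (p₂.eval S) with hW
  have hR : (1 : ℝ) ≤ 2 ^ (δ / 2 * N) := Real.one_le_rpow (by norm_num) (by positivity)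
  set R : ℝ := 2 ^ (δ / 2 * N) with hRdef
  have hRR : (2 : ℝ) ^ (δ * N) = R * R := by
    rw [hRdef, ← Real.rpow_add (by norm_num)]; ring_nf
  have hcard := card_tagLits_le N
  -- The time for a leaf: `K * R` bounds the exponential factor, with `K` absorbing 2 ^ `B`, and `W`
  -- bounds the polynomial one.
  set T : ℕ := ⌊K * R * W⌋₊ with hT
  have hT' : (T : ℝ) ≤ K * R * W := Nat.floor_le (by positivity)
  obtain ⟨n, hn1, hn2, hE⟩ := exists_explores (U := tagLits N) (S := S) hc he hd hx hD
    (leaf := fun ψ b => Answers P T (code (satInstance (untag ψ))) b) (fun ψ hψ hs hl => by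
      obtain ⟨I, hI1, hI2, hI3, hI4⟩ := exists_instance_of_good hψ hl
      obtain ⟨t, s, r, ht, ha⟩ := hP I hI2
      refine ⟨t, s, hI1 ▸ r, Nat.le_floor (ht.trans ?_), ha.trans hI3⟩
      have hn : I.n ≤ A * N := hI4.trans (by rw [hA, mul_assoc]; exact Nat.mul_le_mul_left _ hcard)
      have hn' : (I.n : ℝ) ≤ A * N := by exact_mod_cast hn
      have hsz : I.enc.size ≤ p₂.eval S := by
        rw [hI1]; exact (size_inst ψ).trans (eval_le_eval_of_le _ hs)
      have hf1 : f I.n ≤ B + δ / 2 * N := by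
        refine (hfB I.n).trans (add_le_add le_rfl ?_)
        calc δ / (2 * A) * I.n ≤ δ / (2 * A) * (A * N) := by gcongr
          _ = δ / 2 * N := by field_simp
      have hf2 : (2 : ℝ) ^ f I.n ≤ K * R :=
        calc (2 : ℝ) ^ f I.n ≤ 2 ^ (B + δ / 2 * N) :=
            Real.rpow_le_rpow_of_exponent_le (by norm_num) hf1
          _ = 2 ^ B * R := Real.rpow_add (by norm_num) _ _
          _ ≤ K * R := by gcongr
      have hw : ((p.eval I.enc.size : ℕ) : ℝ) ≤ W := by exact_mod_cast eval_le_eval_of_le p hsz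
      exact mul_le_mul hf2 hw (by positivity) (by positivity)) (start i)
    (good_start φ) (size_start i) (fun a => by simp [deg_two_start])
  have hnR : (n : ℝ) ≤ R := by
    -- The potential is at most `2 * (c + e)` times the number of tagged literals, so `hxn` applies
    -- with `4 * N`.
    refine hn2.trans (le_trans (pow_le_pow_right₀ hx ?_) ((hxn (4 * N)).trans (le_of_eq ?_)))
    · calc potential (tagLits N) (c + e) (start i) ≤ 2 * (c + e) * (tagLits N).card :=
            (Nat.sub_le _ _).trans (Nat.mul_le_mul_left _ (Nat.sub_le _ _))
        _ ≤ 2 * (c + e) * (2 * (4 * N)) := Nat.mul_le_mul_left _ (by omega)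
    · rw [hRdef]; congr 1; push_cast; ring
  obtain ⟨t, s, r, ht, ha⟩ := hQ i S T n _ hE hn1
  refine ⟨t, s, enc_formula φ ▸ r, ?_, ha.trans (satisfiable_iff_start φ).symm⟩
  beta_reduce
  rw [hz]
  set q₀ : ℕ := q.eval (z + S) with hq₀
  have e1 : (((2 * q.comp (Polynomial.X + p₁) + Polynomial.C (2 * K) *
      p.comp (p₂.comp p₁)).eval z : ℕ) : ℝ) = 2 * q₀ + 2 * K * W := by
    simp [hq₀, hW, hS]
  rw [e1, hRR]
  have e2 : (t : ℝ) ≤ (q₀ + T) * (2 * n) := by exact_mod_cast ht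
  have hq0 : (0 : ℝ) ≤ q₀ := by positivity
  calc (t : ℝ) ≤ (q₀ + T) * (2 * n) := e2
    _ ≤ (q₀ * R + K * R * W) * (2 * R) := by
      gcongr
      exact le_mul_of_one_le_right hq0 hR
    _ = R * R * (2 * q₀ + 2 * K * W) := by ring

theorem mainTheorem6 (hETH : ExponentialTimeHypothesis) :
    ∃ (k : ℕ) (H : LoopGraph (Fin k)), H.IsReflexive ∧ H.mrc = 3 ∧
      ∃ α β : ℝ, 0 < α ∧ 0 < β ∧
        ∀ f : ℕ → ℝ, f =o[atTop] (fun n : ℕ => (n : ℝ)) →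
          ¬ ∃ P : Program, SolvesLHom H α β f P := by
  obtain ⟨δ, hδ, h⟩ := hETH
  refine ⟨6, octahedron, octahedron_isReflexive, octahedron_mrc, 1 / 40, 80, by norm_num,
    by norm_num, fun f hf ⟨P, hP⟩ => h (exists_decides_of_solves hf hP hδ)⟩
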